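/- Let $\alpha\in(0,2]$, $c>0$, $a>0$. Let $(X_j(t),t\ge 0)$, $j\in\mathbb Z$, be independent symmetric $\alpha$-stable Lévy processes started at $0$ with $\mathbb E[e^{i\theta X_j(t)}]=\exp(-tc|\theta|^{\alpha})$ (Gaussian if $\alpha=2$), and let $\epsilon$ be uniform on $[0,1]$ and independent of $(X_j)_{j\in\mathbb Z}$. Put $u_j=a(j-\epsilon)$ and let $N_t[0,x]$ be the number of $j\in\mathbb Z$ with $X_j(t)+u_j\in[0,x]$. Let $x\mapsto\widehat N_t[0,x]$, $x\ge0$, be the continuous function obtained from the step function $x\mapsto N_t[0,x]$ by interpolating linearly between its values at consecutive nodes, the nodes being $0$ and the points of discontinuity in $(0,\infty)$. Define $$\widehat Z_t(s)=\frac{\widehat N_t[0,s t^{1/\alpha}]-s t^{1/\alpha}/a}{t^{1/(2\alpha)}},\qquad s\in[0,1].$$ Let $$f(s)=\frac{4s}{a\pi}\int_0^\infty\frac{\sin^2(u/2)}{u^2}\Bigl(1-e^{-2c(u/s)^{\alpha}}\Bigr)\,du\quad(s>0),\qquad f(0)=0 .$$ Theorem. For every $t>0$, almost surely $N_t[0,x]<\infty$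 for all $x\ge0$ and $\widehat Z_t$ is a continuous function on $[0,1]$. There is exactly one probability measure $Q$ on $C[0,1]$ (with the uniform topology and its Borel $\sigma$-algebra) that is the law of a centered Gaussian process $G$ on $[0,1]$ with $$\operatorname{Cov}(G(r),G(s))=\tfrac12\bigl(f(r)+f(s)-f(|r-s|)\bigr),\qquad r,s\in[0,1],$$ and the laws of $\widehat Z_t$ on $C[0,1]$ converge weakly to $Q$ as $t\to\infty$. -/

import Mathlib

open MeasureTheory ProbabilityTheory Filter Topology
open scoped NNReal unitInterval

noncomputable section

namespace StableFluct

/-- The space `C[0,1]` (with the topology of uniform convergence) carries its Borel σ-algebra. -/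
instance instMeasurableSpacePath : MeasurableSpace C(I, ℝ) := borel _

instance instBorelSpacePath : BorelSpace C(I, ℝ) := ⟨rfl⟩

variable {Ω : Type*} [MeasurableSpace Ω]

/-- A real-valued Lévy process indexed by `[0,∞)`: it starts at `0`, has independent and
stationary increments, and almost all of its paths are right-continuous with left limits. -/
structure IsLevyProcess (X : ℝ≥0 → Ω → ℝ) (P : Measure Ω) : Prop where
  measurable : ∀ t, Measurable (X t)
  start_zero : ∀ᵐ ω ∂P, X 0 ω = 0
  indep_increments : HasIndepIncrements X P
  stationary_increments : ∀ s h : ℝ≥0,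
    P.map (fun ω => X (s + h) ω - X s ω) = P.map (fun ω => X h ω)
  cadlag : ∀ᵐ ω ∂P, ∀ t : ℝ≥0,
    ContinuousWithinAt (fun u => X u ω) (Set.Ici t) t ∧
      ∃ l : ℝ, Tendsto (fun u => X u ω) (𝓝[<] t) (𝓝 l)

/-- A symmetric `α`-stable process with scale parameter `c`: a Lévy process with
`E[exp(i θ X(t))] = exp(-t c |θ|^α)`. -/
structure IsSymmetricStableProcess (α c : ℝ) (X : ℝ≥0 → Ω → ℝ) (P : Measure Ω) : Prop where
  levy : IsLevyProcess X P
  charFun_eq : ∀ (t : ℝ≥0) (θ : ℝ),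
    charFun (P.map (X t)) θ = ((Real.exp (-((t : ℝ) * c * |θ| ^ α)) : ℝ) : ℂ)

/-- The position at time `t` of the `j`-th particle, which starts from `u_j = a (j - ε)`. -/
def position (a : ℝ) (X : ℤ → ℝ≥0 → Ω → ℝ) (ε : Ω → ℝ) (t : ℝ≥0) (ω : Ω) (j : ℤ) : ℝ :=
  X j t ω + a * ((j : ℝ) - ε ω)

/-- The number `N_t[0,x]` of particles in the interval `[0,x]` at time `t`
(for `x < 0` the interval is empty and the value is `0`). -/
def count (a : ℝ) (X : ℤ → ℝ≥0 → Ω → ℝ) (ε : Ω → ℝ) (t : ℝ≥0) (ω : Ω) (x : ℝ) : ℝ :=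
  (({j : ℤ | position a X ε t ω j ∈ Set.Icc 0 x}).ncard : ℝ)

/-- The points of discontinuity of `F` in `(0,∞)`. -/
def jumps (F : ℝ → ℝ) : Set ℝ := {y | 0 < y ∧ ¬ ContinuousAt F y}

/-- The last node (the origin or a jump of `F`) that is at most `x`. -/
def leftNode (F : ℝ → ℝ) (x : ℝ) : ℝ := sSup (insert 0 {y ∈ jumps F | y ≤ x})

/-- The first jump of `F` after `x`. -/
def rightNode (F : ℝ → ℝ) (x : ℝ) : ℝ := sInf {y ∈ jumps F | x < y}

/-- Linear interpolation, on `[0,∞)`, of a step function `F` between its values at the nodes,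
i.e. at the origin and at the points of discontinuity of `F`. -/
def interpolate (F : ℝ → ℝ) (x : ℝ) : ℝ :=
  F (leftNode F x) + (x - leftNode F x) / (rightNode F x - leftNode F x) *
    (F (rightNode F x) - F (leftNode F x))

/-- The interpolated fluctuation process
`Ẑ_t(s) = (N̂_t[0, s t^{1/α}] - s t^{1/α} / a) / t^{1/(2α)}`. -/
def fluct (α a : ℝ) (X : ℤ → ℝ≥0 → Ω → ℝ) (ε : Ω → ℝ) (t : ℝ≥0) (ω : Ω) (s : ℝ) : ℝ :=
  (interpolate (count a X ε t ω) (s * (t : ℝ) ^ (1 / α)) - s * (t : ℝ) ^ (1 / α) / a) /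
    (t : ℝ) ^ (1 / (2 * α))

open Classical in
/-- The path `s ↦ Ẑ_t(s)`, `s ∈ [0,1]`, as an element of `C[0,1]`. On the exceptional event where
it is not continuous the value is immaterial; it is set to the zero path. -/
def fluctPath (α a : ℝ) (X : ℤ → ℝ≥0 → Ω → ℝ) (ε : Ω → ℝ) (t : ℝ≥0) (ω : Ω) : C(I, ℝ) :=
  if h : Continuous (fun s : I => fluct α a X ε t ω (s : ℝ)) then
    ⟨fun s : I => fluct α a X ε t ω (s : ℝ), h⟩
  else 0

/-- `f(s) = (4 s / (a π)) ∫_0^∞ (sin²(u/2) / u²) (1 - exp(-2 c (u/s)^α)) du`,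
with `f(0) = 0`. -/
def limitVar (α c a s : ℝ) : ℝ :=
  4 * s / (a * Real.pi) *
    ∫ u in Set.Ioi (0 : ℝ),
      Real.sin (u / 2) ^ 2 / u ^ 2 * (1 - Real.exp (-(2 * c * (u / s) ^ α)))

/-- `Q` is the law on `C[0,1]` of the centered Gaussian process `G` with covariance
`Cov(G(r), G(s)) = (f(r) + f(s) - f(|r - s|)) / 2`: this is the law of the
coordinate process under `Q`. -/
structure IsLimitLaw (α c a : ℝ) (Q : Measure C(I, ℝ)) : Prop where
  gaussian : IsGaussianProcess (fun (s : I) (g : C(I, ℝ)) => g s) Q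
  centered : ∀ s : I, ∫ g : C(I, ℝ), g s ∂Q = 0
  covariance_eq : ∀ r s : I,
    covariance (fun g : C(I, ℝ) => g r) (fun g : C(I, ℝ) => g s) Q =
      (limitVar α c a r + limitVar α c a s - limitVar α c a |(r : ℝ) - (s : ℝ)|) / 2

end StableFluct

end

open MeasureTheory ProbabilityTheory Filter Topology
open scoped NNReal unitInterval

namespace StableFluct

/-! ### The sinc-squared integral behind the limiting variance. -/

section SincSquared

open Real Set

/-! Fix `t` and put `T = t^{1/α}`. At time `t` the particles form a lattice of spacing `a` with a
random shift, perturbed by independent displacements of a common law. For a frozen shift, the number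
of particles in `(0, sT]` is a sum over `j ∈ ℤ` of independent indicators, and it is divided by `√T
→ ∞`. A central limit theorem for bounded independent summands then needs only the sums of the means
and of the variances. Both are found up to `O(1)` uniformly in the shift, so the shift does not
affect the limit.

The variance comes from symmetrisation: with independent copies `ξ, ξ'` of a displacement, `Var f(ξ)
= ½ E (f(ξ) - f(ξ'))²`. Summing over the lattice before averaging turns the total variance into half
the expected number of lattice sites at which exactly one of the two displacements lands in `(0,
q]`. The corresponding symmetric difference consists of two intervals of length `min q |ξ - ξ'|`, so
the total is `E min q |ξ - ξ'| / a + O(1)` (`exists_hasSum_variance`). By stable scaling `ξ - ξ'`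
has the law of `T D`, where `D` has characteristic function `exp(-2c|θ|^α)`. Writing `min s |y|` as
an integral of `1 - cos` gives `E min s |D| = a f(s)` (`integral_min_abs_eq_limitVar`). Covariances
follow by polarisation, because the increment between `r` and `s` is the same statistic for an
interval of length `|r - s| T`.

Finite-dimensional convergence is `norm_integral_cexp_stepFluct_sub_le`. For tightness, the centred
count in an interval of length `ℓ ≥ 1` has fourth moment `O(ℓ²)`. Dyadic chaining down to length
about `1`, below which monotonicity of the count takes over, controls the oscillation
(`measure_oscillation_stepFluct_le`). Interpolation alters the count by at most `1`, which is
negligible after division by `√T`.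

Arzelà–Ascoli and Prokhorov give limit points, and characteristic functions identify them
(`exists_tendsto_of_charFun_of_oscSet`). The Gaussian law `Q` is itself obtained as such a limit
point, so no separate construction of a continuous Gaussian process is needed. -/

lemma integral_mul_exp_neg_mul_Ioi {u : ℝ} (hu : 0 < u) :
    ∫ x in Ioi (0 : ℝ), x * exp (-(u * x)) = 1 / u ^ 2 := by
  have h := Real.integral_rpow_mul_exp_neg_mul_Ioi (a := 2) (r := u) two_pos hu
  rw [show (2 : ℝ) - 1 = 1 by norm_num] at h
  simp only [rpow_one, Gamma_two, mul_one] at h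
  rw [h]
  norm_num

lemma integrableOn_exp_neg_mul_mul_cos {x : ℝ} (hx : 0 < x) :
    IntegrableOn (fun u => exp (-(x * u)) * cos u) (Ioi 0) := by
  have h := (integrableOn_exp_mul_complex_Ioi (a := -x + Complex.I) (by simpa using hx) 0).re
  refine h.congr (Filter.Eventually.of_forall fun u => ?_)
  simp [Complex.exp_re, mul_comm]

lemma integral_exp_neg_mul_mul_cos_Ioi {x : ℝ} (hx : 0 < x) :
    ∫ u in Ioi (0 : ℝ), exp (-(x * u)) * cos u = x / (1 + x ^ 2) := by
  have hre : (-x + Complex.I : ℂ).re < 0 := by simpa using hx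
  have h := integral_exp_mul_complex_Ioi hre 0
  have h2 := integral_re (integrableOn_exp_mul_complex_Ioi hre 0)
  rw [h] at h2
  have h3 : ∫ u in Ioi (0 : ℝ), exp (-(x * u)) * cos u =
      ∫ u in Ioi (0 : ℝ), RCLike.re (Complex.exp ((-x + Complex.I) * u)) := by
    congr 1 with u
    simp [Complex.exp_re, mul_comm]
  rw [h3, h2]
  simp [Complex.div_re, Complex.normSq_apply]
  field_simp
  ring

lemma integral_mul_exp_neg_mul_one_sub_cos {x : ℝ} (hx : 0 < x) :
    ∫ u in Ioi (0 : ℝ), x * exp (-(u * x)) * (1 - cos u) = (1 + x ^ 2)⁻¹ := by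
  have h1 := integral_exp_mul_Ioi (a := -x) (by simpa using hx) 0
  have i1 : IntegrableOn (fun u => exp (-x * u)) (Ioi 0) := integrableOn_exp_mul_Ioi (by simpa using hx) 0
  have : ∀ u, x * exp (-(u * x)) * (1 - cos u)
      = x * (exp (-x * u) - exp (-(x * u)) * cos u) := by
    intro u
    rw [show -(u * x) = -x * u by ring, show -(x * u) = -x * u by ring]
    ring
  simp_rw [this]
  rw [integral_const_mul, integral_sub i1 (integrableOn_exp_neg_mul_mul_cos hx), h1,
    integral_exp_neg_mul_mul_cos_Ioi hx]
  simp
  field_simp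
  ring

/-- Replace `1/u²` by `∫ x e^{-ux} dx` and swap: the integral over `u` becomes `1/(1+x²)`, whose
integral is `π/2`. In `ENNReal` the swap needs no integrability, which is instead deduced from the
finite value. -/
lemma lintegral_one_sub_cos_div_sq :
    ∫⁻ u in Ioi (0 : ℝ), ENNReal.ofReal ((1 - cos u) / u ^ 2) = ENNReal.ofReal (π / 2) := by
  have hcos : ∀ u : ℝ, 0 ≤ 1 - cos u := fun u => by linarith [cos_le_one u]
  have e1 : ∀ u ∈ Ioi (0 : ℝ), ENNReal.ofReal ((1 - cos u) / u ^ 2) =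
      ∫⁻ x in Ioi (0 : ℝ), ENNReal.ofReal (x * exp (-(u * x)) * (1 - cos u)) := by
    intro u hu
    rw [mem_Ioi] at hu
    have h := integral_mul_exp_neg_mul_Ioi hu
    have hi : IntegrableOn (fun x => x * exp (-(u * x))) (Ioi 0) :=
      .of_integral_ne_zero (by rw [h]; positivity)
    rw [← ofReal_integral_eq_lintegral_ofReal (hi.mul_const _), integral_mul_const, h]
    · ring_nf
    · filter_upwards [ae_restrict_mem measurableSet_Ioi] with x (hx : 0 < x)
      have := hcos u
      positivity
  have e2 : ∀ x ∈ Ioi (0 : ℝ), ∫⁻ u in Ioi (0 : ℝ),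
      ENNReal.ofReal (x * exp (-(u * x)) * (1 - cos u)) = ENNReal.ofReal ((1 + x ^ 2)⁻¹) := by
    intro x hx
    rw [mem_Ioi] at hx
    have h := integral_mul_exp_neg_mul_one_sub_cos hx
    rw [← ofReal_integral_eq_lintegral_ofReal (.of_integral_ne_zero (by rw [h]; positivity)), h]
    refine Filter.Eventually.of_forall fun u => ?_
    have := hcos u
    have := hx.le
    show 0 ≤ x * exp (-(u * x)) * (1 - cos u)
    positivity
  rw [setLIntegral_congr_fun measurableSet_Ioi e1,
    lintegral_lintegral_swap (by fun_prop), setLIntegral_congr_fun measurableSet_Ioi e2,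
    ← ofReal_integral_eq_lintegral_ofReal integrable_inv_one_add_sq.integrableOn,
    integral_Ioi_inv_one_add_sq]
  · simp
  · exact Filter.Eventually.of_forall fun x => by show 0 ≤ (1 + x ^ 2)⁻¹; positivity

lemma integrableOn_one_sub_cos_div_sq :
    IntegrableOn (fun u => (1 - cos u) / u ^ 2) (Ioi 0) := by
  refine ⟨Measurable.aestronglyMeasurable (by fun_prop), ?_⟩
  rw [hasFiniteIntegral_iff_ofReal, lintegral_one_sub_cos_div_sq]
  · exact ENNReal.ofReal_lt_top
  · exact Filter.Eventually.of_forall fun u =>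
      div_nonneg (by linarith [cos_le_one u]) (sq_nonneg u)

lemma integral_one_sub_cos_div_sq :
    ∫ u in Ioi (0 : ℝ), (1 - cos u) / u ^ 2 = π / 2 := by
  rw [integral_eq_lintegral_of_nonneg_ae, lintegral_one_sub_cos_div_sq,
    ENNReal.toReal_ofReal (by positivity)]
  · exact Filter.Eventually.of_forall fun u =>
      div_nonneg (by linarith [cos_le_one u]) (sq_nonneg u)
  · exact Measurable.aestronglyMeasurable (by fun_prop)

lemma hasIntegral_one_sub_cos_mul_div_sq (z : ℝ) :
    IntegrableOn (fun u => (1 - cos (z * u)) / u ^ 2) (Ioi 0) ∧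
      ∫ u in Ioi (0 : ℝ), (1 - cos (z * u)) / u ^ 2 = |z| * (π / 2) := by
  rcases eq_or_ne z 0 with rfl | hz
  · simp
  have hz' : 0 < |z| := abs_pos.2 hz
  have h1 : ∀ u, (1 - cos (z * u)) / u ^ 2 =
      |z| ^ 2 * ((1 - cos (|z| * u)) / (|z| * u) ^ 2) := by
    intro u
    have : cos (|z| * u) = cos (z * u) := by
      rcases abs_choice z with h | h <;> rw [h]
      rw [neg_mul, cos_neg]
    rw [this, mul_pow]
    rcases eq_or_ne u 0 with rfl | hu
    · simp
    field_simp
  simp_rw [h1]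
  have hi : IntegrableOn (fun u => (1 - cos (|z| * u)) / (|z| * u) ^ 2) (Ioi 0) :=
    (integrableOn_Ioi_comp_mul_left_iff (fun u => (1 - cos u) / u ^ 2) 0 hz').2
      (by simpa using integrableOn_one_sub_cos_div_sq)
  refine ⟨Integrable.const_mul hi _, ?_⟩
  rw [integral_const_mul, integral_comp_mul_left_Ioi (fun u => (1 - cos u) / u ^ 2) 0 hz',
    mul_zero, integral_one_sub_cos_div_sq, smul_eq_mul]
  field_simp

/-- The elementary integral behind the variance formula. -/
lemma integral_sin_sq_mul_one_sub_cos (z : ℝ) :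
    ∫ u in Ioi (0 : ℝ), sin (u / 2) ^ 2 / u ^ 2 * (1 - cos (z * u)) = π / 4 * min 1 |z| := by
  -- Product-to-sum formulas linearise `(1 - cos u)(1 - cos zu)/2` into terms `1 - cos(ku)` with `k
  -- = 1, z, 1 + z, 1 - z`, each of known integral `|k| π/2`.
  have h : ∀ u : ℝ, sin (u / 2) ^ 2 / u ^ 2 * (1 - cos (z * u)) =
      2⁻¹ * ((1 - cos (1 * u)) / u ^ 2) + 2⁻¹ * ((1 - cos (z * u)) / u ^ 2)
      - 4⁻¹ * ((1 - cos ((1 + z) * u)) / u ^ 2) - 4⁻¹ * ((1 - cos ((1 - z) * u)) / u ^ 2) := by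
    intro u
    have h1 : sin (u / 2) ^ 2 = (1 - cos u) / 2 := by
      have := cos_sq (u / 2)
      rw [sin_sq, this]
      ring_nf
    rw [h1, add_mul, sub_mul, cos_add, cos_sub, one_mul]
    ring
  have Int : ∀ z : ℝ, Integrable (fun u => (1 - cos (z * u)) / u ^ 2) (volume.restrict (Ioi 0)) := fun z => (hasIntegral_one_sub_cos_mul_div_sq z).1
  have V := fun z => (hasIntegral_one_sub_cos_mul_div_sq z).2
  simp_rw [h]
  have A := fun k z : ℝ => (Int z).const_mul k
  have S1 := (A 2⁻¹ 1).add (A 2⁻¹ z)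
  have S2 := S1.sub (A 4⁻¹ (1 + z))
  have key := integral_sub S2 (A 4⁻¹ (1 - z))
  have key2 := integral_sub S1 (A 4⁻¹ (1 + z))
  have key3 := integral_add (A 2⁻¹ 1) (A 2⁻¹ z)
  simp only [Pi.sub_apply, Pi.add_apply] at key key2 key3
  rw [key, key2, key3]
  simp_rw [integral_const_mul, V]
  -- Equivalent to `|1 + z| + |1 - z| = 2 max 1 |z|`.
  have : min 1 |z| = (|1| + |z| - (|1 + z| + |1 - z|) / 2) := by
    rcases le_total 0 z with h0 | h0 <;> rcases le_total 1 |z| with h1 | h1 <;>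
      simp only [h1, min_eq_left, min_eq_right, abs_one]
    · rw [abs_of_nonneg h0] at *
      rw [abs_of_nonneg (by linarith : 0 ≤ 1 + z), abs_of_nonpos (by linarith : 1 - z ≤ 0)]; ring
    · rw [abs_of_nonneg h0] at *
      rw [abs_of_nonneg (by linarith : 0 ≤ 1 + z), abs_of_nonneg (by linarith : 0 ≤ 1 - z)]; ring
    · rw [abs_of_nonpos h0] at *
      rw [abs_of_nonpos (by linarith : 1 + z ≤ 0), abs_of_nonneg (by linarith : 0 ≤ 1 - z)]; ring
    · rw [abs_of_nonpos h0] at *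
      rw [abs_of_nonneg (by linarith : 0 ≤ 1 + z), abs_of_nonneg (by linarith : 0 ≤ 1 - z)]; ring
  rw [this]
  ring

lemma integrableOn_sin_sq_div_sq :
    IntegrableOn (fun u : ℝ => sin (u / 2) ^ 2 / u ^ 2) (Ioi 0) := by
  refine (Integrable.const_mul integrableOn_one_sub_cos_div_sq 2⁻¹).congr
    (Filter.Eventually.of_forall fun u => ?_)
  have := cos_sq (u / 2)
  simp only [sin_sq, this]
  ring_nf

end SincSquared

/-- The limiting variance is the expectation of `min s |D|`, where `D` is the limiting
(rescaled) displacement difference of two particles. -/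
lemma integral_min_abs_eq_limitVar {α c a : ℝ} (ha : 0 < a) {ρ : Measure ℝ}
    [IsProbabilityMeasure ρ]
    (hρ : ∀ θ : ℝ, charFun ρ θ = ((Real.exp (-(2 * c * |θ| ^ α)) : ℝ) : ℂ)) {s : ℝ} (hs : 0 ≤ s) :
    ∫ y, min s |y| ∂ρ = a * limitVar α c a s := by
  rcases hs.eq_or_lt with rfl | hs
  · simp [limitVar]
  have hcos : ∀ θ : ℝ, ∫ y, (1 - Real.cos (θ * y)) ∂ρ = 1 - Real.exp (-(2 * c * |θ| ^ α)) := by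
    intro θ
    have h1 : Integrable (fun y : ℝ => Complex.exp (θ * y * Complex.I)) ρ := by
      refine (integrable_const (1 : ℝ)).mono' (by fun_prop)
        (Filter.Eventually.of_forall fun y => ?_)
      rw [← Complex.ofReal_mul, Complex.norm_exp_ofReal_mul_I]
    have h2 := integral_re h1
    have h3 := hρ θ
    rw [charFun_apply_real] at h3
    rw [h3] at h2
    have h4 : ∀ y : ℝ, RCLike.re (Complex.exp (θ * y * Complex.I)) = Real.cos (θ * y) := by
      intro y
      rw [← Complex.ofReal_mul]
      exact Complex.exp_ofReal_mul_I_re _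
    simp_rw [h4] at h2
    rw [integral_sub (integrable_const _), h2]
    · simp only [integral_const, probReal_univ, smul_eq_mul, mul_one]
      rw [RCLike.re_to_complex, Complex.ofReal_re]
    · refine (integrable_const (1 : ℝ)).mono' (by fun_prop)
        (Filter.Eventually.of_forall fun y => ?_)
      simpa using Real.abs_cos_le_one _
  -- The sinc-squared integral at `z = y / s`. Once `min s |y|` is an integral of `1 - cos`, Fubini
  -- replaces the cosine by its mean, the characteristic function of `ρ`, and the integrand of
  -- `limitVar` appears.
  have hmin : ∀ y : ℝ, min s |y| = 4 * s / Real.pi *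
      ∫ u in Set.Ioi (0 : ℝ), Real.sin (u / 2) ^ 2 / u ^ 2 * (1 - Real.cos (u / s * y)) := by
    intro y
    have h1 : ∀ u : ℝ, u / s * y = y / s * u := fun u => by ring
    simp_rw [h1]
    rw [integral_sin_sq_mul_one_sub_cos, abs_div, abs_of_pos hs]
    rw [show min s |y| = s * min 1 (|y| / s) by
      rw [mul_min_of_nonneg _ _ hs.le]; congr 1 <;> field_simp]
    field_simp
  simp_rw [hmin]
  rw [integral_const_mul, integral_integral_swap]
  · rw [limitVar, ← mul_assoc, show a * (4 * s / (a * Real.pi)) = 4 * s / Real.pi by field_simp]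
    congr 1
    refine setIntegral_congr_fun measurableSet_Ioi fun u hu => ?_
    rw [integral_const_mul, hcos, abs_of_pos (div_pos hu hs)]
  · have hb : Integrable (fun p : ℝ × ℝ => (2 : ℝ) * (Real.sin (p.2 / 2) ^ 2 / p.2 ^ 2))
        (ρ.prod (volume.restrict (Set.Ioi 0))) :=
      (integrable_const (2 : ℝ)).mul_prod integrableOn_sin_sq_div_sq
    refine hb.mono' (Measurable.aestronglyMeasurable (by fun_prop))
      (Filter.Eventually.of_forall fun p => ?_)
    show ‖Real.sin (p.2 / 2) ^ 2 / p.2 ^ 2 * (1 - Real.cos (p.2 / s * p.1))‖ ≤ _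
    have h0 : 0 ≤ Real.sin (p.2 / 2) ^ 2 / p.2 ^ 2 := by positivity
    have h1 := Real.cos_le_one (p.2 / s * p.1)
    have h2 := Real.neg_one_le_cos (p.2 / s * p.1)
    rw [Real.norm_of_nonneg (mul_nonneg h0 (by linarith)), mul_comm]
    exact mul_le_mul_of_nonneg_right (by linarith) h0

/-! ### Laws on path space and their finite-dimensional characteristic functions. -/

section PathSpace

lemma continuous_pathEval (s : I) : Continuous fun g : C(I, ℝ) => g s :=
  continuous_eval_const s

lemma measurable_pathEval (s : I) : Measurable fun g : C(I, ℝ) => g s :=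
  (continuous_pathEval s).measurable

/-- Lusin–Souslin: a continuous injection between Polish spaces is a measurable embedding. Hence
evaluations at a countable dense set generate the Borel σ-algebra of `C[0,1]`, which serves both for
measurability of random paths and for uniqueness of laws. -/
lemma measurableEmbedding_pathRestrict :
    MeasurableEmbedding fun (g : C(I, ℝ)) (n : ℕ) => g (TopologicalSpace.denseSeq I n) := by
  refine Continuous.measurableEmbedding (continuous_pi fun n => continuous_pathEval _) ?_
  intro g h hgh
  refine DFunLike.coe_injective ((TopologicalSpace.denseRange_denseSeq I).equalizer
    g.continuous h.continuous ?_)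
  exact hgh

lemma measurable_path {Ω : Type*} [MeasurableSpace Ω] {f : Ω → C(I, ℝ)}
    (hf : ∀ s : I, Measurable fun ω => f ω s) : Measurable f :=
  measurableEmbedding_pathRestrict.measurable_comp_iff.1
    (measurable_pi_lambda _ fun n => hf (TopologicalSpace.denseSeq I n))

lemma integrable_cexp_mul_I {Ω : Type*} [MeasurableSpace Ω] {P : Measure Ω} [IsFiniteMeasure P]
    {f : Ω → ℝ} (hf : AEMeasurable f P) : Integrable (fun ω => Complex.exp (f ω * Complex.I)) P := by
  refine (integrable_const (1 : ℝ)).mono' ?_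
    (Filter.Eventually.of_forall fun y => by rw [Complex.norm_exp_ofReal_mul_I])
  exact (Complex.measurable_exp.comp_aemeasurable
    ((Complex.measurable_ofReal.comp_aemeasurable hf).mul_const _)).aestronglyMeasurable

lemma charFun_map_apply {Ω : Type*} [MeasurableSpace Ω] {P : Measure Ω}
    {f : Ω → ℝ} (hf : AEMeasurable f P) (u : ℝ) :
    charFun (P.map f) u = ∫ ω, Complex.exp ((u * f ω : ℝ) * Complex.I) ∂P := by
  rw [charFun_apply_real, integral_map hf (Continuous.aestronglyMeasurable (by fun_prop))]
  simp

/-- A probability measure on path space is determined by the characteristic functions of its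
finite-dimensional distributions. -/
lemma eq_of_integral_cexp_sum_eq {Q Q' : Measure C(I, ℝ)} [IsProbabilityMeasure Q]
    [IsProbabilityMeasure Q']
    (h : ∀ {ι : Type} [Fintype ι] (s : ι → I) (θ : ι → ℝ),
      ∫ g, Complex.exp ((∑ i, θ i * g (s i) : ℝ) * Complex.I) ∂Q =
      ∫ g, Complex.exp ((∑ i, θ i * g (s i) : ℝ) * Complex.I) ∂Q') : Q = Q' := by
  apply measurableEmbedding_pathRestrict.map_injective
  have hm : Measurable fun (g : C(I, ℝ)) (n : ℕ) => g (TopologicalSpace.denseSeq I n) :=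
    measurableEmbedding_pathRestrict.measurable
  have := Measure.isProbabilityMeasure_map (μ := Q) hm.aemeasurable
  have := Measure.isProbabilityMeasure_map (μ := Q') hm.aemeasurable
  refine (isProjectiveLimit_map (X := fun n (g : C(I, ℝ)) => g (TopologicalSpace.denseSeq I n))
    hm.aemeasurable).unique ?_
  have key : ∀ J : Finset ℕ,
      Q.map (fun g : C(I, ℝ) => J.restrict (fun n => g (TopologicalSpace.denseSeq I n))) =
      Q'.map (fun g : C(I, ℝ) => J.restrict (fun n => g (TopologicalSpace.denseSeq I n))) := by
    intro J
    have hJ : Measurable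
        (fun g : C(I, ℝ) => J.restrict (fun n => g (TopologicalSpace.denseSeq I n))) :=
      (Finset.measurable_restrict J).comp hm
    have := Measure.isProbabilityMeasure_map (μ := Q) hJ.aemeasurable
    have := Measure.isProbabilityMeasure_map (μ := Q') hJ.aemeasurable
    -- A functional on `J → ℝ` is a combination of coordinates weighted by its values on the
    -- standard basis, so the hypothesis is exactly equality of the characteristic functions of this
    -- marginal.
    refine Measure.ext_of_charFunDual (funext fun L => ?_)
    have hL : ∀ x : J → ℝ, L x = ∑ j, L (Pi.single j 1) * x j := by
      intro x
      conv_lhs => rw [← Finset.univ_sum_single x, map_sum]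
      refine Finset.sum_congr rfl fun j _ => ?_
      rw [show Pi.single j (x j) = x j • (Pi.single j (1 : ℝ) : J → ℝ) by
        rw [← Pi.single_smul]; simp, map_smul, smul_eq_mul, mul_comm]
    rw [charFunDual_apply, charFunDual_apply, integral_map hJ.aemeasurable (by fun_prop),
      integral_map hJ.aemeasurable (by fun_prop)]
    have e : ∀ g : C(I, ℝ), L (J.restrict fun n => g (TopologicalSpace.denseSeq I n)) =
        ∑ j : J, L (Pi.single j 1) * g (TopologicalSpace.denseSeq I j) := fun g => hL _
    simp_rw [e]
    exact h (fun j : J => TopologicalSpace.denseSeq I j) (fun j => L (Pi.single j 1))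
  intro J
  refine Eq.trans ?_ (key J).symm
  exact isProjectiveLimit_map (X := fun n (g : C(I, ℝ)) => g (TopologicalSpace.denseSeq I n))
    hm.aemeasurable J

/-- The finite-dimensional characteristic functions of a centered Gaussian process on `[0,1]`
with covariance `K`. -/
def HasGaussianCharFun (K : I → I → ℝ) (Q : Measure C(I, ℝ)) : Prop :=
  ∀ {ι : Type} [Fintype ι] (s : ι → I) (θ : ι → ℝ),
    ∫ g, Complex.exp ((∑ i, θ i * g (s i) : ℝ) * Complex.I) ∂Q =
      ((Real.exp (-(∑ i, ∑ j, θ i * θ j * K (s i) (s j)) / 2) : ℝ) : ℂ)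

section Gaussian

variable {K : I → I → ℝ} {Q : Measure C(I, ℝ)} [IsProbabilityMeasure Q]

lemma measurable_sum_pathEval {ι : Type} [Fintype ι] (s : ι → I) (θ : ι → ℝ) :
    Measurable fun g : C(I, ℝ) => ∑ i, θ i * g (s i) :=
  Finset.measurable_sum _ fun i _ => (measurable_pathEval (s i)).const_mul _

/-- A characteristic function has modulus at most `1`, so positivity of the quadratic form of `K` is
a consequence and never has to be checked on the explicit covariance. -/
lemma HasGaussianCharFun.sum_nonneg (h : HasGaussianCharFun K Q) {ι : Type} [Fintype ι]
    (s : ι → I) (θ : ι → ℝ) : 0 ≤ ∑ i, ∑ j, θ i * θ j * K (s i) (s j) := by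
  have h1 := h s θ
  have h2 : ‖∫ g, Complex.exp ((∑ i, θ i * g (s i) : ℝ) * Complex.I) ∂Q‖ ≤ 1 := by
    refine (norm_integral_le_of_norm_le_const (C := 1)
      (Filter.Eventually.of_forall fun y => ?_)).trans (by simp)
    rw [Complex.norm_exp_ofReal_mul_I]
  rw [h1, Complex.norm_real, Real.norm_of_nonneg (Real.exp_pos _).le, Real.exp_le_one_iff] at h2
  linarith

lemma HasGaussianCharFun.map_sum (h : HasGaussianCharFun K Q) {ι : Type} [Fintype ι]
    (s : ι → I) (θ : ι → ℝ) :
    Q.map (fun g : C(I, ℝ) => ∑ i, θ i * g (s i)) =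
      gaussianReal 0 (∑ i, ∑ j, θ i * θ j * K (s i) (s j)).toNNReal := by
  have hm := measurable_sum_pathEval s θ
  have := Measure.isProbabilityMeasure_map (μ := Q) hm.aemeasurable
  refine Measure.ext_of_charFun (funext fun u => ?_)
  rw [charFun_map_apply hm.aemeasurable, charFun_gaussianReal]
  have h1 := h s (fun i => u * θ i)
  simp_rw [Finset.mul_sum, ← mul_assoc]
  rw [h1, Complex.ofReal_exp, Real.coe_toNNReal _ (h.sum_nonneg s θ)]
  congr 1
  push_cast
  simp only [mul_zero, zero_mul, zero_sub, neg_div, Finset.sum_mul]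
  congr 2
  refine Finset.sum_congr rfl fun i _ => Finset.sum_congr rfl fun j _ => ?_
  ring

lemma HasGaussianCharFun.hasGaussianLaw_sum (h : HasGaussianCharFun K Q) {ι : Type} [Fintype ι]
    (s : ι → I) (θ : ι → ℝ) : HasGaussianLaw (fun g : C(I, ℝ) => ∑ i, θ i * g (s i)) Q :=
  ⟨by rw [h.map_sum]; infer_instance⟩

lemma HasGaussianCharFun.integral_sum (h : HasGaussianCharFun K Q) {ι : Type} [Fintype ι]
    (s : ι → I) (θ : ι → ℝ) : ∫ g, ∑ i, θ i * g (s i) ∂Q = 0 := by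
  have h1 := integral_map (μ := Q) (measurable_sum_pathEval s θ).aemeasurable
    (f := (id : ℝ → ℝ)) (by fun_prop)
  rw [h.map_sum] at h1
  simpa using h1.symm

lemma HasGaussianCharFun.variance_sum (h : HasGaussianCharFun K Q) {ι : Type} [Fintype ι]
    (s : ι → I) (θ : ι → ℝ) :
    Var[fun g : C(I, ℝ) => ∑ i, θ i * g (s i); Q] = ∑ i, ∑ j, θ i * θ j * K (s i) (s j) := by
  rw [← variance_id_map (measurable_sum_pathEval s θ).aemeasurable, h.map_sum,
    variance_id_gaussianReal, Real.coe_toNNReal _ (h.sum_nonneg s θ)]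

lemma HasGaussianCharFun.hasGaussianLaw (h : HasGaussianCharFun K Q) (s : I) :
    HasGaussianLaw (fun g : C(I, ℝ) => g s) Q := by
  simpa using h.hasGaussianLaw_sum (ι := Unit) (fun _ => s) (fun _ => 1)

lemma HasGaussianCharFun.isGaussianProcess_eval (h : HasGaussianCharFun K Q) :
    IsGaussianProcess (fun (s : I) (g : C(I, ℝ)) => g s) Q := by
  classical
  refine ⟨fun J => ⟨isGaussian_of_map_eq_gaussianReal fun L => ?_⟩⟩
  have hJ : Measurable (fun g : C(I, ℝ) => J.restrict (fun s => g s)) :=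
    measurable_pi_lambda _ fun j => measurable_pathEval j
  rw [Measure.map_map (by fun_prop) hJ]
  have hL : ∀ x : J → ℝ, L x = ∑ j, L (Pi.single j 1) * x j := by
    intro x
    conv_lhs => rw [← Finset.univ_sum_single x, _root_.map_sum]
    refine Finset.sum_congr rfl fun j _ => ?_
    rw [show Pi.single j (x j) = x j • (Pi.single j (1 : ℝ) : J → ℝ) by
      rw [← Pi.single_smul]; simp, map_smul, smul_eq_mul, mul_comm]
  exact ⟨0, _, by
    rw [← h.map_sum (fun j : J => (j : I)) (fun j => L (Pi.single j 1))]
    congr 1 with g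
    exact hL _⟩

/-- Links the description of the limit by Gaussianity, mean and covariance with characteristic
functions, which survive weak limits and determine the law. Variances of sums see only `K r s + K s
r`, hence the symmetry assumption. -/
lemma hasGaussianCharFun_iff (hK : ∀ r s, K r s = K s r) :
    HasGaussianCharFun K Q ↔ IsGaussianProcess (fun (s : I) (g : C(I, ℝ)) => g s) Q ∧
      (∀ s : I, ∫ g : C(I, ℝ), g s ∂Q = 0) ∧
      ∀ r s : I, covariance (fun g : C(I, ℝ) => g r) (fun g : C(I, ℝ) => g s) Q = K r s := by
  constructor
  · intro h
    refine ⟨h.isGaussianProcess_eval, fun s => ?_, fun r s => ?_⟩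
    · simpa using h.integral_sum (ι := Unit) (fun _ => s) (fun _ => 1)
    -- Polarisation: the covariance is read off from the variances of `g r + g s`, `g r` and `g s`.
    · have h1 := h.variance_sum (ι := Fin 2) ![r, s] ![1, 1]
      have h2 := h.variance_sum (ι := Unit) (fun _ => r) (fun _ => 1)
      have h3 := h.variance_sum (ι := Unit) (fun _ => s) (fun _ => 1)
      simp only [Fin.sum_univ_two, Finset.univ_unique, Finset.sum_const, Finset.card_singleton,
        one_smul, one_mul, Matrix.cons_val_zero, Matrix.cons_val_one] at h1 h2 h3
      have h4 := variance_fun_add (h.hasGaussianLaw r).memLp_two (h.hasGaussianLaw s).memLp_two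
      rw [h1, h2, h3, hK s r] at h4
      linarith
  · rintro ⟨hG, h0, hcov⟩ ι _ s θ
    have hmem : ∀ i, MemLp (fun g : C(I, ℝ) => θ i * g (s i)) 2 Q := fun i =>
      (hG.hasGaussianLaw_eval (s i)).memLp_two.const_mul _
    have hlaw : HasGaussianLaw (fun g : C(I, ℝ) => ∑ i, θ i * g (s i)) Q :=
      ((hG.comp_right s).smul θ).hasGaussianLaw_fun_sum
    have h1 := hlaw.map_eq_gaussianReal
    have h2 := charFun_map_apply (measurable_sum_pathEval s θ).aemeasurable (P := Q) 1
    have hmean : ∫ g : C(I, ℝ), ∑ i, θ i * g (s i) ∂Q = 0 := by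
      rw [integral_finsetSum _ fun i _ => (hmem i).integrable (by norm_num)]
      simp [integral_const_mul, h0]
    have hvar : Var[fun g : C(I, ℝ) => ∑ i, θ i * g (s i); Q] =
        ∑ i, ∑ j, θ i * θ j * K (s i) (s j) := by
      rw [variance_fun_sum' fun i _ => hmem i]
      refine Finset.sum_congr rfl fun i _ => Finset.sum_congr rfl fun j _ => ?_
      rw [covariance_const_mul_left, covariance_const_mul_right, hcov]
      ring
    simp only [one_mul] at h2
    rw [← h2, h1, charFun_gaussianReal, Real.coe_toNNReal _ (variance_nonneg _ _), hvar, hmean,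
      Complex.ofReal_exp]
    congr 1
    push_cast
    ring

end Gaussian

end PathSpace

/-! ### Tightness from oscillation bounds, and the functional limit theorem. -/

section Tightness

/-- The paths having an oscillation larger than `η` at scale `δ`. -/
def oscSet (δ η : ℝ) : Set C(I, ℝ) := {g | ∃ r s : I, dist r s ≤ δ ∧ η < |g r - g s|}

lemma isOpen_oscSet (δ η : ℝ) : IsOpen (oscSet δ η) := by
  have : oscSet δ η = ⋃ (r : I) (s : I) (_ : dist r s ≤ δ), {g : C(I, ℝ) | η < |g r - g s|} := by
    ext g; simp only [oscSet, Set.mem_iUnion, Set.mem_ofPred_eq, exists_prop]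
  rw [this]
  refine isOpen_iUnion fun r => isOpen_iUnion fun s => isOpen_iUnion fun _ => ?_
  exact isOpen_lt continuous_const ((continuous_pathEval r).sub (continuous_pathEval s)).abs

lemma oscSet_mono {δ δ' η : ℝ} (h : δ ≤ δ') : oscSet δ η ⊆ oscSet δ' η :=
  fun _ ⟨r, s, h1, h2⟩ => ⟨r, s, h1.trans h, h2⟩

/-- Every path is uniformly continuous, so the sets `oscSet (1/(n+1)) η` decrease to the empty set
and their measures tend to zero. -/
lemma exists_measure_oscSet_le (ν : Measure C(I, ℝ)) [IsFiniteMeasure ν] {η : ℝ} (hη : 0 < η)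
    {κ : ENNReal} (hκ : 0 < κ) : ∃ δ > 0, ν (oscSet δ η) ≤ κ := by
  have hanti : Antitone fun n : ℕ => oscSet (1 / ((n : ℝ) + 1)) η := fun m n hmn =>
    oscSet_mono (one_div_le_one_div_of_le (by positivity) (by gcongr))
  have h := tendsto_measure_iInter_atTop (μ := ν)
    (fun n : ℕ => (isOpen_oscSet (1 / ((n : ℝ) + 1)) η).measurableSet.nullMeasurableSet) hanti
    ⟨0, measure_ne_top _ _⟩
  have hempty : ⋂ n : ℕ, oscSet (1 / ((n : ℝ) + 1)) η = ∅ := by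
    refine Set.eq_empty_of_forall_notMem fun g hg => ?_
    have hu := CompactSpace.uniformContinuous_of_continuous g.continuous
    obtain ⟨δ, hδ, hd⟩ := Metric.uniformContinuous_iff.1 hu η hη
    obtain ⟨n, hn⟩ := exists_nat_one_div_lt hδ
    obtain ⟨r, s, h1, h2⟩ := Set.mem_iInter.1 hg n
    have := hd (h1.trans_lt hn)
    rw [Real.dist_eq] at this
    linarith
  rw [hempty, measure_empty] at h
  obtain ⟨n, hn⟩ := ((tendsto_order.1 h).2 κ hκ).exists
  exact ⟨1 / ((n : ℝ) + 1), by positivity, hn.le⟩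

/-- The finitely many early laws are treated one at a time by shrinking `δ`. This is available along
a sequence, and is the reason why tightness is proved for sequences of times. -/
lemma exists_forall_measure_oscSet_le {ν : ℕ → ProbabilityMeasure C(I, ℝ)} {η : ℝ} (hη : 0 < η)
    {κ : ENNReal} (hκ : 0 < κ)
    (h : ∃ δ > 0, ∀ᶠ n in atTop, (ν n : Measure C(I, ℝ)) (oscSet δ η) ≤ κ) :
    ∃ δ > 0, ∀ n, (ν n : Measure C(I, ℝ)) (oscSet δ η) ≤ κ := by
  obtain ⟨δ, hδ, h⟩ := h
  obtain ⟨N, hN⟩ := eventually_atTop.1 h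
  have key : ∀ m : ℕ, ∃ δ > 0, ∀ n < m, (ν n : Measure C(I, ℝ)) (oscSet δ η) ≤ κ := by
    intro m
    induction m with
    | zero => exact ⟨1, one_pos, fun n hn => absurd hn (Nat.not_lt_zero n)⟩
    | succ m ih =>
      obtain ⟨δ₁, h1, h2⟩ := ih
      obtain ⟨δ₂, h3, h4⟩ := exists_measure_oscSet_le (ν m : Measure C(I, ℝ)) hη hκ
      refine ⟨min δ₁ δ₂, lt_min h1 h3, fun n hn => ?_⟩
      rcases Nat.lt_succ_iff_lt_or_eq.1 hn with hn | rfl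
      · exact (measure_mono (oscSet_mono (min_le_left _ _))).trans (h2 n hn)
      · exact (measure_mono (oscSet_mono (min_le_right _ _))).trans h4
  obtain ⟨δ', hδ', h'⟩ := key N
  refine ⟨min δ δ', lt_min hδ hδ', fun n => ?_⟩
  rcases lt_or_ge n N with hn | hn
  · exact (measure_mono (oscSet_mono (min_le_right _ _))).trans (h' n hn)
  · exact (measure_mono (oscSet_mono (min_le_left _ _))).trans (hN n hn)

/-- Paths started at `0` with a prescribed sequence of moduli of continuity. -/
def modulusSet (δ : ℕ → ℝ) : Set (I → ℝ) :=
  {f | f 0 = 0 ∧ ∀ k : ℕ, ∀ r s : I, dist r s ≤ δ k → |f r - f s| ≤ 1 / ((k : ℝ) + 1)}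

/-- Walk from `s` down to `0` in steps of length `δ 0`; the condition with `k = 0` bounds each
change of `f` by `1`. -/
lemma modulusSet_bound {δ : ℕ → ℝ} (hδ : 0 < δ 0) {f : I → ℝ} (hf : f ∈ modulusSet δ)
    (n : ℕ) : ∀ s : I, (s : ℝ) ≤ n * δ 0 → |f s| ≤ n := by
  induction n with
  | zero =>
    intro s hs
    have : s = 0 := Subtype.ext (le_antisymm (by simpa using hs) s.2.1)
    simp [this, hf.1]
  | succ n ih =>
    intro s hs
    have h1 : max ((s : ℝ) - δ 0) 0 ∈ I := ⟨le_max_right _ _, max_le (by linarith [s.2.2]) zero_le_one⟩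
    have h2 := ih ⟨_, h1⟩ (max_le (by push_cast at hs; linarith) (by positivity))
    have h3 := hf.2 0 s ⟨_, h1⟩ (by
      rw [Subtype.dist_eq, Real.dist_eq, abs_le]
      have := s.2.1
      constructor
      · simp only [neg_le_sub_iff_le_add, max_le_iff]
        constructor <;> linarith
      · have := le_max_left ((s : ℝ) - δ 0) 0
        linarith)
    have h4 := abs_sub_abs_le_abs_sub (f s) (f ⟨_, h1⟩)
    push_cast at *
    norm_num at h3
    linarith

/-- The defining conditions are pointwise closed, and the uniform bound places the set inside a
product of compact intervals. -/
lemma isCompact_modulusSet {δ : ℕ → ℝ} (hδ : ∀ k, 0 < δ k) : IsCompact (modulusSet δ) := by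
  obtain ⟨n, hn⟩ := exists_nat_ge (1 / δ 0)
  have hsub : modulusSet δ ⊆ Set.univ.pi fun _ => Set.Icc (-(n : ℝ)) n := by
    intro f hf s _
    have h1 : (1 : ℝ) ≤ n * δ 0 := by rwa [div_le_iff₀ (hδ 0)] at hn
    exact abs_le.1 (modulusSet_bound (hδ 0) hf n s (s.2.2.trans h1))
  refine (isCompact_univ_pi fun _ => isCompact_Icc).of_isClosed_subset ?_ hsub
  have : modulusSet δ = {f | f 0 = 0} ∩ ⋂ (k : ℕ) (r : I) (s : I) (_ : dist r s ≤ δ k),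
      {f : I → ℝ | |f r - f s| ≤ 1 / ((k : ℝ) + 1)} := by
    ext f; simp only [modulusSet, Set.mem_inter_iff, Set.mem_iInter, Set.mem_ofPred_eq]
  rw [this]
  refine (isClosed_eq (continuous_apply _) continuous_const).inter ?_
  refine isClosed_iInter fun k => isClosed_iInter fun r => isClosed_iInter fun s =>
    isClosed_iInter fun _ => ?_
  exact isClosed_le ((continuous_apply r).sub (continuous_apply s)).abs continuous_const

lemma dist_lt_of_mem_modulusSet {δ : ℕ → ℝ} {ε : ℝ} {k : ℕ} (hk : 1 / ((k : ℝ) + 1) < ε)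
    {f : I → ℝ} (hf : f ∈ modulusSet δ) {r s : I} (h : dist r s < δ k) : dist (f r) (f s) < ε := by
  rw [Real.dist_eq]
  exact (hf.2 k r s h.le).trans_lt hk

/-- Arzelà–Ascoli: the prescribed moduli give equicontinuity. They also make every function in
`modulusSet δ` continuous, so the paths fill the whole pointwise compact set. -/
lemma isCompact_path_modulusSet {δ : ℕ → ℝ} (hδ : ∀ k, 0 < δ k) :
    IsCompact {g : C(I, ℝ) | ⇑g ∈ modulusSet δ} := by
  refine ArzelaAscoli.isCompact_of_equicontinuous _ ?_ ?_
  · convert isCompact_modulusSet hδ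
    ext f
    constructor
    · rintro ⟨g, hg, rfl⟩
      exact hg
    · intro hf
      refine ⟨⟨f, ?_⟩, hf, rfl⟩
      rw [Metric.continuous_iff]
      intro s ε hε
      obtain ⟨k, hk⟩ := exists_nat_one_div_lt hε
      exact ⟨δ k, hδ k, fun r hr => dist_lt_of_mem_modulusSet hk hf hr⟩
  · intro s
    rw [Metric.equicontinuousAt_iff]
    intro ε hε
    obtain ⟨k, hk⟩ := exists_nat_one_div_lt hε
    exact ⟨δ k, hδ k, fun r hr g => dist_lt_of_mem_modulusSet hk g.2 (by rwa [dist_comm])⟩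

/-- Split `ε` into summable budgets `κ k` and choose `δ k` so that oscillation above `1/(k+1)` at
scale `δ k` costs at most `κ k`; a union bound then leaves a compact set. -/
lemma isTightMeasureSet_of_oscSet {ν : ℕ → ProbabilityMeasure C(I, ℝ)}
    (h0 : ∀ n, (ν n : Measure C(I, ℝ)) {g | g 0 ≠ 0} = 0)
    (hmod : ∀ η > 0, ∀ κ : ENNReal, 0 < κ →
      ∃ δ > 0, ∀ᶠ n in atTop, (ν n : Measure C(I, ℝ)) (oscSet δ η) ≤ κ) :
    IsTightMeasureSet {(ν n : Measure C(I, ℝ)) | n} := by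
  rw [isTightMeasureSet_iff_exists_isCompact_measure_compl_le]
  intro ε hε
  obtain ⟨κ, hκ, hsum⟩ := ENNReal.exists_pos_sum_of_countable' hε.ne' ℕ
  have H : ∀ k : ℕ, ∃ δ > 0, ∀ n,
      (ν n : Measure C(I, ℝ)) (oscSet δ (1 / ((k : ℝ) + 1))) ≤ κ k := fun k =>
    exists_forall_measure_oscSet_le (by positivity) (hκ k) (hmod _ (by positivity) _ (hκ k))
  choose δ hδ hle using H
  refine ⟨_, isCompact_path_modulusSet hδ, ?_⟩
  rintro _ ⟨n, rfl⟩
  have hsub : {g : C(I, ℝ) | ⇑g ∈ modulusSet δ}ᶜ ⊆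
      {g | g 0 ≠ 0} ∪ ⋃ k : ℕ, oscSet (δ k) (1 / ((k : ℝ) + 1)) := by
    intro g hg
    by_contra hcon
    simp only [Set.mem_union, Set.mem_iUnion, not_or, not_exists, Set.mem_ofPred_eq, not_not,
      oscSet, not_and, not_lt] at hcon
    exact hg ⟨hcon.1, fun k r s h => hcon.2 k r s h⟩
  calc (ν n : Measure C(I, ℝ)) {g : C(I, ℝ) | ⇑g ∈ modulusSet δ}ᶜ
      ≤ (ν n : Measure C(I, ℝ)) {g | g 0 ≠ 0} +
        ∑' k : ℕ, (ν n : Measure C(I, ℝ)) (oscSet (δ k) (1 / ((k : ℝ) + 1))) :=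
        (measure_mono hsub).trans ((measure_union_le _ _).trans
          (add_le_add le_rfl (measure_iUnion_le _)))
    _ ≤ 0 + ∑' k, κ k := add_le_add (h0 n).le (ENNReal.tsum_le_tsum fun k => hle k n)
    _ ≤ ε := by rw [zero_add]; exact hsum.le

/-- Functional limit theorem on path space: convergence of the finite-dimensional characteristic
functions to Gaussian ones and control of the oscillations imply weak convergence to the law of a
continuous Gaussian process. -/
theorem exists_tendsto_of_charFun_of_oscSet {K : I → I → ℝ} {ν : ℝ≥0 → ProbabilityMeasure C(I, ℝ)}
    (h0 : ∀ t, (ν t : Measure C(I, ℝ)) {g | g 0 ≠ 0} = 0)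
    (hchar : ∀ {ι : Type} [Fintype ι] (s : ι → I) (θ : ι → ℝ),
      Tendsto (fun t => ∫ g, Complex.exp ((∑ i, θ i * g (s i) : ℝ) * Complex.I)
        ∂(ν t : Measure C(I, ℝ))) atTop
        (𝓝 ((Real.exp (-(∑ i, ∑ j, θ i * θ j * K (s i) (s j)) / 2) : ℝ) : ℂ)))
    (hmod : ∀ η > 0, ∀ κ : ENNReal, 0 < κ →
      ∃ δ > 0, ∀ᶠ t in atTop, (ν t : Measure C(I, ℝ)) (oscSet δ η) ≤ κ) :
    ∃ Q : ProbabilityMeasure C(I, ℝ), HasGaussianCharFun K (Q : Measure C(I, ℝ)) ∧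
      Tendsto ν atTop (𝓝 Q) := by
  -- Convergence as `t → ∞` is tested on sequences, and there on ultrafilters: Prokhorov provides a
  -- limit along each ultrafilter, and its characteristic functions are forced. Hence all these
  -- limits agree with the one taken along the integers.
  have key : ∀ u : ℕ → ℝ≥0, Tendsto u atTop atTop → ∀ V : Ultrafilter ℕ, (V : Filter ℕ) ≤ atTop →
      ∃ Q : ProbabilityMeasure C(I, ℝ), HasGaussianCharFun K (Q : Measure C(I, ℝ)) ∧
        Tendsto (fun n => ν (u n)) V (𝓝 Q) := by
    intro u hu V hV
    have htight : IsTightMeasureSet {(ν (u n) : Measure C(I, ℝ)) | n} :=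
      isTightMeasureSet_of_oscSet (ν := fun n => ν (u n)) (fun n => h0 _) fun η hη κ hκ => by
        obtain ⟨δ, hδ, h⟩ := hmod η hη κ hκ
        exact ⟨δ, hδ, hu.eventually h⟩
    have hcomp : IsCompact (closure {ν (u n) | n}) :=
      isCompact_closure_of_isTightMeasureSet (by simpa using htight)
    obtain ⟨Q, -, hQ⟩ := hcomp.ultrafilter_le_nhds (V.map fun n => ν (u n))
      (.trans (by simp) (monotone_principal subset_closure))
    have hQ' : Tendsto (fun n => ν (u n)) V (𝓝 Q) := hQ
    refine ⟨Q, fun {ι} _ s θ => ?_, hQ'⟩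
    have h1 := ((hchar s θ).comp hu).mono_left hV
    rw [ProbabilityMeasure.tendsto_iff_forall_integral_rclike_tendsto ℂ] at hQ'
    have hcont : Continuous fun g : C(I, ℝ) =>
        Complex.exp ((∑ i, θ i * g (s i) : ℝ) * Complex.I) := by
      have : Continuous fun g : C(I, ℝ) => ∑ i, θ i * g (s i) :=
        continuous_finsetSum _ fun i _ => continuous_const.mul (continuous_pathEval _)
      fun_prop
    have h2 := hQ' (BoundedContinuousFunction.ofNormedAddCommGroup _ hcont 1
      fun g => by rw [Complex.norm_exp_ofReal_mul_I])
    exact tendsto_nhds_unique h2 h1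
  obtain ⟨Q, hQ, -⟩ := key (fun n => (n : ℝ≥0)) tendsto_natCast_atTop_atTop
    (Filter.hyperfilter ℕ) Nat.hyperfilter_le_atTop
  refine ⟨Q, hQ, tendsto_of_seq_tendsto fun u hu => ?_⟩
  rw [tendsto_iff_ultrafilter]
  intro V hV
  obtain ⟨Q', hQ', hlim⟩ := key u hu V hV
  have : Q' = Q := ProbabilityMeasure.toMeasure_injective (eq_of_integral_cexp_sum_eq fun s θ => by rw [hQ' s θ, hQ s θ])
  rw [← this]
  exact hlim

end Tightness

/-! ### Point configurations and their interpolated counting functions. -/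

section Configuration

/-- The number of points of the configuration `Y` in `[0,x]`. -/
noncomputable def pointCount (Y : ℤ → ℝ) (x : ℝ) : ℝ := ({j : ℤ | Y j ∈ Set.Icc 0 x}.ncard : ℝ)

lemma exists_isGreatest_of_finite {s : Set ℝ} (hs : s.Finite) (hne : s.Nonempty) :
    ∃ x, IsGreatest s x := by
  obtain ⟨x, hx, hmax⟩ := Set.exists_max_image s id hs hne
  exact ⟨x, hx, hmax⟩

lemma exists_isLeast_of_finite {s : Set ℝ} (hs : s.Finite) (hne : s.Nonempty) :
    ∃ x, IsLeast s x := by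
  obtain ⟨x, hx, hmin⟩ := Set.exists_min_image s id hs hne
  exact ⟨x, hx, hmin⟩

/-- A locally finite simple configuration of points that is unbounded above. -/
structure IsRegularConfig (Y : ℤ → ℝ) : Prop where
  finite : ∀ x, {j : ℤ | Y j ∈ Set.Icc 0 x}.Finite
  injective : Function.Injective Y
  unbounded : ∀ x, ∃ j, x < Y j

namespace IsRegularConfig

variable {Y : ℤ → ℝ}

lemma finite_Ioc (hY : IsRegularConfig Y) {p q : ℝ} (hp : 0 ≤ p) :
    {j : ℤ | Y j ∈ Set.Ioc p q}.Finite :=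
  (hY.finite q).subset fun _ hj => ⟨hp.trans hj.1.le, hj.2⟩

lemma pointCount_add (hY : ∀ x, {j : ℤ | Y j ∈ Set.Icc 0 x}.Finite) {p q : ℝ} (hp : 0 ≤ p)
    (hpq : p ≤ q) :
    pointCount Y q = pointCount Y p + ({j : ℤ | Y j ∈ Set.Ioc p q}.ncard : ℝ) := by
  have hset : {j : ℤ | Y j ∈ Set.Icc 0 q} =
      {j : ℤ | Y j ∈ Set.Icc 0 p} ∪ {j : ℤ | Y j ∈ Set.Ioc p q} := by
    ext j
    simp only [Set.mem_ofPred_eq, Set.mem_Icc, Set.mem_union, Set.mem_Ioc]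
    grind
  rw [pointCount, pointCount, hset, Set.ncard_union_eq _ (hY p)
    ((hY q).subset fun _ hj => ⟨hp.trans hj.1.le, hj.2⟩)]
  · push_cast; rfl
  · rw [Set.disjoint_left]
    rintro j ⟨_, h1⟩ ⟨h2, _⟩
    exact absurd h1 (not_le.2 h2)

lemma pointCount_eq_of_forall_notMem (hY : IsRegularConfig Y) {p q : ℝ} (hp : 0 ≤ p)
    (hpq : p ≤ q) (h : ∀ j, Y j ∉ Set.Ioc p q) : pointCount Y q = pointCount Y p := by
  rw [pointCount_add hY.finite hp hpq]
  have : {j : ℤ | Y j ∈ Set.Ioc p q} = ∅ := Set.eq_empty_of_forall_notMem h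
  rw [this]
  simp

lemma exists_isGreatest (hY : IsRegularConfig Y) (x : ℝ) :
    ∃ L, IsGreatest (insert 0 {y | (0 < y ∧ ∃ j, Y j = y) ∧ y ≤ x}) L := by
  have hfin : (insert 0 {y | (0 < y ∧ ∃ j, Y j = y) ∧ y ≤ x}).Finite := by
    refine Set.Finite.insert _ (((hY.finite x).image Y).subset ?_)
    rintro y ⟨⟨h0, j, rfl⟩, h1⟩
    exact ⟨j, ⟨h0.le, h1⟩, rfl⟩
  exact exists_isGreatest_of_finite hfin ⟨0, Set.mem_insert _ _⟩

lemma exists_isGreatest_lt (hY : IsRegularConfig Y) (x : ℝ) :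
    ∃ L, IsGreatest (insert 0 {y | (0 < y ∧ ∃ j, Y j = y) ∧ y < x}) L := by
  have hfin : (insert 0 {y | (0 < y ∧ ∃ j, Y j = y) ∧ y < x}).Finite := by
    refine Set.Finite.insert _ (((hY.finite x).image Y).subset ?_)
    rintro y ⟨⟨h0, j, rfl⟩, h1⟩
    exact ⟨j, ⟨h0.le, h1.le⟩, rfl⟩
  exact exists_isGreatest_of_finite hfin ⟨0, Set.mem_insert _ _⟩

lemma exists_isLeast (hY : IsRegularConfig Y) {x : ℝ} (hx : 0 ≤ x) :
    ∃ R, IsLeast {y | (0 < y ∧ ∃ j, Y j = y) ∧ x < y} R := by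
  obtain ⟨j₀, hj₀⟩ := hY.unbounded x
  have hfin : {y | (0 < y ∧ ∃ j, Y j = y) ∧ x < y ∧ y ≤ Y j₀}.Finite := by
    refine ((hY.finite (Y j₀)).image Y).subset ?_
    rintro y ⟨⟨h0, j, rfl⟩, h1, h2⟩
    exact ⟨j, ⟨h0.le, h2⟩, rfl⟩
  obtain ⟨R, hR, hmin⟩ := exists_isLeast_of_finite hfin
    ⟨Y j₀, ⟨hx.trans_lt hj₀, j₀, rfl⟩, hj₀, le_rfl⟩
  refine ⟨R, ⟨hR.1, hR.2.1⟩, fun y hy => ?_⟩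
  rcases le_total y (Y j₀) with h | h
  · exact hmin ⟨hy.1, hy.2, h⟩
  · exact hR.2.2.trans h

/-- The count is constant on the gap around a level carrying no point, and just to the left of a
point it is smaller by at least one. -/
lemma jumps_pointCount (hY : IsRegularConfig Y) :
    jumps (pointCount Y) = {y | 0 < y ∧ ∃ j, Y j = y} := by
  ext y
  refine ⟨fun ⟨h0, hc⟩ => ⟨h0, ?_⟩, fun ⟨h0, j, hj⟩ => ⟨h0, fun hc => ?_⟩⟩
  · by_contra hcon
    push Not at hcon
    apply hc
    obtain ⟨L, hL, hLmax⟩ := hY.exists_isGreatest y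
    obtain ⟨R, hR, hRmin⟩ := hY.exists_isLeast h0.le
    have hLy : L < y := by
      rcases hL with rfl | ⟨⟨_, j, hj⟩, h⟩
      · exact h0
      · exact lt_of_le_of_ne h fun h' => hcon j (hj.trans h')
    have hL0 : 0 ≤ L := hLmax (Set.mem_insert _ _)
    have hno : ∀ j, L < Y j → R ≤ Y j := by
      intro j hj
      rcases le_or_gt (Y j) y with h | h
      · exact absurd (hLmax (Or.inr ⟨⟨hL0.trans_lt hj, j, rfl⟩, h⟩)) (not_le.2 hj)
      · exact hRmin ⟨⟨h0.trans h, j, rfl⟩, h⟩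
    refine (continuousAt_const (y := pointCount Y L)).congr ?_
    filter_upwards [Ioo_mem_nhds hLy hR.2] with z hz
    exact (hY.pointCount_eq_of_forall_notMem hL0 hz.1.le fun j hj =>
      absurd (hno j hj.1) (not_le.2 (hj.2.trans_lt hz.2))).symm
  · obtain ⟨δ, hδ, hd⟩ := Metric.continuousAt_iff.1 hc 1 one_pos
    set z := max 0 (y - δ / 2) with hz
    have hz0 : 0 ≤ z := le_max_left _ _
    have hzy : z < y := max_lt h0 (by linarith)
    have h1 : dist (pointCount Y z) (pointCount Y y) < 1 := by
      apply hd
      rw [Real.dist_eq, abs_lt]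
      constructor <;> linarith [le_max_right 0 (y - δ / 2)]
    have h2 := pointCount_add hY.finite hz0 hzy.le
    have h3 : (1 : ℝ) ≤ ({j : ℤ | Y j ∈ Set.Ioc z y}.ncard : ℝ) := by
      exact_mod_cast (Set.ncard_pos (hY.finite_Ioc hz0)).2 ⟨j, by
        show Y j ∈ Set.Ioc z y
        rw [hj]; exact ⟨hzy, le_rfl⟩⟩
    rw [Real.dist_eq, abs_lt] at h1
    linarith

/-- Description of the nodes around a point `x ≥ 0`. -/
lemma exists_nodes (hY : IsRegularConfig Y) {x : ℝ} (hx : 0 ≤ x) :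
    ∃ L R, IsGreatest (insert 0 {y | (0 < y ∧ ∃ j, Y j = y) ∧ y ≤ x}) L ∧
      IsLeast {y | (0 < y ∧ ∃ j, Y j = y) ∧ x < y} R ∧ 0 ≤ L ∧ L ≤ x ∧ x < R ∧
      (∀ j, L < Y j → R ≤ Y j) ∧ (∃ j, Y j = R) := by
  obtain ⟨L, hL⟩ := hY.exists_isGreatest x
  obtain ⟨R, hR⟩ := hY.exists_isLeast hx
  have hL0 : 0 ≤ L := hL.2 (Set.mem_insert _ _)
  refine ⟨L, R, hL, hR, hL0, ?_, hR.1.2, fun j hj => ?_, hR.1.1.2⟩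
  · rcases hL.1 with h | h
    · rwa [h]
    · exact h.2
  · rcases le_or_gt (Y j) x with h | h
    · exact absurd (hL.2 (Or.inr ⟨⟨hL0.trans_lt hj, j, rfl⟩, h⟩)) (not_le.2 hj)
    · exact hR.2 ⟨⟨hx.trans_lt h, j, rfl⟩, h⟩

lemma leftNode_eq (hY : IsRegularConfig Y) {x L : ℝ}
    (hL : IsGreatest (insert 0 {y | (0 < y ∧ ∃ j, Y j = y) ∧ y ≤ x}) L) :
    leftNode (pointCount Y) x = L := by
  rw [leftNode, hY.jumps_pointCount]
  exact hL.csSup_eq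

lemma rightNode_eq (hY : IsRegularConfig Y) {x R : ℝ}
    (hR : IsLeast {y | (0 < y ∧ ∃ j, Y j = y) ∧ x < y} R) :
    rightNode (pointCount Y) x = R := by
  rw [rightNode, hY.jumps_pointCount]
  exact hR.csInf_eq

/-- Injectivity of `Y` makes the jump at `R` exactly one, so the slope on the gap is `1 / (R - L)`.
-/
lemma interpolate_eq (hY : IsRegularConfig Y) {x L R : ℝ} (hx : 0 ≤ x)
    (hL : IsGreatest (insert 0 {y | (0 < y ∧ ∃ j, Y j = y) ∧ y ≤ x}) L)
    (hR : IsLeast {y | (0 < y ∧ ∃ j, Y j = y) ∧ x < y} R) :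
    pointCount Y x = pointCount Y L ∧
      interpolate (pointCount Y) x = pointCount Y x + (x - L) / (R - L) := by
  obtain ⟨L', R', hL', hR', hL0, hLx, hxR, hno, j, hj⟩ := hY.exists_nodes hx
  obtain rfl := hL.unique hL'
  obtain rfl := hR.unique hR'
  have h1 : pointCount Y x = pointCount Y L :=
    hY.pointCount_eq_of_forall_notMem hL0 hLx fun j hj =>
      absurd (hno j hj.1) (not_le.2 (hj.2.trans_lt hxR))
  have h2 : pointCount Y R = pointCount Y L + 1 := by
    rw [pointCount_add hY.finite hL0 (hLx.trans hxR.le)]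
    have : {j : ℤ | Y j ∈ Set.Ioc L R} = {j} := by
      ext i
      simp only [Set.mem_ofPred_eq, Set.mem_singleton_iff]
      refine ⟨fun h => hY.injective ?_, fun h => ?_⟩
      · rw [hj]; exact le_antisymm h.2 (hno i h.1)
      · rw [h, hj]; exact ⟨hLx.trans_lt hxR, le_rfl⟩
    rw [this]
    simp
  refine ⟨h1, ?_⟩
  rw [interpolate, hY.leftNode_eq hL, hY.rightNode_eq hR, h2, h1]
  ring

/-- This permits replacing the interpolation by the count itself: the error becomes `1/√T` after
rescaling. -/
lemma abs_interpolate_sub_le (hY : IsRegularConfig Y) {x : ℝ} (hx : 0 ≤ x) :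
    |interpolate (pointCount Y) x - pointCount Y x| ≤ 1 := by
  obtain ⟨L, R, hL, hR, hL0, hLx, hxR, hno, j, hj⟩ := hY.exists_nodes hx
  rw [(hY.interpolate_eq hx hL hR).2, add_sub_cancel_left,
    abs_of_nonneg (div_nonneg (by linarith) (by linarith)), div_le_one (by linarith)]
  linarith

lemma interpolate_zero (hY : IsRegularConfig Y) (h0 : ∀ j, Y j ≠ 0) :
    interpolate (pointCount Y) 0 = 0 := by
  obtain ⟨L, R, hL, hR, hL0, hLx, hxR, hno, j, hj⟩ := hY.exists_nodes le_rfl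
  have hL' : L = 0 := le_antisymm hLx hL0
  rw [(hY.interpolate_eq le_rfl hL hR).2, hL', pointCount]
  have : {j : ℤ | Y j ∈ Set.Icc (0 : ℝ) 0} = ∅ :=
    Set.eq_empty_of_forall_notMem fun j hj => h0 j (le_antisymm hj.2 hj.1)
  rw [this]
  simp

lemma interpolate_eq_affine (hY : IsRegularConfig Y) {x L R : ℝ} (hx : 0 ≤ x)
    (hL : IsGreatest (insert 0 {y | (0 < y ∧ ∃ j, Y j = y) ∧ y ≤ x}) L)
    (hR : IsLeast {y | (0 < y ∧ ∃ j, Y j = y) ∧ x < y} R) {y : ℝ} (hy : y ∈ Set.Icc L R) :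
    interpolate (pointCount Y) y = pointCount Y L + (y - L) / (R - L) := by
  obtain ⟨L', R', hL', hR', hL0, hLx, hxR, hno, j, hj⟩ := hY.exists_nodes hx
  obtain rfl := hL.unique hL'
  obtain rfl := hR.unique hR'
  rcases hy.2.lt_or_eq with hyR | rfl
  · have hLy : IsGreatest (insert 0 {z | (0 < z ∧ ∃ j, Y j = z) ∧ z ≤ y}) L := by
      refine ⟨?_, ?_⟩
      · rcases hL.1 with h | h
        · exact Or.inl h
        · exact Or.inr ⟨h.1, hy.1⟩
      · rintro z (rfl | ⟨⟨hz0, i, rfl⟩, hz⟩)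
        · exact hL0
        · by_contra hcon
          exact absurd (hno i (not_le.1 hcon)) (not_le.2 (hz.trans_lt hyR))
    have hRy : IsLeast {z | (0 < z ∧ ∃ j, Y j = z) ∧ y < z} R := by
      refine ⟨⟨hR.1.1, hyR⟩, ?_⟩
      rintro z ⟨⟨hz0, i, rfl⟩, hz⟩
      exact hno i (hy.1.trans_lt hz)
    obtain ⟨h1, h2⟩ := hY.interpolate_eq (hL0.trans hy.1) hLy hRy
    rw [h2, h1]
  -- At the right end the point is its own left node and belongs to the next gap; the two formulas
  -- agree because the count has risen by one.
  · have hy0 : 0 ≤ y := hL0.trans hy.1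
    obtain ⟨L₂, R₂, hL₂, hR₂, -, hLx₂, hxR₂, -⟩ := hY.exists_nodes hy0
    have hLy : L₂ = y := le_antisymm hLx₂ (hL₂.2 (Or.inr ⟨hR.1.1, le_rfl⟩))
    rw [(hY.interpolate_eq hy0 hL₂ hR₂).2, hLy, sub_self, zero_div, add_zero,
      div_self (by linarith)]
    rw [pointCount_add hY.finite hL0 hy.1]
    have : {j : ℤ | Y j ∈ Set.Ioc L y} = {j} := by
      ext i
      simp only [Set.mem_ofPred_eq, Set.mem_singleton_iff]
      refine ⟨fun h => hY.injective ?_, fun h => ?_⟩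
      · rw [hj]; exact le_antisymm h.2 (hno i h.1)
      · rw [h, hj]; exact ⟨hLx.trans_lt hxR, le_rfl⟩
    rw [this]
    simp

lemma continuousOn_interpolate_Icc (hY : IsRegularConfig Y) {x L R : ℝ} (hx : 0 ≤ x)
    (hL : IsGreatest (insert 0 {y | (0 < y ∧ ∃ j, Y j = y) ∧ y ≤ x}) L)
    (hR : IsLeast {y | (0 < y ∧ ∃ j, Y j = y) ∧ x < y} R) :
    ContinuousOn (interpolate (pointCount Y)) (Set.Icc L R) := by
  refine ContinuousOn.congr (f := fun y => pointCount Y L + (y - L) / (R - L)) ?_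
    fun y hy => hY.interpolate_eq_affine hx hL hR hy
  fun_prop

/-- No node lies strictly between `x` and the largest node strictly below it, so the affine piece
starting there reaches `x`. -/
lemma exists_continuousOn_left (hY : IsRegularConfig Y) {x : ℝ} (hx : 0 < x) :
    ∃ l < x, ContinuousOn (interpolate (pointCount Y)) (Set.Icc l x) := by
  obtain ⟨L, hL⟩ := hY.exists_isGreatest_lt x
  have hL0 : 0 ≤ L := hL.2 (Set.mem_insert _ _)
  have hLx : L < x := by
    rcases hL.1 with h | h
    · rwa [h]
    · exact h.2
  obtain ⟨L', R, hL', hR, hL0', hLx', hxR, hno, j, hj⟩ := hY.exists_nodes hL0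
  have hLL : L' = L := by
    refine le_antisymm hLx' (hL'.2 ?_)
    rcases hL.1 with h | h
    · exact Or.inl h
    · exact Or.inr ⟨h.1, le_rfl⟩
  rw [hLL] at hL'
  refine ⟨L, hLx, (hY.continuousOn_interpolate_Icc hL0 hL' hR).mono (Set.Icc_subset_Icc_right ?_)⟩
  by_contra hcon
  exact absurd (hL.2 (Or.inr ⟨hR.1.1, not_le.1 hcon⟩)) (not_le.2 hxR)

lemma continuousOn_interpolate (hY : IsRegularConfig Y) :
    ContinuousOn (interpolate (pointCount Y)) (Set.Ici 0) := by
  intro x hx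
  obtain ⟨L, R, hL, hR, hL0, hLx, hxR, -⟩ := hY.exists_nodes hx
  have hr : ContinuousWithinAt (interpolate (pointCount Y)) (Set.Icc x R) x :=
    ((hY.continuousOn_interpolate_Icc hx hL hR).mono (Set.Icc_subset_Icc_left hLx)) x
      ⟨le_rfl, hxR.le⟩
  rcases (show 0 ≤ x from hx).eq_or_lt with h0 | h0
  · refine hr.mono_of_mem_nhdsWithin ?_
    rw [← h0] at hxR ⊢
    exact Icc_mem_nhdsGE hxR
  · obtain ⟨l, hl, hc⟩ := hY.exists_continuousOn_left h0
    have hl' := hc x ⟨hl.le, le_rfl⟩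
    have := hl'.union hr
    rw [Set.Icc_union_Icc_eq_Icc hl.le hxR.le] at this
    exact (this.continuousAt (Icc_mem_nhds hl hxR)).continuousWithinAt

end IsRegularConfig

/-- The number of points in a set, as an extended nonnegative real. -/
noncomputable def pointCountENN (Y : ℤ → ℝ) (s : Set ℝ) : ENNReal := ∑' j, s.indicator 1 (Y j)

lemma pointCountENN_toReal (Y : ℤ → ℝ) (s : Set ℝ) :
    (pointCountENN Y s).toReal = ({j : ℤ | Y j ∈ s}.ncard : ℝ) := by
  have h : pointCountENN Y s = ({j : ℤ | Y j ∈ s}.encard : ENNReal) := by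
    rw [pointCountENN, ← ENNReal.tsum_set_one]
    exact (tsum_subtype {j : ℤ | Y j ∈ s} fun _ => (1 : ENNReal)).symm
  rw [h, Set.ncard]
  -- For infinitely many points both sides take the default value `0`.
  rcases eq_or_ne ({j : ℤ | Y j ∈ s}.encard) ⊤ with h | h
  · simp [h]
  · lift {j : ℤ | Y j ∈ s}.encard to ℕ using h with n
    simp

lemma pointCountENN_ne_top_iff (Y : ℤ → ℝ) (s : Set ℝ) :
    pointCountENN Y s ≠ ⊤ ↔ {j : ℤ | Y j ∈ s}.Finite := by
  have h : pointCountENN Y s = ({j : ℤ | Y j ∈ s}.encard : ENNReal) := by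
    rw [pointCountENN, ← ENNReal.tsum_set_one]
    exact (tsum_subtype {j : ℤ | Y j ∈ s} fun _ => (1 : ENNReal)).symm
  rw [h, ← Set.encard_ne_top_iff]
  simp

lemma measurable_pointCountENN {s : Set ℝ} (hs : MeasurableSet s) :
    Measurable fun Y : ℤ → ℝ => pointCountENN Y s :=
  Measurable.tsum fun j => (measurable_one.indicator hs).comp (measurable_pi_apply j)

lemma measurable_pointCount (x : ℝ) : Measurable fun Y : ℤ → ℝ => pointCount Y x := by
  have h := (measurable_pointCountENN (measurableSet_Icc (a := 0) (b := x))).ennreal_toReal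
  simp_rw [pointCountENN_toReal] at h
  exact h

open Classical in
/-- A measurable expression for the interpolated counting function. -/
noncomputable def interpolatedCount (Y : ℤ → ℝ) (x : ℝ) : ℝ :=
  pointCount Y x +
    (x - (⨆ j, (Set.Icc 0 x).indicator ENNReal.ofReal (Y j)).toReal) /
    ((⨅ j, if x < Y j then ENNReal.ofReal (Y j) else ⊤).toReal -
      (⨆ j, (Set.Icc 0 x).indicator ENNReal.ofReal (Y j)).toReal)

lemma measurable_interpolatedCount (x : ℝ) :
    Measurable fun Y : ℤ → ℝ => interpolatedCount Y x := by
  have h1 : Measurable fun Y : ℤ → ℝ =>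
      (⨆ j, (Set.Icc 0 x).indicator ENNReal.ofReal (Y j)).toReal :=
    (Measurable.iSup fun j => (ENNReal.measurable_ofReal.indicator measurableSet_Icc).comp
      (measurable_pi_apply j)).ennreal_toReal
  have h2 : Measurable fun Y : ℤ → ℝ =>
      (⨅ j, if x < Y j then ENNReal.ofReal (Y j) else ⊤).toReal :=
    (Measurable.iInf fun j => Measurable.ite
      (measurableSet_lt measurable_const (measurable_pi_apply j))
      (ENNReal.measurable_ofReal.comp (measurable_pi_apply j)) measurable_const).ennreal_toReal
  exact (measurable_pointCount x).add ((measurable_const.sub h1).div (h2.sub h1))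

/-- Countable suprema and infima over the indices express the nodes measurably. In `ENNReal` the
supremum is `0` when no point lies in `[0,x]`, which is the node at the origin. -/
lemma IsRegularConfig.interpolate_eq_interpolatedCount {Y : ℤ → ℝ} (hY : IsRegularConfig Y) {x : ℝ}
    (hx : 0 ≤ x) : interpolate (pointCount Y) x = interpolatedCount Y x := by
  obtain ⟨L, R, hL, hR, hL0, hLx, hxR, hno, i, hi⟩ := hY.exists_nodes hx
  have h1 : ⨆ j, (Set.Icc 0 x).indicator ENNReal.ofReal (Y j) = ENNReal.ofReal L := by
    apply le_antisymm
    · refine iSup_le fun j => Set.indicator_apply_le' (fun h => ?_) fun _ => zero_le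
      refine ENNReal.ofReal_le_ofReal ?_
      rcases h.1.eq_or_lt with h0 | h0
      · rw [← h0]; exact hL0
      · exact hL.2 (Or.inr ⟨⟨h0, j, rfl⟩, h.2⟩)
    · rcases hL.1 with h | ⟨⟨h0, j, hj⟩, h⟩
      · rw [h]; simp
      · refine le_iSup_of_le j ?_
        rw [hj, Set.indicator_of_mem (show L ∈ Set.Icc 0 x from ⟨h0.le, h⟩)]
  have h2 : (⨅ j, if x < Y j then ENNReal.ofReal (Y j) else ⊤) = ENNReal.ofReal R := by
    apply le_antisymm
    · refine iInf_le_of_le i ?_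
      rw [hi, if_pos hxR]
    · refine le_iInf fun j => ?_
      split_ifs with h
      · exact ENNReal.ofReal_le_ofReal (hno j (hLx.trans_lt h))
      · exact le_top
  rw [(hY.interpolate_eq hx hL hR).2, interpolatedCount, h1, h2, ENNReal.toReal_ofReal hL0,
    ENNReal.toReal_ofReal (hx.trans hxR.le)]

end Configuration

/-! ### Deterministic counting of shifted lattice points. -/

section Lattice

variable {a : ℝ}

/-- Counting the points of a shifted lattice in an interval. -/
lemma exists_hasSum_lattice (ha : 0 < a) (e x : ℝ) {p q : ℝ} (hpq : p ≤ q) :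
    ∃ n : ℝ, HasSum (fun j : ℤ => (Set.Ioc p q).indicator (1 : ℝ → ℝ) (x + a * ((j : ℝ) - e))) n ∧
      |n - (q - p) / a| ≤ 1 := by
  -- The points in `(p, q]` are those with `A < j ≤ B`. Both floors err downwards by less than one,
  -- so `B - A` differs from `(q - p)/a` by at most `1`, whatever `x` and `e` are.
  set A := ⌊(p - x) / a + e⌋ with hA
  set B := ⌊(q - x) / a + e⌋ with hB
  have hmem : ∀ j : ℤ, x + a * ((j : ℝ) - e) ∈ Set.Ioc p q ↔ j ∈ Finset.Ioc A B := by
    intro j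
    rw [Set.mem_Ioc, Finset.mem_Ioc, hA, hB, Int.floor_lt, Int.le_floor,
      ← lt_sub_iff_add_lt, ← sub_le_iff_le_add, div_lt_iff₀ ha, le_div_iff₀ ha]
    constructor <;> rintro ⟨h1, h2⟩ <;> constructor <;> linarith
  have hAB : A ≤ B := Int.floor_le_floor (by gcongr)
  refine ⟨((Finset.Ioc A B).card : ℝ), ?_, ?_⟩
  · have h := hasSum_sum_of_ne_finset_zero (L := .unconditional ℤ)
      (f := fun j : ℤ => (Set.Ioc p q).indicator (1 : ℝ → ℝ) (x + a * ((j : ℝ) - e)))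
      (s := Finset.Ioc A B) (fun j hj => Set.indicator_of_notMem (fun h => hj ((hmem j).1 h)) _)
    rwa [Finset.sum_congr rfl fun j hj => Set.indicator_of_mem ((hmem j).2 hj) _,
      Pi.one_def, Finset.sum_const, nsmul_one] at h
  · have hc : ((Finset.Ioc A B).card : ℝ) = (B : ℝ) - A := by
      have : (((Finset.Ioc A B).card : ℤ) : ℝ) = ((B - A : ℤ) : ℝ) := by
        rw [Int.card_Ioc, Int.toNat_of_nonneg (by linarith)]
      push_cast at this
      exact this
    have h1 := Int.floor_le ((p - x) / a + e)
    have h2 := Int.lt_floor_add_one ((p - x) / a + e)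
    have h3 := Int.floor_le ((q - x) / a + e)
    have h4 := Int.lt_floor_add_one ((q - x) / a + e)
    have h5 : (q - p) / a = ((q - x) / a + e) - ((p - x) / a + e) := by ring
    rw [hc, h5, abs_le]
    constructor <;> linarith

/-- The symmetric difference of an interval and its translate by `d` is one piece of length `min (q
- p) d` at each end. This is the source of the `min` in the limiting variance. -/
lemma indicator_Ioc_sub_sq {p q d y : ℝ} (hd : 0 ≤ d) :
    ((Set.Ioc p q).indicator (1 : ℝ → ℝ) y - (Set.Ioc p q).indicator (1 : ℝ → ℝ) (y - d)) ^ 2 =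
      (Set.Ioc p (p + min (q - p) d)).indicator (1 : ℝ → ℝ) y +
      (Set.Ioc (q + d - min (q - p) d) (q + d)).indicator (1 : ℝ → ℝ) y := by
  rcases le_total (q - p) d with h | h
  · rw [min_eq_left h]
    simp only [Set.indicator_apply, Set.mem_Ioc, Pi.one_apply]
    split_ifs <;> grind
  · rw [min_eq_right h]
    simp only [Set.indicator_apply, Set.mem_Ioc, Pi.one_apply]
    split_ifs <;> grind

/-- The number of lattice points on which two shifted intervals disagree. -/
lemma exists_hasSum_lattice_sub_sq (ha : 0 < a) (e x x' : ℝ) {p q : ℝ} (hpq : p ≤ q) :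
    ∃ n : ℝ, HasSum (fun j : ℤ =>
        ((Set.Ioc p q).indicator (1 : ℝ → ℝ) (x + a * ((j : ℝ) - e)) -
          (Set.Ioc p q).indicator (1 : ℝ → ℝ) (x' + a * ((j : ℝ) - e))) ^ 2) n ∧
      |n - 2 * min (q - p) |x - x'| / a| ≤ 2 := by
  wlog hx : x' ≤ x generalizing x x'
  · obtain ⟨n, h1, h2⟩ := this x' x (le_of_not_ge hx)
    rw [abs_sub_comm x' x] at h2
    refine ⟨n, ?_, h2⟩
    convert h1 using 2
    ring
  have hm : 0 ≤ min (q - p) (x - x') := le_min (by linarith) (by linarith)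
  obtain ⟨n₁, h1, h1'⟩ := exists_hasSum_lattice ha e x
    (p := p) (q := p + min (q - p) (x - x')) (by linarith)
  obtain ⟨n₂, h2, h2'⟩ := exists_hasSum_lattice ha e x
    (p := q + (x - x') - min (q - p) (x - x')) (q := q + (x - x')) (by linarith)
  refine ⟨n₁ + n₂, ?_, ?_⟩
  · convert h1.add h2 using 2 with j
    rw [← indicator_Ioc_sub_sq (by linarith)]
    congr 3
    ring
  · rw [abs_of_nonneg (by linarith : 0 ≤ x - x')]
    have h5 : n₁ + n₂ - 2 * min (q - p) (x - x') / a =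
        (n₁ - (p + min (q - p) (x - x') - p) / a) +
        (n₂ - (q + (x - x') - (q + (x - x') - min (q - p) (x - x'))) / a) := by ring
    rw [h5]
    exact (abs_add_le _ _).trans (by linarith)

end Lattice

/-! ### Fourth moments and a central limit theorem for independent bounded summands. -/

section IndependentSums

variable {Ω : Type*} [MeasurableSpace Ω] {P : Measure Ω} [IsProbabilityMeasure P]

lemma integrable_of_abs_le {f : Ω → ℝ} (hf : Measurable f) {C : ℝ} (h : ∀ ω, |f ω| ≤ C) :
    Integrable f P :=
  Integrable.of_bound hf.aestronglyMeasurable C (Filter.Eventually.of_forall h)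

lemma integrable_pow_mul_pow {S z : Ω → ℝ} (hS : Measurable S) (hz : Measurable z) {A B : ℝ}
    (hA : ∀ ω, |S ω| ≤ A) (hB : ∀ ω, |z ω| ≤ B) (m n : ℕ) :
    Integrable (fun ω => S ω ^ m * z ω ^ n) P := by
  refine integrable_of_abs_le ((hS.pow_const m).mul (hz.pow_const n)) (C := A ^ m * B ^ n)
    fun ω => ?_
  rw [abs_mul, abs_pow, abs_pow]
  have := (abs_nonneg _).trans (hA ω)
  gcongr
  · exact hA ω
  · exact hB ω

lemma integral_add_sq_of_indepFun {S z : Ω → ℝ} (hS : Measurable S) (hz : Measurable z) {A B : ℝ}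
    (hA : ∀ ω, |S ω| ≤ A) (hB : ∀ ω, |z ω| ≤ B) (hind : IndepFun S z P)
    (hz0 : ∫ ω, z ω ∂P = 0) :
    ∫ ω, (S ω + z ω) ^ 2 ∂P = ∫ ω, S ω ^ 2 ∂P + ∫ ω, z ω ^ 2 ∂P := by
  have J := fun m n => integrable_pow_mul_pow (P := P) hS hz hA hB m n
  have h1 : ∀ ω, (S ω + z ω) ^ 2 = S ω ^ 2 * z ω ^ 0 + 2 * (S ω ^ 1 * z ω ^ 1) +
      S ω ^ 0 * z ω ^ 2 := fun ω => by ring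
  simp_rw [h1]
  have k1 := integral_add (J 2 0) ((J 1 1).const_mul 2)
  have k2 := integral_add ((J 2 0).add ((J 1 1).const_mul 2)) (J 0 2)
  simp only [Pi.add_apply] at k1 k2
  rw [k2, k1, integral_const_mul]
  have h2 : ∫ ω, S ω ^ 1 * z ω ^ 1 ∂P = 0 := by
    simp_rw [pow_one]
    rw [hind.integral_fun_mul_eq_mul_integral hS.aestronglyMeasurable hz.aestronglyMeasurable,
      hz0, mul_zero]
  rw [h2]
  simp

lemma integral_add_pow_four_of_indepFun {S z : Ω → ℝ} (hS : Measurable S) (hz : Measurable z)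
    {A B : ℝ} (hA : ∀ ω, |S ω| ≤ A) (hB : ∀ ω, |z ω| ≤ B) (hind : IndepFun S z P)
    (hS0 : ∫ ω, S ω ∂P = 0) (hz0 : ∫ ω, z ω ∂P = 0) :
    ∫ ω, (S ω + z ω) ^ 4 ∂P = ∫ ω, S ω ^ 4 ∂P + 6 * ((∫ ω, S ω ^ 2 ∂P) * ∫ ω, z ω ^ 2 ∂P) +
      ∫ ω, z ω ^ 4 ∂P := by
  have J := fun m n => integrable_pow_mul_pow (P := P) hS hz hA hB m n
  have E : ∀ m n : ℕ, ∫ ω, S ω ^ m * z ω ^ n ∂P = (∫ ω, S ω ^ m ∂P) * ∫ ω, z ω ^ n ∂P := fun m n =>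
    hind.integral_fun_comp_mul_comp (f := fun x => x ^ m) (g := fun x => x ^ n) hS.aemeasurable
      hz.aemeasurable (by fun_prop) (by fun_prop)
  have h1 : ∀ ω, (S ω + z ω) ^ 4 = S ω ^ 4 * z ω ^ 0 + 4 * (S ω ^ 3 * z ω ^ 1) +
      6 * (S ω ^ 2 * z ω ^ 2) + 4 * (S ω ^ 1 * z ω ^ 3) + S ω ^ 0 * z ω ^ 4 := fun ω => by ring
  simp_rw [h1]
  have J1 := (J 4 0).add ((J 3 1).const_mul 4)
  have J2 := J1.add ((J 2 2).const_mul 6)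
  have J3 := J2.add ((J 1 3).const_mul 4)
  have k1 := integral_add (J 4 0) ((J 3 1).const_mul 4)
  have k2 := integral_add J1 ((J 2 2).const_mul 6)
  have k3 := integral_add J2 ((J 1 3).const_mul 4)
  have k4 := integral_add J3 (J 0 4)
  simp only [Pi.add_apply] at k1 k2 k3 k4
  rw [k4, k3, k2, k1]
  simp_rw [integral_const_mul, E, pow_one, hS0, hz0]
  simp

lemma abs_sum_le_card_mul {ι : Type*} {f : ι → ℝ} {B : ℝ} (h : ∀ i, |f i| ≤ B) (s : Finset ι) :
    |∑ i ∈ s, f i| ≤ s.card * B :=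
  (Finset.abs_sum_le_sum_abs _ _).trans ((Finset.sum_le_sum fun i _ => h i).trans (by simp))

variable {ι : Type*}

/-- Second and fourth moments of sums of independent centered bounded variables. -/
lemma moments_sum_of_iIndepFun {z : ι → Ω → ℝ} (hz : ∀ i, Measurable (z i))
    (hind : iIndepFun z P) (hB : ∀ i ω, |z i ω| ≤ 2) (hz0 : ∀ i, ∫ ω, z i ω ∂P = 0)
    (s : Finset ι) :
    ∫ ω, (∑ i ∈ s, z i ω) ^ 2 ∂P = ∑ i ∈ s, ∫ ω, z i ω ^ 2 ∂P ∧
      ∫ ω, (∑ i ∈ s, z i ω) ^ 4 ∂P ≤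
        3 * (∑ i ∈ s, ∫ ω, z i ω ^ 2 ∂P) ^ 2 + 4 * ∑ i ∈ s, ∫ ω, z i ω ^ 2 ∂P := by
  classical
  induction s using Finset.induction_on with
  | empty => simp
  | insert i s hi ih =>
    have hS : Measurable fun ω => ∑ j ∈ s, z j ω := Finset.measurable_sum _ fun j _ => hz j
    have hA : ∀ ω, |∑ j ∈ s, z j ω| ≤ s.card * 2 := fun ω =>
      abs_sum_le_card_mul (fun j => hB j ω) s
    have hSz : IndepFun (fun ω => ∑ j ∈ s, z j ω) (z i) P := by
      have := hind.indepFun_finsetSum_of_notMem hz hi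
      convert this using 1
      ext ω; simp
    have hS0 : ∫ ω, ∑ j ∈ s, z j ω ∂P = 0 := by
      rw [integral_finsetSum _ fun j _ => integrable_of_abs_le (hz j) (hB j)]
      simp [hz0]
    simp_rw [Finset.sum_insert hi, add_comm (z i _)]
    rw [integral_add_sq_of_indepFun hS (hz i) hA (hB i) hSz (hz0 i),
      integral_add_pow_four_of_indepFun hS (hz i) hA (hB i) hSz hS0 (hz0 i), ih.1]
    refine ⟨add_comm _ _, ?_⟩
    -- `|z| ≤ 2` gives `z⁴ ≤ 4z²`, which feeds the linear term; the cross term of the expansion is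
    -- absorbed by `3(S + v)² = 3S² + 6Sv + 3v²`.
    have h4 : ∫ ω, z i ω ^ 4 ∂P ≤ 4 * ∫ ω, z i ω ^ 2 ∂P := by
      rw [← integral_const_mul]
      refine integral_mono ?_ ?_ fun ω => ?_
      · simpa using integrable_pow_mul_pow (P := P) (hz i) (hz i) (hB i) (hB i) 4 0
      · simpa using (integrable_pow_mul_pow (P := P) (hz i) (hz i) (hB i) (hB i) 2 0).const_mul 4
      · have h1 : z i ω ^ 2 ≤ 4 := by
          have := abs_le.1 (hB i ω)
          nlinarith
        show z i ω ^ 4 ≤ 4 * z i ω ^ 2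
        nlinarith [sq_nonneg (z i ω)]
    have h2 : 0 ≤ ∫ ω, z i ω ^ 2 ∂P := integral_nonneg fun ω => sq_nonneg _
    nlinarith [ih.2, sq_nonneg (∫ ω, z i ω ^ 2 ∂P)]

/-- Fourth moment bound for infinite sums of independent bounded variables. -/
lemma lintegral_tsum_sub_pow_four_le [Countable ι] {η : ι → Ω → ℝ} (hη : ∀ i, Measurable (η i))
    (hind : iIndepFun η P) (hB : ∀ i ω, |η i ω| ≤ 1) (hsum : ∀ᵐ ω ∂P, Summable fun i => η i ω)
    {m V : ℝ} (hm : HasSum (fun i => ∫ ω, η i ω ∂P) m) (hV : HasSum (fun i => Var[η i; P]) V) :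
    ∫⁻ ω, ENNReal.ofReal ((∑' i, η i ω - m) ^ 4) ∂P ≤ ENNReal.ofReal (3 * V ^ 2 + 4 * V) := by
  set z : ι → Ω → ℝ := fun i ω => η i ω - ∫ ω, η i ω ∂P with hzdef
  have hmean : ∀ i, |∫ ω, η i ω ∂P| ≤ 1 := fun i => by
    have := norm_integral_le_of_norm_le_const (μ := P) (f := η i) (C := 1)
      (Filter.Eventually.of_forall (hB i))
    simpa using this
  have hz : ∀ i, Measurable (z i) := fun i => (hη i).sub_const _
  have hzi : iIndepFun z P :=
    hind.comp (fun i x => x - ∫ ω, η i ω ∂P) fun i => measurable_id.sub_const _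
  have hzB : ∀ i ω, |z i ω| ≤ 2 := fun i ω => by
    have h1 := abs_le.1 (hB i ω)
    have h2 := abs_le.1 (hmean i)
    rw [abs_le]
    constructor <;> simp only [hzdef] <;> linarith
  have hz0 : ∀ i, ∫ ω, z i ω ∂P = 0 := fun i => by
    simp only [hzdef]
    rw [integral_sub (integrable_of_abs_le (hη i) (hB i)) (integrable_const _)]
    simp
  have hvar : ∀ i, ∫ ω, z i ω ^ 2 ∂P = Var[η i; P] := fun i =>
    (variance_eq_integral (hη i).aemeasurable).symm
  have hVs : ∀ s : Finset ι, ∑ i ∈ s, ∫ ω, z i ω ^ 2 ∂P ≤ V := fun s => by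
    simp_rw [hvar]
    exact sum_le_hasSum s (fun i _ => variance_nonneg _ _) hV
  have hlim : ∀ᵐ ω ∂P, Tendsto (fun s : Finset ι => ENNReal.ofReal ((∑ i ∈ s, z i ω) ^ 4)) atTop
      (𝓝 (ENNReal.ofReal ((∑' i, η i ω - m) ^ 4))) := by
    filter_upwards [hsum] with ω hω
    have : HasSum (fun i => z i ω) (∑' i, η i ω - m) := hω.hasSum.sub hm
    exact (ENNReal.continuous_ofReal.tendsto _).comp (Tendsto.pow this 4)
  -- Fatou along the finite partial sums; countability of `ι` makes this filter countably generated.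
  calc ∫⁻ ω, ENNReal.ofReal ((∑' i, η i ω - m) ^ 4) ∂P
      = ∫⁻ ω, liminf (fun s : Finset ι => ENNReal.ofReal ((∑ i ∈ s, z i ω) ^ 4)) atTop ∂P :=
        lintegral_congr_ae (hlim.mono fun ω h => h.liminf_eq.symm)
    _ ≤ liminf (fun s : Finset ι => ∫⁻ ω, ENNReal.ofReal ((∑ i ∈ s, z i ω) ^ 4) ∂P) atTop :=
        lintegral_liminf_le fun s =>
          ((Finset.measurable_sum _ fun j _ => hz j).pow_const 4).ennreal_ofReal
    _ ≤ ENNReal.ofReal (3 * V ^ 2 + 4 * V) := by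
        refine liminf_le_of_le (by isBoundedDefault) fun b hb => ?_
        obtain ⟨s, hs⟩ := hb.exists
        refine hs.trans ?_
        rw [← ofReal_integral_eq_lintegral_ofReal]
        · refine ENNReal.ofReal_le_ofReal ((moments_sum_of_iIndepFun hz hzi hzB hz0 s).2.trans ?_)
          have h0 : 0 ≤ ∑ i ∈ s, ∫ ω, z i ω ^ 2 ∂P :=
            Finset.sum_nonneg fun i _ => integral_nonneg fun ω => sq_nonneg _
          have := hVs s
          gcongr
        · simpa using integrable_pow_mul_pow (P := P)
            (Finset.measurable_sum s fun j _ => hz j) (Finset.measurable_sum s fun j _ => hz j)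
            (fun ω => abs_sum_le_card_mul (fun j => hzB j ω) s)
            (fun ω => abs_sum_le_card_mul (fun j => hzB j ω) s) 4 0
        · exact Filter.Eventually.of_forall fun ω => by positivity

/-- Lindeberg replacement: factors in the closed unit disc are exchanged one at a time. -/
lemma norm_prod_sub_prod_le {a b : ι → ℂ} (ha : ∀ i, ‖a i‖ ≤ 1) (hb : ∀ i, ‖b i‖ ≤ 1)
    (s : Finset ι) : ‖∏ i ∈ s, a i - ∏ i ∈ s, b i‖ ≤ ∑ i ∈ s, ‖a i - b i‖ := by
  classical
  induction s using Finset.induction_on with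
  | empty => simp
  | insert i s hi ih =>
    rw [Finset.prod_insert hi, Finset.prod_insert hi, Finset.sum_insert hi]
    have h1 : a i * ∏ j ∈ s, a j - b i * ∏ j ∈ s, b j =
        (a i - b i) * ∏ j ∈ s, a j + b i * (∏ j ∈ s, a j - ∏ j ∈ s, b j) := by ring
    rw [h1]
    refine (norm_add_le _ _).trans ?_
    rw [norm_mul, norm_mul]
    have h2 : ‖∏ j ∈ s, a j‖ ≤ 1 := by
      rw [norm_prod]
      exact Finset.prod_le_one (fun _ _ => norm_nonneg _) fun j _ => ha j
    have h3 := mul_le_of_le_one_right (norm_nonneg (a i - b i)) h2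
    have h4 := mul_le_of_le_one_left (norm_nonneg (∏ j ∈ s, a j - ∏ j ∈ s, b j)) (hb i)
    linarith

/-- Quantitative comparison of the characteristic function of a small centered variable with the
Gaussian one. -/
lemma norm_integral_cexp_sub_le {z : Ω → ℝ} (hz : Measurable z) {δ : ℝ} (hδ : δ ≤ 1 / 2)
    (hB : ∀ ω, |z ω| ≤ 2 * δ) (hz0 : ∫ ω, z ω ∂P = 0) :
    ‖∫ ω, Complex.exp (z ω * Complex.I) ∂P - Real.exp (-(∫ ω, z ω ^ 2 ∂P) / 2)‖ ≤
      2 * δ * ∫ ω, z ω ^ 2 ∂P := by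
  set v := ∫ ω, z ω ^ 2 ∂P with hv
  have hδ0 : 0 ≤ δ := by
    obtain ⟨ω⟩ := nonempty_of_isProbabilityMeasure P
    linarith [(abs_nonneg _).trans (hB ω)]
  have hv0 : 0 ≤ v := integral_nonneg fun ω => sq_nonneg _
  have hi2 : Integrable (fun ω => z ω ^ 2) P := by
    simpa using integrable_pow_mul_pow (P := P) hz hz hB hB 2 0
  have hv1 : v ≤ (2 * δ) ^ 2 := by
    have : v ≤ ∫ _, (2 * δ) ^ 2 ∂P := integral_mono hi2 (integrable_const _) fun ω =>
      sq_le_sq' (abs_le.1 (hB ω)).1 (abs_le.1 (hB ω)).2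
    simpa using this
  -- The third-order Taylor remainder is at most `2/9 |z|³`, and one factor `|z| ≤ 2δ` is traded for
  -- `δ`. The Taylor bound needs `|z| ≤ 1`, whence `δ ≤ 1/2`.
  have hT : ∀ ω, ‖Complex.exp (z ω * Complex.I) - (1 + z ω * Complex.I - (z ω : ℂ) ^ 2 / 2)‖ ≤
      4 / 9 * δ * z ω ^ 2 := by
    intro ω
    have hn : ‖(z ω * Complex.I : ℂ)‖ = |z ω| := by simp
    have h1 := Complex.exp_bound (x := z ω * Complex.I) (by rw [hn]; linarith [hB ω])
      (n := 3) (by norm_num)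
    rw [hn] at h1
    simp only [Finset.sum_range_succ, Finset.sum_range_zero] at h1
    norm_num [Nat.factorial] at h1
    have h2 : (z ω * Complex.I : ℂ) ^ 2 / 2 = - ((z ω : ℂ) ^ 2 / 2) := by
      rw [mul_pow, Complex.I_sq]; ring
    rw [h2, ← sub_eq_add_neg] at h1
    refine h1.trans ?_
    have h3 : |z ω| ^ 3 = |z ω| * z ω ^ 2 := by rw [pow_succ, sq_abs]; ring
    rw [h3]
    nlinarith [hB ω, sq_nonneg (z ω), mul_le_mul_of_nonneg_right (hB ω) (sq_nonneg (z ω))]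
  have hiz : Integrable (fun ω => (z ω : ℂ)) P := (integrable_of_abs_le hz hB).ofReal
  have hi2' : Integrable (fun ω => (z ω : ℂ) ^ 2) P := by
    have := hi2.ofReal (𝕜 := ℂ)
    simpa using this
  have hE : ∫ ω, (1 + z ω * Complex.I - (z ω : ℂ) ^ 2 / 2) ∂P = ((1 - v / 2 : ℝ) : ℂ) := by
    have k1 : Integrable (fun ω => (1 : ℂ) + z ω * Complex.I) P :=
      (integrable_const _).add (hiz.mul_const _)
    rw [integral_sub k1 (hi2'.div_const _), integral_add (integrable_const _) (hiz.mul_const _),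
      integral_mul_const, integral_div, integral_complex_ofReal, hz0]
    have : ∫ ω, (z ω : ℂ) ^ 2 ∂P = (v : ℂ) := by
      rw [hv, ← integral_complex_ofReal]
      simp
    rw [this]
    simp
  have h5 : ‖∫ ω, Complex.exp (z ω * Complex.I) ∂P - ((1 - v / 2 : ℝ) : ℂ)‖ ≤ 4 / 9 * δ * v := by
    have k2 : Integrable (fun ω => (1 : ℂ) + z ω * Complex.I - (z ω : ℂ) ^ 2 / 2) P :=
      ((integrable_const _).add (hiz.mul_const _)).sub (hi2'.div_const _)
    rw [← hE, ← integral_sub (integrable_cexp_mul_I hz.aemeasurable) k2, hv,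
      ← integral_const_mul]
    exact norm_integral_le_of_norm_le (hi2.const_mul _) (Filter.Eventually.of_forall hT)
  have h6 : ‖((1 - v / 2 : ℝ) : ℂ) - Real.exp (-v / 2)‖ ≤ v ^ 2 / 4 := by
    rw [← Complex.ofReal_sub, Complex.norm_real, norm_sub_rev, Real.norm_eq_abs]
    have hv2 : v ≤ 1 := hv1.trans (by nlinarith)
    have := Real.abs_exp_sub_one_sub_id_le (x := -v / 2) (by rw [abs_le]; constructor <;> linarith)
    calc |Real.exp (-v / 2) - (1 - v / 2)| = |Real.exp (-v / 2) - 1 - (-v / 2)| := by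
          congr 1; ring
      _ ≤ _ := this
      _ = v ^ 2 / 4 := by ring
  have h7 : v ^ 2 / 4 ≤ δ * v := by
    have : v ≤ 2 * δ := hv1.trans (by nlinarith)
    nlinarith
  calc _ ≤ _ := norm_sub_le_norm_sub_add_norm_sub _ ((1 - v / 2 : ℝ) : ℂ) _
    _ ≤ 4 / 9 * δ * v + v ^ 2 / 4 := add_le_add h5 h6
    _ ≤ 2 * δ * v := by nlinarith [mul_nonneg hδ0 hv0]

/-- Quantitative central limit theorem for infinite sums of independent bounded variables. -/
lemma norm_integral_cexp_tsum_sub_le [Countable ι] {η : ι → Ω → ℝ} (hη : ∀ i, Measurable (η i))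
    (hind : iIndepFun η P) {δ : ℝ} (hδ : δ ≤ 1 / 2) (hB : ∀ i ω, |η i ω| ≤ δ)
    (hsum : ∀ᵐ ω ∂P, Summable fun i => η i ω)
    {m V : ℝ} (hm : HasSum (fun i => ∫ ω, η i ω ∂P) m) (hV : HasSum (fun i => Var[η i; P]) V) :
    ‖∫ ω, Complex.exp ((∑' i, η i ω : ℝ) * Complex.I) ∂P -
      Complex.exp (m * Complex.I - V / 2)‖ ≤ 2 * δ * V := by
  have hmean : ∀ i, |∫ ω, η i ω ∂P| ≤ δ := fun i => by
    have := norm_integral_le_of_norm_le_const (μ := P) (f := η i) (C := δ)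
      (Filter.Eventually.of_forall (hB i))
    simpa using this
  have hterm : ∀ i, ‖∫ ω, Complex.exp (η i ω * Complex.I) ∂P -
      Complex.exp ((∫ ω, η i ω ∂P : ℝ) * Complex.I - Var[η i; P] / 2)‖ ≤
      2 * δ * Var[η i; P] := by
    intro i
    set e := ∫ ω, η i ω ∂P with he
    have h1 := norm_integral_cexp_sub_le (P := P) (z := fun ω => η i ω - e)
      ((hη i).sub_const _) hδ (fun ω => by
        have h1 := abs_le.1 (hB i ω)
        have h2 := abs_le.1 (hmean i)
        rw [abs_le]
        constructor <;> linarith) (by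
        rw [integral_sub (integrable_of_abs_le (hη i) (hB i)) (integrable_const _)]
        simp [he])
    rw [← variance_eq_integral (hη i).aemeasurable] at h1
    have h2 : ∫ ω, Complex.exp (η i ω * Complex.I) ∂P =
        Complex.exp (e * Complex.I) * ∫ ω, Complex.exp ((η i ω - e : ℝ) * Complex.I) ∂P := by
      rw [← integral_const_mul]
      congr 1 with ω
      rw [← Complex.exp_add]
      push_cast
      ring_nf
    have h3 : Complex.exp (e * Complex.I - Var[η i; P] / 2) =
        Complex.exp (e * Complex.I) * (Real.exp (-Var[η i; P] / 2) : ℝ) := by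
      rw [Complex.ofReal_exp, ← Complex.exp_add]
      push_cast
      ring_nf
    rw [h2, h3, ← mul_sub, norm_mul, Complex.norm_exp_ofReal_mul_I, one_mul]
    exact h1
  -- On finite subsets independence factorises both exponentials, so the termwise errors add up to
  -- `2δ` times the partial variance; this bound passes to the limit.
  have hfin : ∀ s : Finset ι, ‖∫ ω, Complex.exp ((∑ i ∈ s, η i ω : ℝ) * Complex.I) ∂P -
      Complex.exp ((∑ i ∈ s, ∫ ω, η i ω ∂P : ℝ) * Complex.I - (∑ i ∈ s, Var[η i; P] : ℝ) / 2)‖ ≤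
      2 * δ * ∑ i ∈ s, Var[η i; P] := by
    intro s
    have h1 : ∫ ω, Complex.exp ((∑ i ∈ s, η i ω : ℝ) * Complex.I) ∂P =
        ∏ i ∈ s, ∫ ω, Complex.exp (η i ω * Complex.I) ∂P := by
      have hs : iIndepFun (fun i : s => η i) P := hind.precomp Subtype.val_injective
      have := hs.integral_fun_prod_comp (ι := s) (X := fun i : s => η i) (𝕜 := ℂ) (f := fun _ x => Complex.exp (x * Complex.I))
        (fun i => (hη i).aemeasurable) (fun i => by fun_prop)
      rw [Finset.prod_coe_sort s (fun i => ∫ ω, Complex.exp (η i ω * Complex.I) ∂P)] at this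
      rw [← this]
      congr 1 with ω
      rw [Finset.prod_coe_sort s (fun i => Complex.exp (η i ω * Complex.I)), ← Complex.exp_sum,
        ← Finset.sum_mul]
      push_cast
      rfl
    have h2 : Complex.exp ((∑ i ∈ s, ∫ ω, η i ω ∂P : ℝ) * Complex.I -
        (∑ i ∈ s, Var[η i; P] : ℝ) / 2) =
        ∏ i ∈ s, Complex.exp ((∫ ω, η i ω ∂P : ℝ) * Complex.I - Var[η i; P] / 2) := by
      rw [← Complex.exp_sum, Finset.sum_sub_distrib, ← Finset.sum_mul, ← Finset.sum_div]
      push_cast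
      rfl
    rw [h1, h2, Finset.mul_sum]
    refine (norm_prod_sub_prod_le (fun i => ?_) (fun i => ?_) s).trans
      (Finset.sum_le_sum fun i _ => hterm i)
    · refine (norm_integral_le_of_norm_le_const (C := 1)
        (Filter.Eventually.of_forall fun y => ?_)).trans (by simp)
      rw [Complex.norm_exp_ofReal_mul_I]
    · rw [Complex.norm_exp]
      simpa using div_nonneg (variance_nonneg (η i) P) two_pos.le
  have hl1 : Tendsto (fun s : Finset ι => ∫ ω, Complex.exp ((∑ i ∈ s, η i ω : ℝ) * Complex.I) ∂P)
      atTop (𝓝 (∫ ω, Complex.exp ((∑' i, η i ω : ℝ) * Complex.I) ∂P)) := by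
    refine tendsto_integral_filter_of_dominated_convergence (fun _ => (1 : ℝ))
      (Filter.Eventually.of_forall fun s => ?_)
      (Filter.Eventually.of_forall fun s => Filter.Eventually.of_forall fun ω => ?_)
      (integrable_const _) ?_
    · have : Measurable fun ω => ∑ i ∈ s, η i ω := Finset.measurable_sum _ fun j _ => hη j
      exact (integrable_cexp_mul_I this.aemeasurable).aestronglyMeasurable
    · rw [Complex.norm_exp_ofReal_mul_I]
    · filter_upwards [hsum] with ω hω
      have hc : Continuous fun x : ℝ => Complex.exp (x * Complex.I) := by fun_prop
      exact (hc.tendsto _).comp hω.hasSum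
  have hm' : Tendsto (fun s : Finset ι => ∑ i ∈ s, ∫ ω, η i ω ∂P) atTop (𝓝 m) := hm
  have hV' : Tendsto (fun s : Finset ι => ∑ i ∈ s, Var[η i; P]) atTop (𝓝 V) := hV
  have hl2 : Tendsto (fun s : Finset ι => Complex.exp ((∑ i ∈ s, ∫ ω, η i ω ∂P : ℝ) * Complex.I -
      (∑ i ∈ s, Var[η i; P] : ℝ) / 2)) atTop (𝓝 (Complex.exp (m * Complex.I - V / 2))) := by
    have h1 := (Complex.continuous_ofReal.tendsto m).comp hm'
    have h2 := (Complex.continuous_ofReal.tendsto V).comp hV'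
    exact (Complex.continuous_exp.tendsto _).comp ((h1.mul_const Complex.I).sub (h2.div_const 2))
  exact le_of_tendsto_of_tendsto (hl1.sub hl2).norm (Tendsto.const_mul (2 * δ) hV')
    (Filter.Eventually.of_forall hfin)

end IndependentSums

/-! ### Means and variances summed over the lattice. -/

section LatticeSums

lemma hasSum_integral_of_nonneg {β ι : Type*} [MeasurableSpace β] [Countable ι] {κ : Measure β}
    [IsFiniteMeasure κ] {F : ι → β → ℝ} (hF : ∀ i, Measurable (F i)) (h0 : ∀ i x, 0 ≤ F i x)
    {n : β → ℝ} (hn : ∀ x, HasSum (fun i => F i x) (n x)) {C : ℝ} (hC : ∀ x, n x ≤ C) :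
    Integrable n κ ∧ HasSum (fun i => ∫ x, F i x ∂κ) (∫ x, n x ∂κ) := by
  have hmeas : Measurable n :=
    measurable_of_tendsto_metrizable' (atTop : Filter (Finset ι))
      (f := fun s x => ∑ i ∈ s, F i x) (fun s => Finset.measurable_sum _ fun i _ => hF i)
      (tendsto_pi_nhds.2 fun x => hn x)
  have hint : Integrable n κ := by
    refine Integrable.of_bound hmeas.aestronglyMeasurable C (Eventually.of_forall fun x => ?_)
    rw [Real.norm_eq_abs, abs_of_nonneg ((hn x).nonneg fun i => h0 i x)]
    exact hC x
  refine ⟨hint, hasSum_integral_of_dominated_convergence F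
    (fun i => (hF i).aestronglyMeasurable) (fun i => Eventually.of_forall fun x => ?_)
    (Eventually.of_forall fun x => (hn x).summable) ?_ (Eventually.of_forall hn)⟩
  · rw [Real.norm_eq_abs, abs_of_nonneg (h0 i x)]
  · simpa only [(hn _).tsum_eq] using hint

lemma abs_integral_sub_integral_le {β : Type*} [MeasurableSpace β] {κ : Measure β}
    [IsProbabilityMeasure κ] {f g : β → ℝ} (hf : Integrable f κ) (hg : Integrable g κ) {C : ℝ}
    (h : ∀ x, |f x - g x| ≤ C) : |∫ x, f x ∂κ - ∫ x, g x ∂κ| ≤ C := by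
  rw [← integral_sub hf hg]
  simpa using norm_integral_le_of_norm_le_const (μ := κ) (f := fun x => f x - g x) (C := C)
    (Eventually.of_forall h)

lemma measurable_indicator_Ioc (p q : ℝ) :
    Measurable ((Set.Ioc p q).indicator (1 : ℝ → ℝ)) :=
  measurable_one.indicator measurableSet_Ioc

lemma indicator_Ioc_nonneg (p q x : ℝ) : 0 ≤ (Set.Ioc p q).indicator (1 : ℝ → ℝ) x :=
  Set.indicator_nonneg (fun _ _ => zero_le_one) x

lemma indicator_Ioc_le_one (p q x : ℝ) : (Set.Ioc p q).indicator (1 : ℝ → ℝ) x ≤ 1 :=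
  Set.indicator_le_self' (fun _ _ => zero_le_one) x

lemma abs_indicator_Ioc_le (p q x : ℝ) : |(Set.Ioc p q).indicator (1 : ℝ → ℝ) x| ≤ 1 := by
  rw [abs_of_nonneg (indicator_Ioc_nonneg p q x)]
  exact indicator_Ioc_le_one p q x

lemma indicator_Ioc_sub {p q : ℝ} (hp : 0 ≤ p) (hpq : p ≤ q) (x : ℝ) :
    (Set.Ioc 0 q).indicator (1 : ℝ → ℝ) x - (Set.Ioc 0 p).indicator (1 : ℝ → ℝ) x =
      (Set.Ioc p q).indicator (1 : ℝ → ℝ) x := by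
  simp only [Set.indicator, Set.mem_Ioc, Pi.one_apply]
  split_ifs <;> grind

variable {a : ℝ} {μ : Measure ℝ} [IsProbabilityMeasure μ]

/-- Summing over `j` before averaging over the displacement leaves a lattice count that is within
`1` of `(q - p)/a` for every `x`, so the law `μ` plays no part in the bound. -/
lemma exists_hasSum_mean (ha : 0 < a) (e : ℝ) {p q : ℝ} (hpq : p ≤ q) :
    ∃ m : ℝ, HasSum (fun j : ℤ =>
        ∫ x, (Set.Ioc p q).indicator (1 : ℝ → ℝ) (x + a * ((j : ℝ) - e)) ∂μ) m ∧
      |m - (q - p) / a| ≤ 1 := by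
  choose n hn hn' using fun x => exists_hasSum_lattice ha e x hpq
  obtain ⟨h1, h2⟩ := hasSum_integral_of_nonneg (κ := μ) (C := (q - p) / a + 1)
    (fun j : ℤ => (measurable_indicator_Ioc p q).comp (measurable_id.add_const (a * ((j : ℝ) - e))))
    (fun j x => indicator_Ioc_nonneg p q _) hn (fun x => by linarith [(abs_le.1 (hn' x)).2])
  refine ⟨_, h2, ?_⟩
  simpa using abs_integral_sub_integral_le (κ := μ) h1 (integrable_const ((q - p) / a)) hn'

/-- Symmetrisation with an independent copy. It turns variances into counts of lattice sites at
which two displacements disagree. -/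
lemma variance_eq_integral_prod {f : ℝ → ℝ} (hf : Measurable f) {B : ℝ} (hB : ∀ x, |f x| ≤ B) :
    Var[f; μ] = 1 / 2 * ∫ z : ℝ × ℝ, (f z.1 - f z.2) ^ 2 ∂(μ.prod μ) := by
  have h1 : ∀ z : ℝ × ℝ, (f z.1 - f z.2) ^ 2 =
      f z.1 ^ 2 - 2 * (f z.1 * f z.2) + f z.2 ^ 2 := fun z => by ring
  have m1 : Measurable fun z : ℝ × ℝ => f z.1 := hf.comp measurable_fst
  have m2 : Measurable fun z : ℝ × ℝ => f z.2 := hf.comp measurable_snd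
  have J := fun m n => integrable_pow_mul_pow (P := μ.prod μ) m1 m2
    (fun z => hB z.1) (fun z => hB z.2) m n
  have i1 : Integrable (fun z : ℝ × ℝ => f z.1 ^ 2) (μ.prod μ) := by simpa using J 2 0
  have i2 : Integrable (fun z : ℝ × ℝ => 2 * (f z.1 * f z.2)) (μ.prod μ) := by
    simpa using (J 1 1).const_mul 2
  have i3 : Integrable (fun z : ℝ × ℝ => f z.2 ^ 2) (μ.prod μ) := by simpa using J 0 2
  have k1 := integral_sub i1 i2
  have k2 := integral_add (i1.sub i2) i3
  simp only [Pi.sub_apply] at k2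
  simp_rw [h1]
  rw [k2, k1, integral_const_mul, integral_prod_mul f f,
    integral_fun_fst (fun x => f x ^ 2), integral_fun_snd (fun x => f x ^ 2),
    variance_eq_sub (MemLp.of_bound hf.aestronglyMeasurable B (Eventually.of_forall hB))]
  simp
  ring

/-- The variances of the summands of a linear statistic, summed over the lattice. -/
lemma exists_hasSum_variance (ha : 0 < a) (e : ℝ) {ι : Type*} [Fintype ι] (b q : ι → ℝ)
    (hq : ∀ k, 0 ≤ q k) :
    ∃ V : ℝ, HasSum (fun j : ℤ => Var[fun x =>
        ∑ k, b k * (Set.Ioc 0 (q k)).indicator (1 : ℝ → ℝ) (x + a * ((j : ℝ) - e)); μ]) V ∧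
      |V - ∑ k, ∑ l, b k * b l * (∫ z : ℝ × ℝ, min (q k) |z.1 - z.2| ∂(μ.prod μ) +
          ∫ z : ℝ × ℝ, min (q l) |z.1 - z.2| ∂(μ.prod μ) -
          ∫ z : ℝ × ℝ, min |q k - q l| |z.1 - z.2| ∂(μ.prod μ)) / (2 * a)| ≤
        3 / 2 * (∑ k, |b k|) ^ 2 := by
  set w : ι → ℤ → ℝ → ℝ :=
    fun k j x => (Set.Ioc 0 (q k)).indicator (1 : ℝ → ℝ) (x + a * ((j : ℝ) - e)) with hw
  have hwm : ∀ k j, Measurable (w k j) := fun k j =>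
    (measurable_indicator_Ioc 0 (q k)).comp (measurable_id.add_const (a * ((j : ℝ) - e)))
  set W : ℤ → ℝ → ℝ := fun j x => ∑ k, b k * w k j x with hW
  have hWm : ∀ j, Measurable (W j) := fun j =>
    Finset.measurable_sum _ fun k _ => (hwm k j).const_mul _
  have hWB : ∀ j x, |W j x| ≤ ∑ k, |b k| := fun j x =>
    (Finset.abs_sum_le_sum_abs _ _).trans (Finset.sum_le_sum fun k _ => by
      rw [abs_mul]
      exact mul_le_of_le_one_right (abs_nonneg _) (abs_indicator_Ioc_le _ _ _))
  choose n hn hn' using fun k (z : ℝ × ℝ) => exists_hasSum_lattice_sub_sq ha e z.1 z.2 (hq k)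
  simp only [sub_zero] at hn'
  -- The difference of the indicators of `(0, q k]` and `(0, q l]` is, up to sign, that of the
  -- interval between, so the count applies with length `|q k - q l|`. It supplies the last square
  -- in `xy = (x² + y² - (x - y)²)/2`.
  have hpair : ∀ k l (z : ℝ × ℝ), ∃ n : ℝ, HasSum (fun j : ℤ =>
      ((w k j z.1 - w k j z.2) - (w l j z.1 - w l j z.2)) ^ 2) n ∧
      |n - 2 * min |q k - q l| |z.1 - z.2| / a| ≤ 2 := by
    intro k l z
    rcases le_total (q k) (q l) with h | h
    · obtain ⟨n, hn, hn'⟩ := exists_hasSum_lattice_sub_sq ha e z.1 z.2 h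
      rw [abs_sub_comm, abs_of_nonneg (sub_nonneg.2 h)]
      refine ⟨n, ?_, hn'⟩
      convert hn using 2 with j
      simp only [hw, ← indicator_Ioc_sub (hq k) h]
      ring
    · obtain ⟨n, hn, hn'⟩ := exists_hasSum_lattice_sub_sq ha e z.1 z.2 h
      rw [abs_of_nonneg (sub_nonneg.2 h)]
      refine ⟨n, ?_, hn'⟩
      convert hn using 2 with j
      simp only [hw, ← indicator_Ioc_sub (hq l) h]
      ring
  choose r hr hr' using hpair
  set N : ℝ × ℝ → ℝ := fun z => ∑ k, ∑ l, b k * b l * ((n k z + n l z - r k l z) / 2) with hN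
  have hNsum : ∀ z : ℝ × ℝ, HasSum (fun j => (W j z.1 - W j z.2) ^ 2) (N z) := by
    intro z
    have h : ∀ j, (W j z.1 - W j z.2) ^ 2 = ∑ k, ∑ l, b k * b l *
        (((w k j z.1 - w k j z.2) ^ 2 + (w l j z.1 - w l j z.2) ^ 2 -
          ((w k j z.1 - w k j z.2) - (w l j z.1 - w l j z.2)) ^ 2) / 2) := by
      intro j
      simp only [hW, ← Finset.sum_sub_distrib]
      rw [sq, Finset.sum_mul_sum]
      refine Finset.sum_congr rfl fun k _ => Finset.sum_congr rfl fun l _ => by ring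
    simp_rw [h]
    exact hasSum_sum fun k _ => hasSum_sum fun l _ =>
      ((((hn k z).add (hn l z)).sub (hr k l z)).div_const 2).mul_left _
  set L : ℝ × ℝ → ℝ := fun z => ∑ k, ∑ l, b k * b l *
    ((min (q k) |z.1 - z.2| + min (q l) |z.1 - z.2| - min |q k - q l| |z.1 - z.2|) / a) with hL
  -- Three counts, each with error at most `2`, are halved by the polarisation; the factor `1/2` of
  -- the symmetrised variance then leaves `3/2`.
  have hNL : ∀ z, |N z - L z| ≤ 3 * (∑ k, |b k|) ^ 2 := by
    intro z
    simp only [hN, hL, ← Finset.sum_sub_distrib, ← mul_sub]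
    rw [sq, Finset.sum_mul_sum, Finset.mul_sum]
    refine (Finset.abs_sum_le_sum_abs _ _).trans (Finset.sum_le_sum fun k _ => ?_)
    rw [Finset.mul_sum]
    refine (Finset.abs_sum_le_sum_abs _ _).trans (Finset.sum_le_sum fun l _ => ?_)
    rw [abs_mul, abs_mul, mul_comm 3]
    refine mul_le_mul_of_nonneg_left ?_ (by positivity)
    have h1 := abs_le.1 (hn' k z)
    have h2 := abs_le.1 (hn' l z)
    have h3 := abs_le.1 (hr' k l z)
    have h4 : (n k z + n l z - r k l z) / 2 -
        (min (q k) |z.1 - z.2| + min (q l) |z.1 - z.2| - min |q k - q l| |z.1 - z.2|) / a =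
        ((n k z - 2 * min (q k) |z.1 - z.2| / a) + (n l z - 2 * min (q l) |z.1 - z.2| / a) -
          (r k l z - 2 * min |q k - q l| |z.1 - z.2| / a)) / 2 := by ring
    rw [h4, abs_le]
    constructor <;> linarith
  have hmin : ∀ c : ℝ, 0 ≤ c → Integrable (fun z : ℝ × ℝ => min c |z.1 - z.2|) (μ.prod μ) :=
    fun c hc => integrable_of_abs_le (by fun_prop) (C := c) fun z => by
      rw [abs_of_nonneg (le_min hc (abs_nonneg _))]
      exact min_le_left _ _
  have hterm : ∀ k l, Integrable (fun z : ℝ × ℝ => b k * b l *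
      ((min (q k) |z.1 - z.2| + min (q l) |z.1 - z.2| - min |q k - q l| |z.1 - z.2|) / a))
      (μ.prod μ) := fun k l =>
    ((((hmin _ (hq k)).add (hmin _ (hq l))).sub (hmin _ (abs_nonneg _))).div_const a).const_mul _
  have hLint : Integrable L (μ.prod μ) :=
    integrable_finsetSum _ fun k _ => integrable_finsetSum _ fun l _ => hterm k l
  obtain ⟨C, hC⟩ : ∃ C, ∀ z, N z ≤ C := by
    refine ⟨∑ k, ∑ l, |b k| * |b l| * ((q k + q l + |q k - q l|) / a) + 3 * (∑ k, |b k|) ^ 2,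
      fun z => ?_⟩
    have h1 := (abs_le.1 (hNL z)).2
    have h2 : L z ≤ ∑ k, ∑ l, |b k| * |b l| * ((q k + q l + |q k - q l|) / a) := by
      refine Finset.sum_le_sum fun k _ => Finset.sum_le_sum fun l _ => ?_
      refine (le_abs_self _).trans ?_
      rw [abs_mul, abs_mul, abs_div, abs_of_pos ha]
      gcongr
      rw [abs_le]
      have := abs_nonneg (z.1 - z.2)
      have a1 := le_min (hq k) this
      have a2 := le_min (hq l) this
      have a3 := le_min (abs_nonneg (q k - q l)) this
      have b1 := min_le_left (q k) |z.1 - z.2|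
      have b2 := min_le_left (q l) |z.1 - z.2|
      have b3 := min_le_left |q k - q l| |z.1 - z.2|
      constructor <;> linarith
    linarith
  obtain ⟨hNint, hVs⟩ := hasSum_integral_of_nonneg (κ := μ.prod μ)
    (F := fun j z => (W j z.1 - W j z.2) ^ 2)
    (fun j => (((hWm j).comp measurable_fst).sub ((hWm j).comp measurable_snd)).pow_const 2)
    (fun j z => sq_nonneg _) hNsum hC
  refine ⟨1 / 2 * ∫ z, N z ∂(μ.prod μ), ?_, ?_⟩
  · have := hVs.mul_left (1 / 2)
    simpa only [← variance_eq_integral_prod (hWm _) (hWB _)] using this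
  · have h := abs_integral_sub_integral_le (κ := μ.prod μ) hNint hLint hNL
    have hLi : ∫ z, L z ∂(μ.prod μ) = ∑ k, ∑ l, b k * b l *
        (∫ z : ℝ × ℝ, min (q k) |z.1 - z.2| ∂(μ.prod μ) +
          ∫ z : ℝ × ℝ, min (q l) |z.1 - z.2| ∂(μ.prod μ) -
          ∫ z : ℝ × ℝ, min |q k - q l| |z.1 - z.2| ∂(μ.prod μ)) / a := by
      simp only [hL]
      rw [integral_finsetSum _ fun k _ => integrable_finsetSum _ fun l _ => hterm k l]
      refine Finset.sum_congr rfl fun k _ => ?_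
      rw [integral_finsetSum _ fun l _ => hterm k l]
      refine Finset.sum_congr rfl fun l _ => ?_
      have k1 := integral_add (hmin _ (hq k)) (hmin _ (hq l))
      have k2 := integral_sub ((hmin _ (hq k)).add (hmin _ (hq l)))
        (hmin _ (abs_nonneg (q k - q l)))
      simp only [Pi.add_apply] at k2
      rw [integral_const_mul, integral_div, k2, k1, mul_div_assoc]
    have h2 : ∑ k, ∑ l, b k * b l *
        (∫ z : ℝ × ℝ, min (q k) |z.1 - z.2| ∂(μ.prod μ) +
          ∫ z : ℝ × ℝ, min (q l) |z.1 - z.2| ∂(μ.prod μ) -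
          ∫ z : ℝ × ℝ, min |q k - q l| |z.1 - z.2| ∂(μ.prod μ)) / (2 * a) =
        1 / 2 * ∫ z, L z ∂(μ.prod μ) := by
      rw [hLi, Finset.mul_sum]
      refine Finset.sum_congr rfl fun k _ => ?_
      rw [Finset.mul_sum]
      refine Finset.sum_congr rfl fun l _ => ?_
      field_simp
    rw [h2, ← mul_sub, abs_mul, abs_of_pos (by norm_num : (0 : ℝ) < 1 / 2)]
    linarith

end LatticeSums

/-! ### Freezing an independent variable. -/

section Conditioning

variable {Ω : Type*} [MeasurableSpace Ω] {P : Measure Ω} [IsProbabilityMeasure P]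
  {β γ : Type*} [MeasurableSpace β] [MeasurableSpace γ] {U : Ω → β} {V : Ω → γ}

/-- Independence gives a product law, so a bound uniform in the frozen value of `U` survives
integration. It transfers fixed-shift estimates to the random shift. -/
lemma lintegral_le_of_indepFun (hU : Measurable U) (hV : Measurable V) (hUV : IndepFun U V P)
    {Φ : β × γ → ENNReal} (hΦ : Measurable Φ) {B : ENNReal}
    (hB : ∀ u, ∫⁻ ω, Φ (u, V ω) ∂P ≤ B) : ∫⁻ ω, Φ (U ω, V ω) ∂P ≤ B := by
  have h1 : ∫⁻ ω, Φ (U ω, V ω) ∂P = ∫⁻ z, Φ z ∂((P.map U).prod (P.map V)) := by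
    rw [← (indepFun_iff_map_prod_eq_prod_map_map hU.aemeasurable hV.aemeasurable).1 hUV,
      lintegral_map hΦ (hU.prodMk hV)]
  have : IsProbabilityMeasure (P.map U) := Measure.isProbabilityMeasure_map hU.aemeasurable
  have : IsProbabilityMeasure (P.map V) := Measure.isProbabilityMeasure_map hV.aemeasurable
  rw [h1, lintegral_prod _ hΦ.aemeasurable]
  calc ∫⁻ u, ∫⁻ v, Φ (u, v) ∂(P.map V) ∂(P.map U) ≤ ∫⁻ _, B ∂(P.map U) :=
        lintegral_mono fun u => by
          rw [lintegral_map (f := fun v => Φ (u, v)) (hΦ.comp measurable_prodMk_left) hV]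
          exact hB u
    _ = B := by simp

/-- The comparison value `w` does not depend on `u`: the Gaussian limit is the same for every shift,
so no mixture arises. -/
lemma norm_integral_sub_le_of_indepFun (hU : Measurable U) (hV : Measurable V)
    (hUV : IndepFun U V P) {Φ : β × γ → ℂ} (hΦ : Measurable Φ) (hΦ1 : ∀ z, ‖Φ z‖ ≤ 1) {w : ℂ}
    {B : ℝ} (hB : ∀ u, ‖∫ ω, Φ (u, V ω) ∂P - w‖ ≤ B) : ‖∫ ω, Φ (U ω, V ω) ∂P - w‖ ≤ B := by
  have h1 : ∫ ω, Φ (U ω, V ω) ∂P = ∫ z, Φ z ∂((P.map U).prod (P.map V)) := by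
    rw [← (indepFun_iff_map_prod_eq_prod_map_map hU.aemeasurable hV.aemeasurable).1 hUV,
      integral_map (hU.prodMk hV).aemeasurable hΦ.aestronglyMeasurable]
  have : IsProbabilityMeasure (P.map U) := Measure.isProbabilityMeasure_map hU.aemeasurable
  have : IsProbabilityMeasure (P.map V) := Measure.isProbabilityMeasure_map hV.aemeasurable
  have hint : Integrable Φ ((P.map U).prod (P.map V)) :=
    Integrable.of_bound hΦ.aestronglyMeasurable 1 (Eventually.of_forall hΦ1)
  have h2 : ∀ u, ∫ v, Φ (u, v) ∂(P.map V) = ∫ ω, Φ (u, V ω) ∂P := fun u =>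
    integral_map hV.aemeasurable (hΦ.comp measurable_prodMk_left).aestronglyMeasurable
  have h3 : ∫ u, (∫ v, Φ (u, v) ∂(P.map V) - w) ∂(P.map U) = ∫ ω, Φ (U ω, V ω) ∂P - w := by
    rw [integral_sub hint.integral_prod_left (integrable_const w), h1, integral_prod _ hint]
    simp
  rw [← h3]
  refine (norm_integral_le_of_norm_le_const (C := B) (Eventually.of_forall fun u => ?_)).trans
    (by simp)
  rw [h2]
  exact hB u

end Conditioning

/-! ### Counts of the shifted configuration as sums of indicators. -/

section Counting

/-- No finiteness is required: an infinite count has `toReal` zero, and a divergent real sum has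
`tsum` zero. -/
lemma toReal_pointCountENN_eq_tsum (Y : ℤ → ℝ) (s : Set ℝ) :
    (pointCountENN Y s).toReal = ∑' j, s.indicator (1 : ℝ → ℝ) (Y j) := by
  classical
  rw [pointCountENN, ENNReal.tsum_toReal_eq]
  · congr 1 with j
    simp only [Set.indicator, Pi.one_apply]
    split_ifs <;> simp
  · intro j
    simp only [Set.indicator, Pi.one_apply]
    split_ifs <;> simp

lemma hasSum_toReal_pointCountENN {Y : ℤ → ℝ} {s : Set ℝ} (h : pointCountENN Y s ≠ ⊤) :
    HasSum (fun j => s.indicator (1 : ℝ → ℝ) (Y j)) (pointCountENN Y s).toReal := by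
  rw [toReal_pointCountENN_eq_tsum]
  refine (summable_of_hasFiniteSupport (((pointCountENN_ne_top_iff Y s).1 h).subset ?_)).hasSum
  intro j hj
  by_contra h'
  exact hj (Set.indicator_of_notMem (s := s) (a := Y j) h' _)

/-- The configuration of the points `x_j + a (j - e)`. -/
def shiftedConfig (a e : ℝ) (x : ℤ → ℝ) (j : ℤ) : ℝ := x j + a * ((j : ℝ) - e)

lemma measurable_shiftedConfig (a : ℝ) :
    Measurable fun z : ℝ × (ℤ → ℝ) => shiftedConfig a z.1 z.2 :=
  measurable_pi_lambda _ fun j =>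
    ((measurable_pi_apply j).comp measurable_snd).add
      ((measurable_fst.const_sub (j : ℝ)).const_mul a)

/-- The number of points in `(p, q]` of the configuration `x_j + a (j - e)`. -/
noncomputable def shiftedCount (a p q : ℝ) (z : ℝ × (ℤ → ℝ)) : ENNReal :=
  pointCountENN (shiftedConfig a z.1 z.2) (Set.Ioc p q)

lemma measurable_shiftedCount (a p q : ℝ) : Measurable (shiftedCount a p q) :=
  (measurable_pointCountENN measurableSet_Ioc).comp (measurable_shiftedConfig a)

end Counting

lemma add_pow_four_le (x y : ℝ) : (x + y) ^ 4 ≤ 8 * (x ^ 4 + y ^ 4) := by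
  have h1 : (x + y) ^ 2 ≤ 2 * (x ^ 2 + y ^ 2) := by nlinarith [sq_nonneg (x - y)]
  have h2 : ((x + y) ^ 2) ^ 2 ≤ (2 * (x ^ 2 + y ^ 2)) ^ 2 := by gcongr
  nlinarith [sq_nonneg (x ^ 2 - y ^ 2)]

/-! ### Estimates for a fixed shift of the lattice. -/

section FixedShift

variable {Ω : Type*} [MeasurableSpace Ω] {P : Measure Ω} [IsProbabilityMeasure P]
  {a : ℝ} {μ : Measure ℝ} [IsProbabilityMeasure μ] {ξ : ℤ → Ω → ℝ}

omit [IsProbabilityMeasure P] [IsProbabilityMeasure μ] in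
lemma integral_indicator_comp (hξ : ∀ j, Measurable (ξ j)) (hμ : ∀ j, P.map (ξ j) = μ)
    (p q v : ℝ) (j : ℤ) : ∫ ω, (Set.Ioc p q).indicator (1 : ℝ → ℝ) (ξ j ω + v) ∂P =
      ∫ x, (Set.Ioc p q).indicator (1 : ℝ → ℝ) (x + v) ∂μ := by
  rw [← hμ j, integral_map (hξ j).aemeasurable]
  exact ((measurable_indicator_Ioc p q).comp (measurable_id.add_const v)).aestronglyMeasurable

lemma lintegral_shiftedCount_fixed_le (ha : 0 < a) (hξ : ∀ j, Measurable (ξ j))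
    (hμ : ∀ j, P.map (ξ j) = μ) {p q : ℝ} (hpq : p ≤ q) (e : ℝ) :
    ∫⁻ ω, shiftedCount a p q (e, fun j => ξ j ω) ∂P ≤ ENNReal.ofReal ((q - p) / a + 1) := by
  obtain ⟨m, hm, hm'⟩ := exists_hasSum_mean (μ := μ) ha e hpq
  have hmeas : ∀ j : ℤ, Measurable fun ω => ξ j ω + a * ((j : ℝ) - e) :=
    fun j => (hξ j).add_const _
  have h1 : ∀ j : ℤ, ∫⁻ ω, (Set.Ioc p q).indicator (1 : ℝ → ENNReal)
      (ξ j ω + a * ((j : ℝ) - e)) ∂P = ENNReal.ofReal (∫ x,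
        (Set.Ioc p q).indicator (1 : ℝ → ℝ) (x + a * ((j : ℝ) - e)) ∂μ) := by
    intro j
    rw [← integral_indicator_comp hξ hμ _ _ _ j, ofReal_integral_eq_lintegral_ofReal]
    · congr 1 with ω
      simp only [Set.indicator, Pi.one_apply]
      split_ifs <;> simp
    · exact integrable_of_abs_le ((measurable_indicator_Ioc p q).comp (hmeas j))
        fun ω => abs_indicator_Ioc_le _ _ _
    · exact Eventually.of_forall fun ω => indicator_Ioc_nonneg _ _ _
  simp only [shiftedCount, pointCountENN, shiftedConfig]
  have hmeas' : ∀ j : ℤ, Measurable fun ω =>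
      (Set.Ioc p q).indicator (1 : ℝ → ENNReal) (ξ j ω + a * ((j : ℝ) - e)) := fun j =>
    (measurable_one.indicator measurableSet_Ioc).comp (hmeas j)
  rw [lintegral_tsum fun j => (hmeas' j).aemeasurable]
  simp_rw [h1]
  rw [← ENNReal.ofReal_tsum_of_nonneg
    (fun j => integral_nonneg fun x => indicator_Ioc_nonneg _ _ _) hm.summable, hm.tsum_eq]
  exact ENNReal.ofReal_le_ofReal (by linarith [(abs_le.1 hm').2])

lemma ae_shiftedCount_fixed_ne_top (ha : 0 < a) (hξ : ∀ j, Measurable (ξ j))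
    (hμ : ∀ j, P.map (ξ j) = μ) {p q : ℝ} (hpq : p ≤ q) (e : ℝ) :
    ∀ᵐ ω ∂P, shiftedCount a p q (e, fun j => ξ j ω) ≠ ⊤ := by
  have hm : Measurable fun ω => shiftedCount a p q (e, fun j => ξ j ω) :=
    (measurable_shiftedCount a p q).comp
      (measurable_const.prodMk (measurable_pi_lambda _ fun j => hξ j))
  refine (ae_lt_top hm ?_).mono fun ω h => h.ne
  exact ((lintegral_shiftedCount_fixed_le ha hξ hμ hpq e).trans_lt ENNReal.ofReal_lt_top).ne

/-- An indicator has variance at most its mean, so the total variance is at most `(q - p)/a + 1`.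
The resulting fourth moment is quadratic in the length, which lets chaining beat the number of
dyadic intervals; length at least `1` absorbs the lattice errors. -/
lemma lintegral_shiftedCount_fixed_pow_four_le (ha : 0 < a) (hξ : ∀ j, Measurable (ξ j))
    (hind : iIndepFun ξ P) (hμ : ∀ j, P.map (ξ j) = μ) {p q : ℝ} (hpq : 1 ≤ q - p) (e : ℝ) :
    ∫⁻ ω, ENNReal.ofReal (((shiftedCount a p q (e, fun j => ξ j ω)).toReal - (q - p) / a) ^ 4) ∂P
      ≤ ENNReal.ofReal (64 * (1 / a + 1) ^ 2 * (q - p) ^ 2) := by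
  have hpq' : p ≤ q := by linarith
  obtain ⟨m, hm, hm'⟩ := exists_hasSum_mean (μ := μ) ha e hpq'
  set η : ℤ → Ω → ℝ := fun j ω =>
    (Set.Ioc p q).indicator (1 : ℝ → ℝ) (ξ j ω + a * ((j : ℝ) - e)) with hη
  have hw : ∀ j : ℤ, Measurable fun x : ℝ =>
      (Set.Ioc p q).indicator (1 : ℝ → ℝ) (x + a * ((j : ℝ) - e)) := fun j =>
    (measurable_indicator_Ioc p q).comp (measurable_id.add_const _)
  have hηm : ∀ j, Measurable (η j) := fun j => (hw j).comp (hξ j)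
  have hηi : iIndepFun η P := hind.comp _ hw
  have hmean : HasSum (fun j => ∫ ω, η j ω ∂P) m := by
    simpa only [hη, integral_indicator_comp hξ hμ] using hm
  have hvar : ∀ j, Var[η j; P] ≤ ∫ ω, η j ω ∂P := fun j => by
    refine (variance_le_expectation_sq (hηm j).aestronglyMeasurable).trans_eq ?_
    congr 1 with ω
    simp only [Pi.pow_apply, hη, Set.indicator, Pi.one_apply]
    split_ifs <;> simp
  have hVs : Summable fun j => Var[η j; P] :=
    Summable.of_nonneg_of_le (fun j => variance_nonneg _ _) hvar hmean.summable
  set V := ∑' j, Var[η j; P] with hV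
  have hVm : V ≤ m := hasSum_le hvar hVs.hasSum hmean
  have hV0 : 0 ≤ V := tsum_nonneg fun j => variance_nonneg _ _
  have hfin := ae_shiftedCount_fixed_ne_top (P := P) ha hξ hμ hpq' e
  have hsum : ∀ᵐ ω ∂P, HasSum (fun j => η j ω)
      (shiftedCount a p q (e, fun j => ξ j ω)).toReal := by
    filter_upwards [hfin] with ω hω using hasSum_toReal_pointCountENN hω
  have h4 := lintegral_tsum_sub_pow_four_le hηm hηi (fun j ω => abs_indicator_Ioc_le _ _ _)
    (hsum.mono fun ω h => h.summable) hmean hVs.hasSum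
  have hNm : Measurable fun ω => ∑' j, η j ω := by
    have h : (fun ω => ∑' j, η j ω) =
        fun ω => (shiftedCount a p q (e, fun j => ξ j ω)).toReal := by
      ext ω
      exact (toReal_pointCountENN_eq_tsum _ _).symm
    rw [h]
    exact ((measurable_shiftedCount a p q).comp
      (measurable_const.prodMk (measurable_pi_lambda _ fun j => hξ j))).ennreal_toReal
  set ℓ := q - p with hℓ
  have hm2 := abs_le.1 hm'
  calc ∫⁻ ω, ENNReal.ofReal (((shiftedCount a p q (e, fun j => ξ j ω)).toReal - ℓ / a) ^ 4) ∂P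
      ≤ ∫⁻ ω, (8 * ENNReal.ofReal ((∑' j, η j ω - m) ^ 4) + 8) ∂P := by
        refine lintegral_mono_ae (hsum.mono fun ω h => ?_)
        rw [h.tsum_eq]
        set N := (shiftedCount a p q (e, fun j => ξ j ω)).toReal
        have h8 : (8 : ENNReal) = ENNReal.ofReal 8 := by norm_num
        rw [h8, ← ENNReal.ofReal_mul (by norm_num), ← ENNReal.ofReal_add (by positivity)
          (by norm_num)]
        refine ENNReal.ofReal_le_ofReal ?_
        have e1 : N - ℓ / a = (N - m) + (m - ℓ / a) := by ring
        have e2 : (m - ℓ / a) ^ 2 ≤ 1 := by nlinarith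
        have e3 : (m - ℓ / a) ^ 4 ≤ 1 := by nlinarith [sq_nonneg (m - ℓ / a)]
        have e4 := add_pow_four_le (N - m) (m - ℓ / a)
        rw [e1]
        linarith
    _ = 8 * ∫⁻ ω, ENNReal.ofReal ((∑' j, η j ω - m) ^ 4) ∂P + 8 := by
        rw [lintegral_add_right _ measurable_const,
          lintegral_const_mul _ ((hNm.sub_const m).pow_const 4).ennreal_ofReal]
        simp
    _ ≤ 8 * ENNReal.ofReal (3 * V ^ 2 + 4 * V) + 8 := by gcongr
    _ ≤ ENNReal.ofReal (64 * (1 / a + 1) ^ 2 * ℓ ^ 2) := by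
        have h8 : (8 : ENNReal) = ENNReal.ofReal 8 := by norm_num
        rw [h8, ← ENNReal.ofReal_mul (by norm_num), ← ENNReal.ofReal_add (by positivity)
          (by norm_num)]
        refine ENNReal.ofReal_le_ofReal ?_
        -- `B` dominates both `V` and `1`, and `8(3B² + 4B) + 8 ≤ 64B²`.
        set B := (1 / a + 1) * ℓ with hB
        have hB1 : 1 ≤ B := by
          have : 0 < 1 / a := by positivity
          nlinarith
        have hVB : V ≤ B := by
          have : B = ℓ / a + ℓ := by rw [hB]; ring
          linarith
        have : 64 * (1 / a + 1) ^ 2 * ℓ ^ 2 = 64 * B ^ 2 := by rw [hB]; ring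
        rw [this]
        nlinarith

/-- Quantitative central limit theorem for linear statistics of the counts, for a fixed shift of
the lattice. -/
lemma norm_integral_cexp_shiftedCount_fixed_le (ha : 0 < a) (hξ : ∀ j, Measurable (ξ j))
    (hind : iIndepFun ξ P) (hμ : ∀ j, P.map (ξ j) = μ) {T : ℝ} (hT : 0 < T) {v : ℝ → ℝ}
    (hv : ∀ s, 0 ≤ s → ∫ z : ℝ × ℝ, min (s * T) |z.1 - z.2| ∂(μ.prod μ) = T * (a * v s))
    {ι : Type*} [Fintype ι] (s θ : ι → ℝ) (hs : ∀ k, 0 ≤ s k)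
    (hθ : (∑ k, |θ k|) / √T ≤ 1 / 2) (e : ℝ) :
    ‖∫ ω, Complex.exp ((∑ k, θ k * (((shiftedCount a 0 (s k * T) (e, fun j => ξ j ω)).toReal -
        s k * T / a) / √T) : ℝ) * Complex.I) ∂P -
      (Real.exp (-(∑ k, ∑ l, θ k * θ l * ((v (s k) + v (s l) - v |s k - s l|) / 2)) / 2) : ℝ)‖ ≤
      (∑ k, |θ k|) / √T *
        (2 * ∑ k, ∑ l, θ k * θ l * ((v (s k) + v (s l) - v |s k - s l|) / 2) + 5) := by
  have hT' : 0 < √T := Real.sqrt_pos.2 hT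
  set b : ι → ℝ := fun k => θ k / √T with hb
  set δ := (∑ k, |θ k|) / √T with hδ
  have hbδ : ∑ k, |b k| = δ := by
    simp only [hb, hδ, abs_div, abs_of_pos hT', Finset.sum_div]
  have hδ0 : 0 ≤ δ := hbδ ▸ Finset.sum_nonneg fun k _ => abs_nonneg _
  set S := ∑ k, ∑ l, θ k * θ l * ((v (s k) + v (s l) - v |s k - s l|) / 2) with hS
  have hq : ∀ k, 0 ≤ s k * T := fun k => mul_nonneg (hs k) hT.le
  choose m hm hm' using fun k => exists_hasSum_mean (μ := μ) ha e (hq k)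
  obtain ⟨V, hV, hV'⟩ := exists_hasSum_variance (μ := μ) ha e b (fun k => s k * T) hq
  set w : ℤ → ℝ → ℝ := fun j x => ∑ k, b k *
    (Set.Ioc 0 (s k * T)).indicator (1 : ℝ → ℝ) (x + a * ((j : ℝ) - e)) with hw
  have hi : ∀ (k : ι) (j : ℤ), Measurable fun x : ℝ =>
      (Set.Ioc 0 (s k * T)).indicator (1 : ℝ → ℝ) (x + a * ((j : ℝ) - e)) := fun k j =>
    (measurable_indicator_Ioc _ _).comp (measurable_id.add_const _)
  have hwm : ∀ j, Measurable (w j) := fun j =>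
    Finset.measurable_sum _ fun k _ => (hi k j).const_mul _
  have hwB : ∀ j x, |w j x| ≤ δ := fun j x => hbδ ▸
    (Finset.abs_sum_le_sum_abs _ _).trans (Finset.sum_le_sum fun k _ => by
      rw [abs_mul]
      exact mul_le_of_le_one_right (abs_nonneg _) (abs_indicator_Ioc_le _ _ _))
  set η : ℤ → Ω → ℝ := fun j ω => w j (ξ j ω) with hη
  have hηm : ∀ j, Measurable (η j) := fun j => (hwm j).comp (hξ j)
  have hmean : HasSum (fun j => ∫ ω, η j ω ∂P) (∑ k, b k * m k) := by
    have h : ∀ j : ℤ, ∫ ω, η j ω ∂P = ∑ k, b k * ∫ x,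
        (Set.Ioc 0 (s k * T)).indicator (1 : ℝ → ℝ) (x + a * ((j : ℝ) - e)) ∂μ := by
      intro j
      simp only [hη, hw]
      rw [integral_finsetSum _ fun k _ => ?_]
      · simp_rw [integral_const_mul, integral_indicator_comp hξ hμ]
      · exact (integrable_of_abs_le ((hi k j).comp (hξ j))
          fun ω => abs_indicator_Ioc_le _ _ _).const_mul _
    simp_rw [h]
    exact hasSum_sum fun k _ => (hm k).mul_left _
  have hvar : HasSum (fun j => Var[η j; P]) V := by
    have h : ∀ j, Var[η j; P] = Var[w j; μ] := fun j => by
      rw [← hμ j, variance_map (hwm j).aemeasurable (hξ j).aemeasurable]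
      rfl
    simp_rw [h]
    exact hV
  have hsum : ∀ᵐ ω ∂P, HasSum (fun j => η j ω)
      (∑ k, b k * (shiftedCount a 0 (s k * T) (e, fun j => ξ j ω)).toReal) := by
    filter_upwards [ae_all_iff.2 fun k => ae_shiftedCount_fixed_ne_top (P := P) ha hξ hμ (hq k) e]
      with ω hω
    exact hasSum_sum fun k _ => (hasSum_toReal_pointCountENN (hω k)).mul_left _
  have hclt := norm_integral_cexp_tsum_sub_le hηm (hind.comp _ hwm) hθ
    (fun j ω => hwB j _) (hsum.mono fun ω h => h.summable) hmean hvar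
  set L := ∑ k, b k * (s k * T / a) with hL
  have hmL : |∑ k, b k * m k - L| ≤ δ := by
    rw [hL, ← Finset.sum_sub_distrib, ← hbδ]
    refine (Finset.abs_sum_le_sum_abs _ _).trans (Finset.sum_le_sum fun k _ => ?_)
    rw [← mul_sub, abs_mul]
    have := hm' k
    rw [sub_zero] at this
    exact mul_le_of_le_one_right (abs_nonneg _) this
  -- The weights contribute `1/T` and the assumption `hv` contributes `T`, so the main term does not
  -- depend on `T`; only the lattice error remains.
  have hVS : |V - S| ≤ 3 / 2 * δ ^ 2 := by
    have h : S = ∑ k, ∑ l, b k * b l *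
        (∫ z : ℝ × ℝ, min (s k * T) |z.1 - z.2| ∂(μ.prod μ) +
          ∫ z : ℝ × ℝ, min (s l * T) |z.1 - z.2| ∂(μ.prod μ) -
          ∫ z : ℝ × ℝ, min |s k * T - s l * T| |z.1 - z.2| ∂(μ.prod μ)) / (2 * a) := by
      refine Finset.sum_congr rfl fun k _ => Finset.sum_congr rfl fun l _ => ?_
      rw [← sub_mul, abs_mul, abs_of_pos hT, hv _ (hs k), hv _ (hs l), hv _ (abs_nonneg _)]
      simp only [hb]
      have : θ k / √T * (θ l / √T) = θ k * θ l / T := by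
        rw [div_mul_div_comm, Real.mul_self_sqrt hT.le]
      rw [this]
      field_simp
    rw [h, ← hbδ]
    exact hV'
  have hV0 : 0 ≤ V := hvar.nonneg fun j => variance_nonneg _ _
  have hVb := abs_le.1 hVS
  have hint : ∫ ω, Complex.exp ((∑ k, θ k * (((shiftedCount a 0 (s k * T)
      (e, fun j => ξ j ω)).toReal - s k * T / a) / √T) : ℝ) * Complex.I) ∂P =
      Complex.exp (-(L * Complex.I)) * ∫ ω, Complex.exp ((∑' j, η j ω : ℝ) * Complex.I) ∂P := by
    rw [← integral_const_mul]
    refine integral_congr_ae (hsum.mono fun ω h => ?_)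
    simp only
    rw [h.tsum_eq, ← Complex.exp_add]
    congr 1
    have : ∑ k, θ k * (((shiftedCount a 0 (s k * T) (e, fun j => ξ j ω)).toReal -
        s k * T / a) / √T) =
        ∑ k, b k * (shiftedCount a 0 (s k * T) (e, fun j => ξ j ω)).toReal - L := by
      rw [hL, ← Finset.sum_sub_distrib]
      refine Finset.sum_congr rfl fun k _ => ?_
      simp only [hb]
      ring
    rw [this]
    push_cast
    ring
  set z : ℂ := Complex.exp ((∑ k, b k * m k : ℝ) * Complex.I - V / 2) with hz
  have h1 : ‖Complex.exp (-(L * Complex.I)) * ∫ ω, Complex.exp ((∑' j, η j ω : ℝ) * Complex.I) ∂P -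
      Complex.exp (-(L * Complex.I)) * z‖ ≤ 2 * δ * V := by
    rw [← mul_sub, norm_mul, ← neg_mul, ← Complex.ofReal_neg, Complex.norm_exp_ofReal_mul_I,
      one_mul]
    exact hclt
  have h2 : ‖Complex.exp (-(L * Complex.I)) * z - (Real.exp (-S / 2) : ℝ)‖ ≤
      2 * (δ + 3 / 4 * δ ^ 2) := by
    -- The exponent `d` collects the error `δ` of the mean and half the error of the variance; its
    -- norm is at most `1`, so `‖exp d - 1‖ ≤ 2‖d‖`.
    set d : ℂ := ((V - S) / 2 : ℝ) - ((∑ k, b k * m k - L : ℝ) : ℂ) * Complex.I with hd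
    have hdn : ‖d‖ ≤ δ + 3 / 4 * δ ^ 2 := by
      refine (norm_sub_le _ _).trans ?_
      rw [norm_mul, Complex.norm_I, mul_one, Complex.norm_real, Complex.norm_real,
        Real.norm_eq_abs, Real.norm_eq_abs, abs_div, abs_two]
      linarith
    have e1 : Complex.exp (-(L * Complex.I)) * z =
        Complex.exp (((∑ k, b k * m k - L : ℝ) : ℂ) * Complex.I - V / 2) := by
      rw [hz, ← Complex.exp_add]
      congr 1
      push_cast
      ring
    have e2 : ((Real.exp (-S / 2) : ℝ) : ℂ) =
        Complex.exp (((∑ k, b k * m k - L : ℝ) : ℂ) * Complex.I - V / 2) * Complex.exp d := by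
      rw [Complex.ofReal_exp, ← Complex.exp_add]
      congr 1
      rw [hd]
      push_cast
      ring
    have e3 : ‖Complex.exp (((∑ k, b k * m k - L : ℝ) : ℂ) * Complex.I - V / 2)‖ ≤ 1 := by
      rw [Complex.norm_exp]
      simpa using div_nonneg hV0 two_pos.le
    rw [e1, e2, ← mul_one_sub, norm_mul, norm_sub_rev]
    calc _ ≤ 1 * (2 * ‖d‖) := mul_le_mul e3
          (Complex.norm_exp_sub_one_le (hdn.trans (by nlinarith))) (norm_nonneg _) zero_le_one
      _ ≤ _ := by linarith
  rw [hint]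
  calc _ ≤ _ := norm_sub_le_norm_sub_add_norm_sub _ (Complex.exp (-(L * Complex.I)) * z) _
    _ ≤ 2 * δ * V + 2 * (δ + 3 / 4 * δ ^ 2) := add_le_add h1 h2
    _ ≤ 2 * δ * (S + 1) + 2 * (δ + 3 / 4 * δ ^ 2) := by
        gcongr
        nlinarith
    _ ≤ δ * (2 * S + 5) := by nlinarith

end FixedShift

/-! ### Dyadic chaining. -/

section Chaining

/-- The largest dyadic number of level `m` that is at most `s`. -/
noncomputable def dyadicFloor (m : ℕ) (s : ℝ) : ℝ := (⌊s * 2 ^ m⌋₊ : ℝ) / 2 ^ m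

lemma dyadicFloor_nonneg (m : ℕ) (s : ℝ) : 0 ≤ dyadicFloor m s := by
  unfold dyadicFloor
  positivity

lemma dyadicFloor_le (m : ℕ) {s : ℝ} (hs : 0 ≤ s) : dyadicFloor m s ≤ s := by
  rw [dyadicFloor, div_le_iff₀ (by positivity)]
  exact Nat.floor_le (by positivity)

lemma sub_dyadicFloor_le (m : ℕ) (s : ℝ) : s - dyadicFloor m s ≤ 1 / 2 ^ m := by
  rw [dyadicFloor, sub_le_iff_le_add, ← add_div, le_div_iff₀ (by positivity), add_comm]
  exact (Nat.lt_floor_add_one _).le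

variable {Z : ℝ → ℝ} {B : ℕ → ℝ} {m₀ n : ℕ}

/-- The floor at level `m` is also a grid point of level `m + 1`, and the finer floor is either that
point or its right neighbour. -/
lemma abs_dyadicFloor_succ_sub_le {m : ℕ} (hB0 : 0 ≤ B (m + 1))
    (hB : ∀ k : ℕ, k < 2 ^ (m + 1) →
      |Z ((k + 1 : ℝ) / 2 ^ (m + 1)) - Z ((k : ℝ) / 2 ^ (m + 1))| ≤ B (m + 1)) {s : ℝ}
    (hs : 0 ≤ s) (hs1 : s ≤ 1) :
    |Z (dyadicFloor (m + 1) s) - Z (dyadicFloor m s)| ≤ B (m + 1) := by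
  unfold dyadicFloor
  set k := ⌊s * 2 ^ m⌋₊ with hk
  set k' := ⌊s * 2 ^ (m + 1)⌋₊ with hk'
  have h1 : (k : ℝ) ≤ s * 2 ^ m := Nat.floor_le (by positivity)
  have h2 : s * 2 ^ m < k + 1 := Nat.lt_floor_add_one _
  have h3 : (k' : ℝ) ≤ s * 2 ^ (m + 1) := Nat.floor_le (by positivity)
  have h4 : 2 * k ≤ k' := Nat.le_floor (by push_cast; rw [pow_succ]; linarith)
  have h5 : k' < 2 * k + 2 := by
    have : (k' : ℝ) < 2 * k + 2 := by rw [pow_succ] at h3; linarith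
    exact_mod_cast this
  have h6 : (k : ℝ) / 2 ^ m = ((2 * k : ℕ) : ℝ) / 2 ^ (m + 1) := by
    push_cast
    rw [pow_succ]
    field_simp
  have h7 : k' ≤ 2 ^ (m + 1) := by
    have : (k' : ℝ) ≤ 2 ^ (m + 1) := h3.trans (mul_le_of_le_one_left (by positivity) hs1)
    exact_mod_cast this
  rw [h6]
  rcases (by omega : k' = 2 * k ∨ k' = 2 * k + 1) with h | h
  · rw [h]
    simpa using hB0
  · have := hB (2 * k) (by omega)
    rw [h]
    push_cast at this ⊢
    exact this

lemma abs_dyadicFloor_sub_le (hmn : m₀ ≤ n) (hB0 : ∀ m, 0 ≤ B m)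
    (hB : ∀ m, m₀ ≤ m → m ≤ n → ∀ k : ℕ, k < 2 ^ m →
      |Z ((k + 1 : ℝ) / 2 ^ m) - Z ((k : ℝ) / 2 ^ m)| ≤ B m) {s : ℝ}
    (hs : 0 ≤ s) (hs1 : s ≤ 1) :
    |Z (dyadicFloor n s) - Z (dyadicFloor m₀ s)| ≤ ∑ m ∈ Finset.Ioc m₀ n, B m := by
  induction n, hmn using Nat.le_induction with
  | base => simp
  | succ n hn ih =>
    rw [← Finset.insert_Ioc_right_eq_Ioc_add_one hn, Finset.sum_insert (by simp)]
    have h1 := ih fun m hm hmn => hB m hm (hmn.trans n.le_succ)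
    have h2 := abs_dyadicFloor_succ_sub_le (hB0 (n + 1))
      (hB (n + 1) (hn.trans n.le_succ) le_rfl) hs hs1
    exact (abs_sub_le _ (Z (dyadicFloor n s)) _).trans (add_le_add h2 h1)

/-- Chaining along dyadic points; below the finest scale the one-sided bound `hmono` takes over. -/
lemma abs_sub_le_of_dyadic (hmn : m₀ ≤ n) {K : ℝ} (hK : 0 ≤ K)
    (hmono : ∀ r s, 0 ≤ r → r ≤ s → s ≤ 1 → Z r - K * (s - r) ≤ Z s) (hB0 : ∀ m, 0 ≤ B m)
    (hB : ∀ m, m₀ ≤ m → m ≤ n → ∀ k : ℕ, k < 2 ^ m →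
      |Z ((k + 1 : ℝ) / 2 ^ m) - Z ((k : ℝ) / 2 ^ m)| ≤ B m) {r s : ℝ} (hr : 0 ≤ r) (hrs : r ≤ s)
    (hs1 : s ≤ 1) (hd : s - r ≤ 1 / 2 ^ m₀) :
    |Z s - Z r| ≤ 4 * ∑ m ∈ Finset.Icc m₀ n, B m + 2 * (K / 2 ^ n) := by
  have hsum : ∑ m ∈ Finset.Icc m₀ n, B m = B m₀ + ∑ m ∈ Finset.Ioc m₀ n, B m := by
    rw [← Finset.Ioc_insert_left hmn, Finset.sum_insert (by simp)]
  have hBn : B n ≤ ∑ m ∈ Finset.Icc m₀ n, B m :=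
    Finset.single_le_sum (fun m _ => hB0 m) (Finset.right_mem_Icc.2 hmn)
  -- `Z u + K u` is nondecreasing, so `Z u` is bounded below through the grid point on its left and
  -- above through the one on its right, which costs one further grid increment. If no right
  -- neighbour exists then `u = 1` is itself a grid point.
  have hend : ∀ u, 0 ≤ u → u ≤ 1 → |Z u - Z (dyadicFloor n u)| ≤ B n + K / 2 ^ n := by
    intro u hu hu1
    have hKn : ∀ x, x ≤ 1 / 2 ^ n → K * x ≤ K / 2 ^ n := fun x hx => by
      rw [div_eq_mul_one_div]
      exact mul_le_mul_of_nonneg_left hx hK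
    have h1 := hmono (dyadicFloor n u) u (dyadicFloor_nonneg n u) (dyadicFloor_le n hu) hu1
    have h2 := hKn _ (sub_dyadicFloor_le n u)
    have h3 := hB0 n
    have h5 : (0 : ℝ) < 2 ^ n := by positivity
    have h6 : (⌊u * 2 ^ n⌋₊ : ℝ) ≤ u * 2 ^ n := Nat.floor_le (by positivity)
    have h7 : u * 2 ^ n < ⌊u * 2 ^ n⌋₊ + 1 := Nat.lt_floor_add_one _
    rw [abs_le]
    refine ⟨by linarith, ?_⟩
    by_cases hk : ⌊u * 2 ^ n⌋₊ < 2 ^ n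
    · have h4 := (abs_le.1 (hB n hmn le_rfl _ hk)).2
      have h8 : u ≤ (⌊u * 2 ^ n⌋₊ + 1 : ℝ) / 2 ^ n := by
        rw [le_div_iff₀ h5]
        exact h7.le
      have h9 : (⌊u * 2 ^ n⌋₊ + 1 : ℝ) / 2 ^ n ≤ 1 := by
        rw [div_le_one h5]
        exact_mod_cast hk
      have h10 := hmono u _ hu h8 h9
      have h11 := hKn ((⌊u * 2 ^ n⌋₊ + 1 : ℝ) / 2 ^ n - u) (by
        rw [add_div]
        have := dyadicFloor_le n hu
        unfold dyadicFloor at this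
        linarith)
      show Z u - Z ((⌊u * 2 ^ n⌋₊ : ℝ) / 2 ^ n) ≤ _
      linarith
    · have hk' : (2 : ℝ) ^ n ≤ ⌊u * 2 ^ n⌋₊ := by exact_mod_cast not_lt.1 hk
      have : u = dyadicFloor n u := by
        unfold dyadicFloor
        rw [eq_div_iff h5.ne']
        nlinarith
      rw [← this]
      have : 0 ≤ K / 2 ^ n := by positivity
      linarith
  -- Points at distance at most `2^{-m₀}` have equal or adjacent floors at level `m₀`.
  have hmid : |Z (dyadicFloor m₀ s) - Z (dyadicFloor m₀ r)| ≤ B m₀ := by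
    have h5 : (0 : ℝ) < 2 ^ m₀ := by positivity
    have h1 : ⌊r * 2 ^ m₀⌋₊ ≤ ⌊s * 2 ^ m₀⌋₊ := Nat.floor_le_floor (by gcongr)
    have h2 : ⌊s * 2 ^ m₀⌋₊ ≤ ⌊r * 2 ^ m₀⌋₊ + 1 := by
      rw [← Nat.floor_add_one (mul_nonneg hr h5.le)]
      refine Nat.floor_le_floor ?_
      rw [le_div_iff₀ h5] at hd
      linarith
    have h3 : ⌊s * 2 ^ m₀⌋₊ ≤ 2 ^ m₀ := by
      have h : (⌊s * 2 ^ m₀⌋₊ : ℝ) ≤ 2 ^ m₀ :=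
        (Nat.floor_le (mul_nonneg (hr.trans hrs) h5.le)).trans (mul_le_of_le_one_left h5.le hs1)
      exact_mod_cast h
    unfold dyadicFloor
    rcases (by omega : ⌊s * 2 ^ m₀⌋₊ = ⌊r * 2 ^ m₀⌋₊ ∨ ⌊s * 2 ^ m₀⌋₊ = ⌊r * 2 ^ m₀⌋₊ + 1) with h | h
    · rw [h]
      simpa using hB0 m₀
    · rw [h]
      push_cast
      exact hB m₀ le_rfl hmn _ (by omega)
  have a1 := abs_le.1 (hend s (hr.trans hrs) hs1)
  have a2 := abs_le.1 (hend r hr (hrs.trans hs1))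
  have a3 := abs_le.1 (abs_dyadicFloor_sub_le hmn hB0 hB (hr.trans hrs) hs1)
  have a4 := abs_le.1 (abs_dyadicFloor_sub_le hmn hB0 hB hr (hrs.trans hs1))
  have a5 := abs_le.1 hmid
  have a6 := hB0 m₀
  rw [hsum] at hBn ⊢
  rw [abs_le]
  constructor <;> linarith

end Chaining

/-! ### The randomly shifted perturbed lattice. -/

section RandomShift

/-- The points `ξ_j + a (j - ε)` of a lattice with a random shift `ε`, displaced by independent
variables `ξ_j` with law `μ`. -/
structure IsPerturbedLattice {Ω : Type*} [MeasurableSpace Ω] (μ : Measure ℝ) (ξ : ℤ → Ω → ℝ)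
    (ε : Ω → ℝ) (P : Measure Ω) : Prop where
  measurable : ∀ j, Measurable (ξ j)
  indep : iIndepFun ξ P
  law : ∀ j, P.map (ξ j) = μ
  measurable_shift : Measurable ε
  indep_shift : IndepFun ε (fun ω j => ξ j ω) P

/-- The rescaled fluctuation of the number of points in `(0, s T]`. -/
noncomputable def stepFluct (a T : ℝ) (z : ℝ × (ℤ → ℝ)) (s : ℝ) : ℝ :=
  ((shiftedCount a 0 (s * T) z).toReal - s * T / a) / √T

lemma measurable_stepFluct (a T s : ℝ) : Measurable fun z => stepFluct a T z s :=
  (((measurable_shiftedCount a 0 (s * T)).ennreal_toReal).sub_const _).div_const _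

lemma shiftedCount_add (a : ℝ) {p q r : ℝ} (hpq : p ≤ q) (hqr : q ≤ r) (z : ℝ × (ℤ → ℝ)) :
    shiftedCount a p r z = shiftedCount a p q z + shiftedCount a q r z := by
  simp only [shiftedCount, pointCountENN]
  rw [← ENNReal.tsum_add]
  congr 1 with j
  rw [← Set.Ioc_union_Ioc_eq_Ioc hpq hqr, Set.indicator_union_of_disjoint]
  exact Set.Ioc_disjoint_Ioc_of_le le_rfl

lemma stepFluct_sub {a T : ℝ} (hT : 0 ≤ T) {z : ℝ × (ℤ → ℝ)}
    (hz : ∀ p q, shiftedCount a p q z ≠ ⊤) {r s : ℝ} (hr : 0 ≤ r) (hrs : r ≤ s) :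
    stepFluct a T z s - stepFluct a T z r =
      ((shiftedCount a (r * T) (s * T) z).toReal - (s * T - r * T) / a) / √T := by
  unfold stepFluct
  rw [shiftedCount_add a (mul_nonneg hr hT) (mul_le_mul_of_nonneg_right hrs hT),
    ENNReal.toReal_add (hz _ _) (hz _ _)]
  ring

namespace IsPerturbedLattice

variable {Ω : Type*} [MeasurableSpace Ω] {P : Measure Ω} [IsProbabilityMeasure P]
  {a : ℝ} {μ : Measure ℝ} [IsProbabilityMeasure μ] {ξ : ℤ → Ω → ℝ} {ε : Ω → ℝ}

omit [IsProbabilityMeasure P] [IsProbabilityMeasure μ] in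
lemma measurable_prod (h : IsPerturbedLattice μ ξ ε P) :
    Measurable fun ω => (ε ω, fun j => ξ j ω) :=
  h.measurable_shift.prodMk (measurable_pi_lambda _ h.measurable)

lemma lintegral_shiftedCount_le (h : IsPerturbedLattice μ ξ ε P) (ha : 0 < a) {p q : ℝ}
    (hpq : p ≤ q) :
    ∫⁻ ω, shiftedCount a p q (ε ω, fun j => ξ j ω) ∂P ≤ ENNReal.ofReal ((q - p) / a + 1) :=
  lintegral_le_of_indepFun h.measurable_shift (measurable_pi_lambda _ h.measurable) h.indep_shift
    (measurable_shiftedCount a p q)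
    fun e => lintegral_shiftedCount_fixed_le ha h.measurable h.law hpq e

lemma ae_shiftedCount_ne_top (h : IsPerturbedLattice μ ξ ε P) (ha : 0 < a) :
    ∀ᵐ ω ∂P, ∀ p q, shiftedCount a p q (ε ω, fun j => ξ j ω) ≠ ⊤ := by
  have h1 : ∀ n : ℕ, ∀ᵐ ω ∂P, shiftedCount a (-n) n (ε ω, fun j => ξ j ω) ≠ ⊤ := fun n => by
    refine (ae_lt_top ((measurable_shiftedCount a _ _).comp h.measurable_prod) ?_).mono
      fun ω h => h.ne
    exact ((h.lintegral_shiftedCount_le ha (by linarith [n.cast_nonneg (α := ℝ)])).trans_lt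
      ENNReal.ofReal_lt_top).ne
  filter_upwards [ae_all_iff.2 h1] with ω hω p q
  obtain ⟨n, hn⟩ := exists_nat_ge (max |p| |q|)
  have hp := abs_le.1 ((le_max_left _ _).trans hn)
  have hq := abs_le.1 ((le_max_right _ _).trans hn)
  refine (pointCountENN_ne_top_iff _ _).2
    (((pointCountENN_ne_top_iff _ _).1 (hω n)).subset fun j hj => ?_)
  exact Set.Ioc_subset_Ioc hp.1 hq.2 hj

lemma measure_lt_abs_shiftedCount_sub_le (h : IsPerturbedLattice μ ξ ε P) (ha : 0 < a) {p q : ℝ}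
    (hpq : 1 ≤ q - p) {x : ℝ} (hx : 0 < x) :
    P {ω | x < |(shiftedCount a p q (ε ω, fun j => ξ j ω)).toReal - (q - p) / a|} ≤
      ENNReal.ofReal (64 * (1 / a + 1) ^ 2 * (q - p) ^ 2 / x ^ 4) := by
  have hΦ : Measurable fun z : ℝ × (ℤ → ℝ) =>
      ENNReal.ofReal (((shiftedCount a p q z).toReal - (q - p) / a) ^ 4) :=
    (((measurable_shiftedCount a p q).ennreal_toReal.sub_const _).pow_const 4).ennreal_ofReal
  have h1 := lintegral_le_of_indepFun h.measurable_shift (measurable_pi_lambda _ h.measurable)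
    h.indep_shift hΦ
    fun e => lintegral_shiftedCount_fixed_pow_four_le ha h.measurable h.indep h.law hpq e
  have hx4 : 0 < x ^ 4 := by positivity
  rw [ENNReal.ofReal_div_of_pos hx4]
  calc _ ≤ P {ω | ENNReal.ofReal (x ^ 4) ≤ ENNReal.ofReal
        (((shiftedCount a p q (ε ω, fun j => ξ j ω)).toReal - (q - p) / a) ^ 4)} := by
        refine measure_mono fun ω hω => ENNReal.ofReal_le_ofReal ?_
        have h2 := pow_le_pow_left₀ hx.le (le_of_lt hω) 4
        rwa [Even.pow_abs (by decide)] at h2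
    _ ≤ (∫⁻ ω, ENNReal.ofReal
        (((shiftedCount a p q (ε ω, fun j => ξ j ω)).toReal - (q - p) / a) ^ 4) ∂P) /
          ENNReal.ofReal (x ^ 4) :=
        meas_ge_le_lintegral_div (hΦ.comp h.measurable_prod).aemeasurable (by simpa using hx4)
          ENNReal.ofReal_ne_top
    _ ≤ _ := by gcongr

/-- Convergence of the finite-dimensional characteristic functions, with a rate. -/
lemma norm_integral_cexp_stepFluct_sub_le (h : IsPerturbedLattice μ ξ ε P) (ha : 0 < a) {T : ℝ}
    (hT : 0 < T) {v : ℝ → ℝ}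
    (hv : ∀ s, 0 ≤ s → ∫ z : ℝ × ℝ, min (s * T) |z.1 - z.2| ∂(μ.prod μ) = T * (a * v s))
    {ι : Type*} [Fintype ι] (s θ : ι → ℝ) (hs : ∀ k, 0 ≤ s k)
    (hθ : (∑ k, |θ k|) / √T ≤ 1 / 2) :
    ‖∫ ω, Complex.exp ((∑ k, θ k * stepFluct a T (ε ω, fun j => ξ j ω) (s k) : ℝ) *
        Complex.I) ∂P -
      (Real.exp (-(∑ k, ∑ l, θ k * θ l * ((v (s k) + v (s l) - v |s k - s l|) / 2)) / 2) : ℝ)‖ ≤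
      (∑ k, |θ k|) / √T *
        (2 * ∑ k, ∑ l, θ k * θ l * ((v (s k) + v (s l) - v |s k - s l|) / 2) + 5) := by
  have hm : Measurable fun z : ℝ × (ℤ → ℝ) => ∑ k, θ k * stepFluct a T z (s k) :=
    Finset.measurable_sum _ fun k _ => (measurable_stepFluct a T (s k)).const_mul _
  refine norm_integral_sub_le_of_indepFun h.measurable_shift
    (measurable_pi_lambda _ h.measurable) h.indep_shift
    (Φ := fun z => Complex.exp ((∑ k, θ k * stepFluct a T z (s k) : ℝ) * Complex.I))
    (by fun_prop) (fun z => ?_)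
    fun e => norm_integral_cexp_shiftedCount_fixed_le ha h.measurable h.indep h.law hT hv s θ hs hθ
      e
  rw [Complex.norm_exp_ofReal_mul_I]

/-- Control of the oscillation of the rescaled counts. -/
lemma measure_oscillation_stepFluct_le (h : IsPerturbedLattice μ ξ ε P) (ha : 0 < a) (m₀ : ℕ)
    {T : ℝ} (hT : 2 ^ m₀ ≤ T) :
    P {ω | ∃ r s, 0 ≤ r ∧ r ≤ s ∧ s ≤ 1 ∧ s - r ≤ 1 / 2 ^ m₀ ∧
        40 * (9 / 10 : ℝ) ^ m₀ + 4 / (a * √T) <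
          |stepFluct a T (ε ω, fun j => ξ j ω) s - stepFluct a T (ε ω, fun j => ξ j ω) r|} ≤
      ENNReal.ofReal (64 * (1 / a + 1) ^ 2 * ((5000 / 6561) ^ m₀ / (1 - 5000 / 6561))) := by
  have hT1 : 1 ≤ T := (one_le_pow₀ (by norm_num)).trans hT
  have hT0 : 0 < T := by linarith
  have hsT : 0 < √T := Real.sqrt_pos.2 hT0
  -- `2^n ≤ T < 2^{n+1}`: level `n` is the finest at which dyadic intervals still have length `T/2^m
  -- ≥ 1`, as the fourth-moment bound requires.
  obtain ⟨n, hn, hn'⟩ := exists_nat_pow_near hT1 (one_lt_two)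
  have hmn : m₀ ≤ n := by
    have := (pow_lt_pow_iff_right₀ (one_lt_two (α := ℝ))).1 (hT.trans_lt hn')
    omega
  set D := 64 * (1 / a + 1) ^ 2 with hD
  -- The thresholds `(9/10)^m` are summable, yet `(10/9)⁴/2 = 5000/6561 < 1`, so the union over the
  -- `2^m` intervals of level `m` still has geometrically small probability.
  set A : ℕ → ℕ → Set Ω := fun m k => {ω | (9 / 10 : ℝ) ^ m * √T <
    |(shiftedCount a ((k : ℝ) / 2 ^ m * T) ((k + 1 : ℝ) / 2 ^ m * T) (ε ω, fun j => ξ j ω)).toReal -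
      ((k + 1 : ℝ) / 2 ^ m * T - (k : ℝ) / 2 ^ m * T) / a|} with hA
  have hAle : ∀ m ≤ n, ∀ k, P (A m k) ≤ ENNReal.ofReal (D * ((5000 / 6561) ^ m / 2 ^ m)) := by
    intro m hm k
    have e1 : (k + 1 : ℝ) / 2 ^ m * T - (k : ℝ) / 2 ^ m * T = T / 2 ^ m := by ring
    have e2 : 1 ≤ (k + 1 : ℝ) / 2 ^ m * T - (k : ℝ) / 2 ^ m * T := by
      rw [e1, one_le_div (by positivity)]
      exact (pow_le_pow_right₀ one_le_two hm).trans hn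
    refine (h.measure_lt_abs_shiftedCount_sub_le ha e2
      (by positivity : 0 < (9 / 10 : ℝ) ^ m * √T)).trans_eq ?_
    congr 1
    have e3 : √T ^ 4 = T ^ 2 := by
      rw [show √T ^ 4 = (√T ^ 2) ^ 2 by ring, Real.sq_sqrt hT0.le]
    have e4 : (5000 / 6561 : ℝ) ^ m = 1 / (2 ^ m * ((9 / 10) ^ m) ^ 4) := by
      rw [← pow_mul, mul_comm m 4, pow_mul, ← mul_pow, ← one_div_pow]
      norm_num
    rw [e1, mul_pow, e3, e4, ← hD]
    field_simp
  have hsub : {ω | ∃ r s, 0 ≤ r ∧ r ≤ s ∧ s ≤ 1 ∧ s - r ≤ 1 / 2 ^ m₀ ∧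
        40 * (9 / 10 : ℝ) ^ m₀ + 4 / (a * √T) <
          |stepFluct a T (ε ω, fun j => ξ j ω) s - stepFluct a T (ε ω, fun j => ξ j ω) r|} ≤ᵐ[P]
      (⋃ m ∈ Finset.Ico m₀ (n + 1), ⋃ k ∈ Finset.range (2 ^ m), A m k : Set Ω) := by
    filter_upwards [h.ae_shiftedCount_ne_top ha] with ω hω
    rintro ⟨r, s, hr, hrs, hs, hd, hlt⟩
    by_contra hnot
    have hnot' : ∀ m, m₀ ≤ m → m ≤ n → ∀ k, k < 2 ^ m → ω ∉ A m k := by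
      intro m h1 h2 k hk hmem
      refine hnot ?_
      show ω ∈ (⋃ m ∈ Finset.Ico m₀ (n + 1), ⋃ k ∈ Finset.range (2 ^ m), A m k : Set Ω)
      simp only [Set.mem_iUnion, Finset.mem_Ico, Finset.mem_range]
      exact ⟨m, ⟨h1, by omega⟩, k, hk, hmem⟩
    -- The count is nondecreasing, so the fluctuation decreases only through its centring, at rate
    -- `K = √T / a`.
    have hch := abs_sub_le_of_dyadic (Z := stepFluct a T (ε ω, fun j => ξ j ω))
      (B := fun m => (9 / 10 : ℝ) ^ m) hmn (K := √T / a) (by positivity) (fun r s hr hrs _ => by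
        have h1 := stepFluct_sub hT0.le hω hr hrs
        have h2 : (0 : ℝ) ≤ (shiftedCount a (r * T) (s * T) (ε ω, fun j => ξ j ω)).toReal :=
          ENNReal.toReal_nonneg
        have h3 : √T / a * (s - r) = ((s * T - r * T) / a) / √T := by
          have : T = √T * √T := (Real.mul_self_sqrt hT0.le).symm
          field_simp
          rw [Real.sq_sqrt hT0.le]
          ring
        rw [sub_div, ← h3] at h1
        have : 0 ≤ (shiftedCount a (r * T) (s * T) (ε ω, fun j => ξ j ω)).toReal / √T := by
          positivity
        linarith) (fun m => by positivity) (fun m h1 h2 k hk => by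
        rw [stepFluct_sub hT0.le hω (by positivity) (div_le_div_of_nonneg_right (by linarith) (by positivity)), abs_div,
          abs_of_pos hsT, div_le_iff₀ hsT]
        exact le_of_not_gt fun h3 => hnot' m h1 h2 k hk h3) hr hrs hs hd
    have hIcc : Finset.Icc m₀ n = Finset.Ico m₀ (n + 1) := by
      ext m; simp
    have hgeo : ∑ m ∈ Finset.Icc m₀ n, (9 / 10 : ℝ) ^ m ≤ (9 / 10) ^ m₀ / (1 - 9 / 10) := by
      rw [hIcc]
      exact geom_sum_Ico_le_of_lt_one (by norm_num) (by norm_num)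
    -- From `T < 2^{n+1}`. The two endpoints give `4/(a√T)`, and `40` is `4` times the geometric
    -- factor `1/(1 - 9/10)`.
    have hK : √T / a / 2 ^ n ≤ 2 / (a * √T) := by
      rw [div_div, div_le_div_iff₀ (by positivity) (by positivity)]
      have : √T * √T = T := Real.mul_self_sqrt hT0.le
      rw [pow_succ] at hn'
      calc √T * (a * √T) = a * T := by linear_combination a * this
        _ ≤ a * (2 ^ n * 2) := by gcongr
        _ = _ := by ring
    have h4 : 4 / (a * √T) = 2 * (2 / (a * √T)) := by ring
    have h5 : (9 / 10 : ℝ) ^ m₀ / (1 - 9 / 10) = 10 * (9 / 10) ^ m₀ := by ring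
    rw [h5] at hgeo
    linarith
  calc _ ≤ P (⋃ m ∈ Finset.Ico m₀ (n + 1), ⋃ k ∈ Finset.range (2 ^ m), A m k) :=
        measure_mono_ae hsub
    _ ≤ ∑ m ∈ Finset.Ico m₀ (n + 1), ∑ k ∈ Finset.range (2 ^ m), P (A m k) :=
        (measure_biUnion_finset_le _ _).trans
          (Finset.sum_le_sum fun m _ => measure_biUnion_finset_le _ _)
    _ ≤ ∑ m ∈ Finset.Ico m₀ (n + 1), ENNReal.ofReal (D * (5000 / 6561) ^ m) := by
        refine Finset.sum_le_sum fun m hm => ?_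
        refine (Finset.sum_le_sum fun k _ =>
          hAle m (by simp only [Finset.mem_Ico] at hm; omega) k).trans_eq ?_
        rw [Finset.sum_const, Finset.card_range, nsmul_eq_mul,
          ← ENNReal.ofReal_natCast, ← ENNReal.ofReal_mul (by positivity)]
        congr 1
        push_cast
        field_simp
    _ = ENNReal.ofReal (D * ∑ m ∈ Finset.Ico m₀ (n + 1), (5000 / 6561) ^ m) := by
        rw [Finset.mul_sum, ENNReal.ofReal_sum_of_nonneg fun m _ => by positivity]
    _ ≤ _ := by
        refine ENNReal.ofReal_le_ofReal (mul_le_mul_of_nonneg_left ?_ (by positivity))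
        exact geom_sum_Ico_le_of_lt_one (by norm_num) (by norm_num)

end IsPerturbedLattice

end RandomShift

/-! ### Absence of atoms. -/

section Atoms

/-- A probability measure whose characteristic function vanishes at infinity has no atoms. -/
lemma nullSingletonClass_of_tendsto_charFun {μ : Measure ℝ} [IsProbabilityMeasure μ]
    (h : ∀ θ : ℝ, θ ≠ 0 → Tendsto (fun n : ℕ => charFun μ (n * θ)) atTop (𝓝 0)) : NullSingletonClass μ := by
  refine ⟨fun x => ?_⟩
  -- Averaging the frequency over a standard Gaussian gives `∫ exp(-n²(y - x)²/2) dμ(y)`, which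
  -- dominates `μ {x}`. The left side tends to zero by dominated convergence, since `θ = 0` is
  -- Gaussian-null.
  have hswap : ∀ n : ℕ, ∫ θ : ℝ, Complex.exp ((-(n * θ * x) : ℝ) * Complex.I) * charFun μ (n * θ)
      ∂(gaussianReal 0 1) = ((∫ y, Real.exp (-(n * (y - x)) ^ 2 / 2) ∂μ : ℝ) : ℂ) := by
    intro n
    have h1 : ∀ θ : ℝ, Complex.exp ((-(n * θ * x) : ℝ) * Complex.I) * charFun μ (n * θ) =
        ∫ y, Complex.exp ((θ * (n * (y - x)) : ℝ) * Complex.I) ∂μ := by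
      intro θ
      rw [charFun_apply_real, ← integral_const_mul]
      congr 1 with y
      rw [← Complex.exp_add]
      congr 1
      push_cast
      ring
    simp_rw [h1]
    rw [integral_integral_swap, ← integral_complex_ofReal]
    · congr 1 with y
      have h2 := charFun_gaussianReal (μ := 0) (v := 1) ((n : ℝ) * (y - x))
      rw [charFun_apply_real] at h2
      have h3 : ∀ θ : ℝ, Complex.exp ((θ * (n * (y - x)) : ℝ) * Complex.I) =
          Complex.exp (((n : ℝ) * (y - x) : ℝ) * θ * Complex.I) := fun θ => by
        congr 1
        push_cast
        ring
      simp_rw [h3]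
      rw [h2]
      push_cast
      congr 1
      ring
    · refine Integrable.of_bound (Continuous.aestronglyMeasurable ?_) 1
        (Eventually.of_forall fun z => ?_)
      · unfold Function.uncurry
        fun_prop
      · simp only [Function.uncurry]
        rw [Complex.norm_exp_ofReal_mul_I]
  have hle : ∀ n : ℕ, μ.real {x} ≤ ‖∫ θ : ℝ, Complex.exp ((-(n * θ * x) : ℝ) * Complex.I) *
      charFun μ (n * θ) ∂(gaussianReal 0 1)‖ := by
    intro n
    rw [hswap, Complex.norm_real, Real.norm_eq_abs]
    refine le_trans ?_ (le_abs_self _)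
    rw [← integral_indicator_one (measurableSet_singleton x)]
    refine integral_mono ((integrable_const (1 : ℝ)).indicator (measurableSet_singleton x)) ?_
      fun y => ?_
    · refine integrable_of_abs_le (by fun_prop) (C := 1) fun y => ?_
      rw [abs_of_pos (Real.exp_pos _), Real.exp_le_one_iff]
      have := sq_nonneg ((n : ℝ) * (y - x))
      linarith
    · refine Set.indicator_apply_le' (fun hy => ?_) fun _ => (Real.exp_pos _).le
      rw [Set.mem_singleton_iff.1 hy]
      simp
  have hlim : Tendsto (fun n : ℕ => ∫ θ : ℝ, Complex.exp ((-(n * θ * x) : ℝ) * Complex.I) *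
      charFun μ (n * θ) ∂(gaussianReal 0 1)) atTop (𝓝 0) := by
    have h0 : (0 : ℂ) = ∫ _ : ℝ, (0 : ℂ) ∂(gaussianReal 0 1) := by simp
    rw [h0]
    refine tendsto_integral_of_dominated_convergence (fun _ => (1 : ℝ)) (fun n => ?_)
      (integrable_const _) (fun n => Eventually.of_forall fun θ => ?_) ?_
    · have : Measurable fun θ : ℝ => charFun μ (n * θ) :=
        measurable_charFun.comp (measurable_id.const_mul _)
      exact (Measurable.mul (by fun_prop) this).aestronglyMeasurable
    · rw [norm_mul, Complex.norm_exp_ofReal_mul_I, one_mul]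
      exact norm_charFun_le_one _
    · have : ∀ᵐ θ : ℝ ∂(gaussianReal 0 1), θ ≠ 0 := by
        have := nullSingletonClass_gaussianReal (μ := 0) (v := 1) one_ne_zero
        exact Measure.ae_ne _ 0
      filter_upwards [this] with θ hθ
      refine (tendsto_zero_iff_norm_tendsto_zero).2 ?_
      simp_rw [norm_mul, Complex.norm_exp_ofReal_mul_I, one_mul]
      exact tendsto_zero_iff_norm_tendsto_zero.1 (h θ hθ)
  have h0 : μ.real {x} ≤ 0 := by
    have := hlim.norm
    rw [norm_zero] at this
    exact ge_of_tendsto' this hle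
  have h1 := le_antisymm h0 measureReal_nonneg
  rwa [measureReal_eq_zero_iff] at h1

lemma ae_ne_of_indepFun {Ω : Type*} [MeasurableSpace Ω] {P : Measure Ω} [IsProbabilityMeasure P]
    {U V : Ω → ℝ} (hU : Measurable U) (hV : Measurable V) (hUV : IndepFun U V P)
    [NullSingletonClass (P.map U)] : ∀ᵐ ω ∂P, U ω ≠ V ω := by
  have hS : MeasurableSet {z : ℝ × ℝ | z.2 = z.1} :=
    measurableSet_eq_fun measurable_snd measurable_fst
  have h := lintegral_le_of_indepFun hV hU hUV.symm
    (Φ := {z : ℝ × ℝ | z.2 = z.1}.indicator 1) (measurable_one.indicator hS) (B := 0) fun v => by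
      have : ∀ ω, {z : ℝ × ℝ | z.2 = z.1}.indicator (1 : ℝ × ℝ → ENNReal) (v, U ω) =
          (U ⁻¹' {v}).indicator 1 ω := fun ω => rfl
      simp_rw [this]
      rw [lintegral_indicator_one (hU (measurableSet_singleton v)),
        ← Measure.map_apply hU (measurableSet_singleton v), measure_singleton]
  have h2 : ∫⁻ ω, {z : ℝ × ℝ | z.2 = z.1}.indicator (1 : ℝ × ℝ → ENNReal) (V ω, U ω) ∂P =
      P {ω | U ω = V ω} := by
    rw [← lintegral_indicator_one (measurableSet_eq_fun hU hV)]
    rfl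
  rw [h2] at h
  exact measure_eq_zero_iff_ae_notMem.1 (le_antisymm h (zero_le))

end Atoms

/-! ### Almost sure regularity of the random configuration. -/

namespace IsPerturbedLattice

variable {Ω : Type*} [MeasurableSpace Ω] {P : Measure Ω} [IsProbabilityMeasure P]
  {a : ℝ} {μ : Measure ℝ} [IsProbabilityMeasure μ] {ξ : ℤ → Ω → ℝ} {ε : Ω → ℝ}

/-- If no point lies beyond `n`, then `(n, n + ℓ]` is empty and its count misses `ℓ/a` by more than
`ℓ/(2a)`. The fourth-moment bound makes this `O(ℓ⁻²)` for every `ℓ`, hence null. -/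
lemma ae_unbounded (h : IsPerturbedLattice μ ξ ε P) (ha : 0 < a) :
    ∀ᵐ ω ∂P, ∀ x, ∃ j, x < shiftedConfig a (ε ω) (fun j => ξ j ω) j := by
  have h1 : ∀ n : ℕ, ∀ᵐ ω ∂P, ∃ j, (n : ℝ) < shiftedConfig a (ε ω) (fun j => ξ j ω) j := by
    intro n
    rw [ae_iff]
    have hb : ∀ ℓ : ℕ, 1 ≤ ℓ →
        P {ω | ¬∃ j, (n : ℝ) < shiftedConfig a (ε ω) (fun j => ξ j ω) j} ≤
          ENNReal.ofReal (64 * (1 / a + 1) ^ 2 * (16 * a ^ 4) / (ℓ : ℝ) ^ 2) := by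
      intro ℓ hℓ
      have hℓ' : (1 : ℝ) ≤ ℓ := by exact_mod_cast hℓ
      have hx : 0 < (ℓ : ℝ) / (2 * a) := by positivity
      refine (measure_mono fun ω hω => ?_).trans
        ((h.measure_lt_abs_shiftedCount_sub_le ha (p := n) (q := n + ℓ) (by linarith) hx).trans_eq
          ?_)
      · have h0 : shiftedCount a n (n + ℓ) (ε ω, fun j => ξ j ω) = 0 := by
          simp only [shiftedCount, pointCountENN, ENNReal.tsum_eq_zero]
          exact fun j => Set.indicator_of_notMem
            (fun hj : shiftedConfig a (ε ω) (fun j => ξ j ω) j ∈ Set.Ioc (n : ℝ) (n + ℓ) =>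
              hω ⟨j, hj.1⟩) _
        show (ℓ : ℝ) / (2 * a) <
          |(shiftedCount a n (n + ℓ) (ε ω, fun j => ξ j ω)).toReal - (n + ℓ - n) / a|
        rw [h0, ENNReal.toReal_zero, zero_sub, abs_neg, add_sub_cancel_left, abs_of_pos (by positivity)]
        rw [div_lt_div_iff₀ (by positivity) ha]
        nlinarith
      · congr 1
        field_simp
        ring
    refine le_antisymm ?_ zero_le
    have hlim : Tendsto (fun ℓ : ℕ => ENNReal.ofReal
        (64 * (1 / a + 1) ^ 2 * (16 * a ^ 4) / (ℓ : ℝ) ^ 2)) atTop (𝓝 0) := by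
      rw [← ENNReal.ofReal_zero]
      refine ENNReal.tendsto_ofReal (Tendsto.div_atTop tendsto_const_nhds ?_)
      exact (tendsto_pow_atTop two_ne_zero).comp tendsto_natCast_atTop_atTop
    exact ge_of_tendsto hlim ((eventually_ge_atTop 1).mono hb)
  filter_upwards [ae_all_iff.2 h1] with ω hω x
  obtain ⟨n, hn⟩ := exists_nat_ge x
  obtain ⟨j, hj⟩ := hω n
  exact ⟨j, hn.trans_lt hj⟩

/-- Two points coincide only if `ξ i = ξ j + a(j - i)`, where the shift cancels; this is null for
independent atomless displacements. Avoiding `0` makes paths start at `0` and identifies counts on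
`[0,x]` and `(0,x]`. -/
lemma ae_isRegularConfig (h : IsPerturbedLattice μ ξ ε P) (ha : 0 < a) [NullSingletonClass μ] :
    ∀ᵐ ω ∂P, IsRegularConfig (shiftedConfig a (ε ω) (fun j => ξ j ω)) ∧
      ∀ j, shiftedConfig a (ε ω) (fun j => ξ j ω) j ≠ 0 := by
  have hat : ∀ j, NullSingletonClass (P.map (ξ j)) := fun j => by rw [h.law]; infer_instance
  have hinj : ∀ i j, i ≠ j → ∀ᵐ ω ∂P, ξ i ω ≠ ξ j ω + a * ((j : ℝ) - i) := fun i j hij => by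
    have hind : IndepFun (ξ i) (fun ω => ξ j ω + a * ((j : ℝ) - i)) P :=
      (h.indep.indepFun hij).comp (φ := id) (ψ := fun x => x + a * ((j : ℝ) - i)) measurable_id
        (measurable_id.add_const _)
    exact ae_ne_of_indepFun (h.measurable i) ((h.measurable j).add_const _) hind
  have hzero : ∀ j, ∀ᵐ ω ∂P, ξ j ω ≠ -(a * ((j : ℝ) - ε ω)) := fun j => by
    have hind : IndepFun (ξ j) (fun ω => -(a * ((j : ℝ) - ε ω))) P :=
      (h.indep_shift.comp (φ := fun e : ℝ => -(a * ((j : ℝ) - e)))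
        (ψ := fun x : ℤ → ℝ => x j) (by fun_prop) (measurable_pi_apply j)).symm
    exact ae_ne_of_indepFun (h.measurable j)
      (((h.measurable_shift.const_sub _).const_mul _).neg) hind
  filter_upwards [h.ae_unbounded ha, h.ae_shiftedCount_ne_top ha,
    ae_all_iff.2 fun i => ae_all_iff.2 fun j => ae_all_iff.2 (hinj i j), ae_all_iff.2 hzero]
    with ω h1 h2 h3 h4
  refine ⟨⟨fun x => ?_, fun i j hij => ?_, h1⟩, fun j hj => h4 j ?_⟩
  · refine ((pointCountENN_ne_top_iff _ _).1 (h2 (-1) x)).subset fun j hj => ?_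
    exact ⟨by linarith [hj.1], hj.2⟩
  · by_contra hne
    refine h3 i j hne ?_
    simp only [shiftedConfig] at hij
    linarith
  · simp only [shiftedConfig] at hj
    linarith

end IsPerturbedLattice

/-! ### The stable particle system and convergence of its fluctuations. -/

section StableSystem

/-- Self-similarity: as `T^α = t`, the difference of two independent displacements divided by `T`
has characteristic function `exp(-2c|θ|^α)`, free of `t`. -/
lemma integral_min_abs_sub_eq {α c a : ℝ} (ha : 0 < a) (hα : 0 < α) {t : ℝ≥0} (ht : 0 < t)
    {μ : Measure ℝ} [IsProbabilityMeasure μ]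
    (hμ : ∀ θ : ℝ, charFun μ θ = ((Real.exp (-((t : ℝ) * c * |θ| ^ α)) : ℝ) : ℂ)) {s : ℝ}
    (hs : 0 ≤ s) :
    ∫ z : ℝ × ℝ, min (s * (t : ℝ) ^ (1 / α)) |z.1 - z.2| ∂(μ.prod μ) =
      (t : ℝ) ^ (1 / α) * (a * limitVar α c a s) := by
  have ht' : (0 : ℝ) < t := ht
  set T := (t : ℝ) ^ (1 / α) with hT
  have hT0 : 0 < T := Real.rpow_pos_of_pos ht' _
  have hTα : T ^ α = t := by
    rw [hT, ← Real.rpow_mul ht'.le, one_div_mul_cancel hα.ne', Real.rpow_one]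
  have hm : Measurable fun z : ℝ × ℝ => (z.1 - z.2) / T := by fun_prop
  have : IsProbabilityMeasure ((μ.prod μ).map fun z : ℝ × ℝ => (z.1 - z.2) / T) :=
    Measure.isProbabilityMeasure_map hm.aemeasurable
  have hρ : ∀ θ : ℝ, charFun ((μ.prod μ).map fun z : ℝ × ℝ => (z.1 - z.2) / T) θ =
      ((Real.exp (-(2 * c * |θ| ^ α)) : ℝ) : ℂ) := by
    intro θ
    rw [charFun_map_apply hm.aemeasurable]
    have h1 : ∀ z : ℝ × ℝ, Complex.exp ((θ * ((z.1 - z.2) / T) : ℝ) * Complex.I) =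
        Complex.exp ((θ / T : ℝ) * z.1 * Complex.I) *
          Complex.exp ((-(θ / T) : ℝ) * z.2 * Complex.I) := fun z => by
      rw [← Complex.exp_add]
      congr 1
      push_cast
      ring
    simp_rw [h1]
    rw [integral_prod_mul (fun x : ℝ => Complex.exp ((θ / T : ℝ) * x * Complex.I))
      (fun x : ℝ => Complex.exp ((-(θ / T) : ℝ) * x * Complex.I)), ← charFun_apply_real,
      ← charFun_apply_real, hμ, hμ, abs_neg, ← Complex.ofReal_mul, ← Real.exp_add, abs_div,
      abs_of_pos hT0, Real.div_rpow (abs_nonneg _) hT0.le, hTα]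
    congr 2
    field_simp
    ring
  rw [← integral_min_abs_eq_limitVar ha hρ hs, integral_map hm.aemeasurable
    (by fun_prop), ← integral_const_mul]
  congr 1 with z
  rw [abs_div, abs_of_pos hT0, mul_min_of_nonneg _ _ hT0.le, mul_comm s, mul_div_cancel₀ _ hT0.ne']

lemma nullSingletonClass_of_charFun_stable {α c : ℝ} (hα : 0 < α) (hc : 0 < c) {t : ℝ≥0}
    (ht : 0 < t) {μ : Measure ℝ} [IsProbabilityMeasure μ]
    (hμ : ∀ θ : ℝ, charFun μ θ = ((Real.exp (-((t : ℝ) * c * |θ| ^ α)) : ℝ) : ℂ)) :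
    NullSingletonClass μ := by
  have ht' : (0 : ℝ) < t := ht
  refine nullSingletonClass_of_tendsto_charFun fun θ hθ => ?_
  simp_rw [hμ]
  rw [← Complex.ofReal_zero]
  refine (Complex.continuous_ofReal.tendsto 0).comp ?_
  refine Real.tendsto_exp_neg_atTop_nhds_zero.comp ?_
  refine Tendsto.const_mul_atTop (by positivity) ((tendsto_rpow_atTop hα).comp ?_)
  simp_rw [abs_mul, Nat.abs_cast]
  exact tendsto_natCast_atTop_atTop.atTop_mul_const (abs_pos.2 hθ)

lemma sqrt_rpow_one_div (α : ℝ) (t : ℝ≥0) :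
    √((t : ℝ) ^ (1 / α)) = (t : ℝ) ^ (1 / (2 * α)) := by
  rw [Real.sqrt_eq_rpow, ← Real.rpow_mul t.coe_nonneg]
  congr 1
  ring

lemma pointCount_eq_toReal_shiftedCount {a e : ℝ} {x : ℤ → ℝ}
    (hY : IsRegularConfig (shiftedConfig a e x)) (h0 : ∀ j, shiftedConfig a e x j ≠ 0) {y : ℝ}
    (hy : 0 ≤ y) :
    pointCount (shiftedConfig a e x) y = (shiftedCount a 0 y (e, x)).toReal := by
  rw [IsRegularConfig.pointCount_add hY.finite le_rfl hy, shiftedCount, pointCountENN_toReal,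
    pointCount]
  have : {j : ℤ | shiftedConfig a e x j ∈ Set.Icc (0 : ℝ) 0} = ∅ :=
    Set.eq_empty_of_forall_notMem fun j hj => h0 j (le_antisymm hj.2 hj.1)
  rw [this]
  simp

variable {Ω : Type*} [MeasurableSpace Ω] {α a : ℝ} {X : ℤ → ℝ≥0 → Ω → ℝ} {ε : Ω → ℝ} {t : ℝ≥0}
  {ω : Ω}

omit [MeasurableSpace Ω] in
lemma fluct_eq (s : ℝ) : fluct α a X ε t ω s =
    (interpolate (pointCount (shiftedConfig a (ε ω) fun j => X j t ω)) (s * (t : ℝ) ^ (1 / α)) -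
      s * (t : ℝ) ^ (1 / α) / a) / √((t : ℝ) ^ (1 / α)) := by
  rw [sqrt_rpow_one_div]
  rfl

omit [MeasurableSpace Ω] in
lemma abs_fluct_sub_stepFluct_le (hY : IsRegularConfig (shiftedConfig a (ε ω) fun j => X j t ω))
    (h0 : ∀ j, shiftedConfig a (ε ω) (fun j => X j t ω) j ≠ 0) {s : ℝ} (hs : 0 ≤ s) :
    |fluct α a X ε t ω s - stepFluct a ((t : ℝ) ^ (1 / α)) (ε ω, fun j => X j t ω) s| ≤
      1 / √((t : ℝ) ^ (1 / α)) := by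
  have hT : 0 ≤ s * (t : ℝ) ^ (1 / α) := mul_nonneg hs (Real.rpow_nonneg t.2 _)
  rw [fluct_eq, stepFluct, ← pointCount_eq_toReal_shiftedCount hY h0 hT, ← sub_div,
    sub_sub_sub_cancel_right, abs_div, abs_of_nonneg (Real.sqrt_nonneg _)]
  gcongr
  exact hY.abs_interpolate_sub_le hT

omit [MeasurableSpace Ω] in
lemma continuous_fluct (hY : IsRegularConfig (shiftedConfig a (ε ω) fun j => X j t ω)) :
    Continuous fun s : I => fluct α a X ε t ω s := by
  simp_rw [fluct_eq]
  refine ((Continuous.sub ?_ (by fun_prop)).div_const _)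
  exact hY.continuousOn_interpolate.comp_continuous (by fun_prop) fun s =>
    mul_nonneg s.2.1 (Real.rpow_nonneg t.2 _)

omit [MeasurableSpace Ω] in
lemma fluctPath_apply (hY : IsRegularConfig (shiftedConfig a (ε ω) fun j => X j t ω)) (s : I) :
    fluctPath α a X ε t ω s = fluct α a X ε t ω s := by
  rw [fluctPath, dif_pos (continuous_fluct hY)]
  rfl

omit [MeasurableSpace Ω] in
lemma fluct_zero (hY : IsRegularConfig (shiftedConfig a (ε ω) fun j => X j t ω))
    (h0 : ∀ j, shiftedConfig a (ε ω) (fun j => X j t ω) j ≠ 0) : fluct α a X ε t ω 0 = 0 := by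
  rw [fluct_eq]
  simp [hY.interpolate_zero h0]

omit [MeasurableSpace Ω] in
-- At time `0` the scale `0^{1/(2α)}` vanishes and division by zero gives the zero path. This covers
-- the single time excluded by the regularity results, since convergence in distribution asks for
-- measurability at every index.
lemma fluctPath_time_zero (hα : α ≠ 0) (ω : Ω) : fluctPath α a X ε 0 ω = 0 := by
  have h : ∀ s, fluct α a X ε 0 ω s = 0 := fun s => by
    rw [fluct]
    simp [Real.zero_rpow, hα]
  ext s
  rw [fluctPath]
  split_ifs with hc
  · exact h s
  · rfl

/-- On regular configurations the path coordinates have the measurable form `interpolatedCount`; the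
rest lies in a measurable null set, where the path is replaced by zero. -/
lemma aemeasurable_fluctPath {P : Measure Ω} (hX : ∀ j, Measurable (X j t)) (hε : Measurable ε)
    (hreg : ∀ᵐ ω ∂P, IsRegularConfig (shiftedConfig a (ε ω) fun j => X j t ω)) :
    AEMeasurable (fluctPath α a X ε t) P := by
  classical
  obtain ⟨G, hG, hGm, hG0⟩ := exists_measurable_superset_of_null (ae_iff.1 hreg)
  have hreg' : ∀ ω ∉ G, IsRegularConfig (shiftedConfig a (ε ω) fun j => X j t ω) := fun ω hω => by
    by_contra h
    exact hω (hG h)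
  refine ⟨fun ω => if ω ∈ G then 0 else fluctPath α a X ε t ω, measurable_path fun s => ?_, ?_⟩
  · have hm : Measurable fun ω =>
        (interpolatedCount (shiftedConfig a (ε ω) fun j => X j t ω) (s * (t : ℝ) ^ (1 / α)) -
          s * (t : ℝ) ^ (1 / α) / a) / √((t : ℝ) ^ (1 / α)) :=
      (((measurable_interpolatedCount _).comp ((measurable_shiftedConfig a).comp
        (hε.prodMk (measurable_pi_lambda _ hX)))).sub_const _).div_const _
    have hT : 0 ≤ (s : ℝ) * (t : ℝ) ^ (1 / α) :=
      mul_nonneg s.2.1 (Real.rpow_nonneg t.coe_nonneg _)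
    convert hm.indicator hGm.compl using 1
    ext ω
    by_cases h : ω ∈ G
    · rw [Set.indicator_of_notMem (by simpa using h), if_pos h]
      rfl
    · rw [Set.indicator_of_mem (by simpa using h), if_neg h, fluctPath_apply (hreg' ω h), fluct_eq, (hreg' ω h).interpolate_eq_interpolatedCount hT]
  · filter_upwards [measure_eq_zero_iff_ae_notMem.1 hG0] with ω hω
    rw [if_neg hω]

variable {P : Measure Ω} [IsProbabilityMeasure P] {c : ℝ} {μ : ℝ≥0 → Measure ℝ}
  [∀ t, IsProbabilityMeasure (μ t)]

lemma ae_isRegularConfig_of_stable (hα : 0 < α) (hc : 0 < c) (ha : 0 < a)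
    (hX : IsPerturbedLattice (μ t) (fun j => X j t) ε P)
    (hμ : ∀ θ : ℝ, charFun (μ t) θ = ((Real.exp (-((t : ℝ) * c * |θ| ^ α)) : ℝ) : ℂ))
    (ht : 0 < t) :
    ∀ᵐ ω ∂P, IsRegularConfig (shiftedConfig a (ε ω) fun j => X j t ω) ∧
      ∀ j, shiftedConfig a (ε ω) (fun j => X j t ω) j ≠ 0 :=
  have := nullSingletonClass_of_charFun_stable hα hc ht hμ
  hX.ae_isRegularConfig ha

lemma aemeasurable_fluctPath_of_stable (hα : 0 < α) (hc : 0 < c) (ha : 0 < a)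
    (hX : IsPerturbedLattice (μ t) (fun j => X j t) ε P)
    (hμ : ∀ θ : ℝ, charFun (μ t) θ = ((Real.exp (-((t : ℝ) * c * |θ| ^ α)) : ℝ) : ℂ)) :
    AEMeasurable (fluctPath α a X ε t) P := by
  rcases eq_zero_or_pos t with rfl | ht
  · have : fluctPath α a X ε 0 = fun _ => 0 := funext (fluctPath_time_zero hα.ne')
    rw [this]
    exact aemeasurable_const
  · exact aemeasurable_fluctPath hX.measurable hX.measurable_shift
      ((ae_isRegularConfig_of_stable hα hc ha hX hμ ht).mono fun ω h => h.1)

lemma norm_cexp_mul_I_sub_le (x y : ℝ) :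
    ‖Complex.exp (x * Complex.I) - Complex.exp (y * Complex.I)‖ ≤ |x - y| := by
  have h : Complex.exp (x * Complex.I) - Complex.exp (y * Complex.I) =
      Complex.exp (y * Complex.I) * (Complex.exp (Complex.I * (x - y : ℝ)) - 1) := by
    rw [mul_sub, ← Complex.exp_add, mul_one]
    congr 2
    push_cast
    ring
  rw [h, norm_mul, Complex.norm_exp_ofReal_mul_I, one_mul]
  exact Real.norm_exp_I_mul_ofReal_sub_one_le

lemma tendsto_sqrt_rpow_atTop (hα : 0 < α) :
    Tendsto (fun t : ℝ≥0 => √((t : ℝ) ^ (1 / α))) atTop atTop :=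
  Real.tendsto_sqrt_atTop.comp ((tendsto_rpow_atTop (one_div_pos.2 hα)).comp
    (NNReal.tendsto_coe_atTop.2 tendsto_id))

/-- The covariance kernel of the limit. -/
noncomputable def limitCov (α c a : ℝ) (r s : I) : ℝ :=
  (limitVar α c a r + limitVar α c a s - limitVar α c a |(r : ℝ) - (s : ℝ)|) / 2

/-- The constant `6` is the `5` of the count estimate plus `1` for the interpolation error `1/√T` in
each coordinate. -/
lemma norm_integral_cexp_fluctPath_sub_le (hα : 0 < α) (hc : 0 < c) (ha : 0 < a)
    (hX : IsPerturbedLattice (μ t) (fun j => X j t) ε P)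
    (hμ : ∀ θ : ℝ, charFun (μ t) θ = ((Real.exp (-((t : ℝ) * c * |θ| ^ α)) : ℝ) : ℂ))
    (ht : 0 < t) {ι : Type*} [Fintype ι] (s : ι → I) (θ : ι → ℝ)
    (hθ : (∑ k, |θ k|) / √((t : ℝ) ^ (1 / α)) ≤ 1 / 2) :
    ‖∫ ω, Complex.exp ((∑ k, θ k * fluctPath α a X ε t ω (s k) : ℝ) * Complex.I) ∂P -
      (Real.exp (-(∑ k, ∑ l, θ k * θ l * limitCov α c a (s k) (s l)) / 2) : ℝ)‖ ≤
      (∑ k, |θ k|) / √((t : ℝ) ^ (1 / α)) *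
        (2 * ∑ k, ∑ l, θ k * θ l * limitCov α c a (s k) (s l) + 6) := by
  have ht' : (0 : ℝ) < t := ht
  set T := (t : ℝ) ^ (1 / α) with hT
  have hT0 : 0 < T := Real.rpow_pos_of_pos ht' _
  have hreg := ae_isRegularConfig_of_stable hα hc ha hX hμ ht
  have h1 := hX.norm_integral_cexp_stepFluct_sub_le ha hT0 (v := limitVar α c a)
    (fun s hs => integral_min_abs_sub_eq ha hα ht hμ hs) (fun k => (s k : ℝ)) θ
    (fun k => (s k).2.1) hθ
  have hm1 : AEMeasurable (fun ω => ∑ k, θ k * fluctPath α a X ε t ω (s k)) P :=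
    Finset.aemeasurable_fun_sum _ fun k _ => ((measurable_pathEval (s k)).comp_aemeasurable
      (aemeasurable_fluctPath_of_stable hα hc ha hX hμ)).const_mul _
  have hm2 : Measurable fun ω => ∑ k, θ k * stepFluct a T (ε ω, fun j => X j t ω) (s k) :=
    Finset.measurable_sum _ fun k _ =>
      ((measurable_stepFluct a T (s k)).comp hX.measurable_prod).const_mul _
  have h2 : ‖∫ ω, Complex.exp ((∑ k, θ k * fluctPath α a X ε t ω (s k) : ℝ) * Complex.I) ∂P -
      ∫ ω, Complex.exp ((∑ k, θ k * stepFluct a T (ε ω, fun j => X j t ω) (s k) : ℝ) *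
        Complex.I) ∂P‖ ≤ (∑ k, |θ k|) / √T := by
    rw [← integral_sub (integrable_cexp_mul_I hm1) (integrable_cexp_mul_I hm2.aemeasurable)]
    refine (norm_integral_le_of_norm_le_const (C := (∑ k, |θ k|) / √T)
      (hreg.mono fun ω hω => ?_)).trans (by simp)
    refine (norm_cexp_mul_I_sub_le _ _).trans ?_
    rw [← Finset.sum_sub_distrib, Finset.sum_div]
    refine (Finset.abs_sum_le_sum_abs _ _).trans (Finset.sum_le_sum fun k _ => ?_)
    rw [← mul_sub, abs_mul, div_eq_mul_one_div, fluctPath_apply hω.1]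
    exact mul_le_mul_of_nonneg_left (abs_fluct_sub_stepFluct_le hω.1 hω.2 (s k).2.1)
      (abs_nonneg _)
  simp only [limitCov]
  refine (norm_sub_le_norm_sub_add_norm_sub _ _ _).trans ((add_le_add h2 h1).trans_eq ?_)
  ring

/-- In `(4/a + 2)/√T` the `4/a` comes from chaining and the `2` from replacing the interpolation by
the count at both endpoints. -/
lemma measure_oscSet_fluctPath_le (hα : 0 < α) (hc : 0 < c) (ha : 0 < a)
    (hX : IsPerturbedLattice (μ t) (fun j => X j t) ε P)
    (hμ : ∀ θ : ℝ, charFun (μ t) θ = ((Real.exp (-((t : ℝ) * c * |θ| ^ α)) : ℝ) : ℂ))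
    (ht : 0 < t) {m₀ : ℕ} (hm₀ : 2 ^ m₀ ≤ (t : ℝ) ^ (1 / α)) {η : ℝ}
    (hη : 40 * (9 / 10 : ℝ) ^ m₀ + (4 / a + 2) / √((t : ℝ) ^ (1 / α)) ≤ η) :
    P {ω | fluctPath α a X ε t ω ∈ oscSet (1 / 2 ^ m₀) η} ≤
      ENNReal.ofReal (64 * (1 / a + 1) ^ 2 * ((5000 / 6561) ^ m₀ / (1 - 5000 / 6561))) := by
  refine (measure_mono_ae ?_).trans (hX.measure_oscillation_stepFluct_le ha m₀ hm₀)
  filter_upwards [ae_isRegularConfig_of_stable hα hc ha hX hμ ht] with ω hω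
  have key : ∀ r s : I, r ≤ s → dist r s ≤ 1 / 2 ^ m₀ →
      η < |fluctPath α a X ε t ω r - fluctPath α a X ε t ω s| → ∃ r s : ℝ, 0 ≤ r ∧ r ≤ s ∧ s ≤ 1 ∧
        s - r ≤ 1 / 2 ^ m₀ ∧ 40 * (9 / 10 : ℝ) ^ m₀ + 4 / (a * √((t : ℝ) ^ (1 / α))) <
          |stepFluct a ((t : ℝ) ^ (1 / α)) (ε ω, fun j => X j t ω) s -
            stepFluct a ((t : ℝ) ^ (1 / α)) (ε ω, fun j => X j t ω) r| := by
    intro r s hrs hd hlt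
    refine ⟨r, s, r.2.1, hrs, s.2.2, ?_, ?_⟩
    · rw [Subtype.dist_eq, Real.dist_eq, abs_sub_comm] at hd
      exact (le_abs_self _).trans hd
    · rw [fluctPath_apply hω.1, fluctPath_apply hω.1] at hlt
      have h1 := abs_le.1 (abs_fluct_sub_stepFluct_le (α := α) hω.1 hω.2 r.2.1)
      have h2 := abs_le.1 (abs_fluct_sub_stepFluct_le (α := α) hω.1 hω.2 s.2.1)
      have h3 : 4 / (a * √((t : ℝ) ^ (1 / α))) =
          (4 / a + 2) / √((t : ℝ) ^ (1 / α)) - 2 * (1 / √((t : ℝ) ^ (1 / α))) := by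
        rw [add_div, div_div]
        ring
      rw [h3]
      rcases lt_abs.1 hlt with h | h
      · exact lt_abs.2 (Or.inr (by linarith))
      · exact lt_abs.2 (Or.inl (by linarith))
  rintro ⟨r, s, hd, hlt⟩
  rcases le_total r s with h | h
  · exact key r s h hd hlt
  · exact key s r h (by rwa [dist_comm]) (by rwa [abs_sub_comm])

theorem exists_tendstoInDistribution_fluctPath (hα : 0 < α) (hc : 0 < c) (ha : 0 < a)
    (hX : ∀ t, IsPerturbedLattice (μ t) (fun j => X j t) ε P)
    (hμ : ∀ t θ, charFun (μ t) θ = ((Real.exp (-((t : ℝ) * c * |θ| ^ α)) : ℝ) : ℂ)) :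
    ∃ Q : ProbabilityMeasure C(I, ℝ),
      HasGaussianCharFun (limitCov α c a) (Q : Measure C(I, ℝ)) ∧
      TendstoInDistribution (fun t : ℝ≥0 => fluctPath α a X ε t) atTop
        (id : C(I, ℝ) → C(I, ℝ)) (fun _ => P) (Q : Measure C(I, ℝ)) := by
  have hmeas : ∀ t, AEMeasurable (fluctPath α a X ε t) P := fun t =>
    aemeasurable_fluctPath_of_stable hα hc ha (hX t) (hμ t)
  have hsq := tendsto_sqrt_rpow_atTop hα
  suffices h : ∃ Q : ProbabilityMeasure C(I, ℝ),
      HasGaussianCharFun (limitCov α c a) (Q : Measure C(I, ℝ)) ∧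
      Tendsto (β := ProbabilityMeasure C(I, ℝ)) (fun t : ℝ≥0 => ⟨P.map (fluctPath α a X ε t),
        Measure.isProbabilityMeasure_map (hmeas t)⟩) atTop (𝓝 Q) by
    obtain ⟨Q, hQ, hlim⟩ := h
    refine ⟨Q, hQ, hmeas, aemeasurable_id, ?_⟩
    have hid : (⟨(Q : Measure C(I, ℝ)).map id, Measure.isProbabilityMeasure_map aemeasurable_id⟩ :
        ProbabilityMeasure C(I, ℝ)) = Q := Subtype.ext (Measure.map_id (μ := (Q : Measure C(I, ℝ))))
    rw [hid]
    exact hlim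
  refine exists_tendsto_of_charFun_of_oscSet ?_ ?_ ?_
  · intro t
    have hm : MeasurableSet {g : C(I, ℝ) | g 0 ≠ 0} :=
      (measurable_pathEval 0) (measurableSet_singleton 0).compl
    show P.map (fluctPath α a X ε t) {g | g 0 ≠ 0} = 0
    rw [Measure.map_apply_of_aemeasurable (hmeas t) hm]
    refine measure_eq_zero_iff_ae_notMem.2 ?_
    rcases eq_zero_or_pos t with rfl | ht
    · refine Eventually.of_forall fun ω hω => hω ?_
      rw [fluctPath_time_zero hα.ne']
      rfl
    · filter_upwards [ae_isRegularConfig_of_stable hα hc ha (hX t) (hμ t) ht] with ω hω h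
      refine h ?_
      rw [fluctPath_apply hω.1]
      exact fluct_zero hω.1 hω.2
  · intro ι _ s θ
    rw [tendsto_iff_norm_sub_tendsto_zero]
    set S := ∑ k, |θ k|
    have hS : Tendsto (fun t : ℝ≥0 => S / √((t : ℝ) ^ (1 / α))) atTop (𝓝 0) :=
      tendsto_const_nhds.div_atTop hsq
    have hS' := hS.mul_const (2 * ∑ k, ∑ l, θ k * θ l * limitCov α c a (s k) (s l) + 6)
    rw [zero_mul] at hS'
    refine squeeze_zero' (Eventually.of_forall fun t => norm_nonneg _) ?_ hS'
    filter_upwards [eventually_gt_atTop 0, hS.eventually_le_const (by norm_num : (0 : ℝ) < 1 / 2)]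
      with t ht hθ
    show ‖∫ g, Complex.exp ((∑ i, θ i * g (s i) : ℝ) * Complex.I)
      ∂(P.map (fluctPath α a X ε t)) - _‖ ≤ _
    rw [integral_map (hmeas t) (Continuous.aestronglyMeasurable ?_)]
    · exact norm_integral_cexp_fluctPath_sub_le hα hc ha (hX t) (hμ t) ht s θ hθ
    · have := fun i => continuous_pathEval (s i)
      fun_prop
  · intro η hη κ hκ
    have h1 : Tendsto (fun m : ℕ => 40 * (9 / 10 : ℝ) ^ m) atTop (𝓝 0) := by
      simpa using (tendsto_pow_atTop_nhds_zero_of_lt_one (by norm_num : (0 : ℝ) ≤ 9 / 10)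
        (by norm_num)).const_mul 40
    have h2 : Tendsto (fun m : ℕ => ENNReal.ofReal
        (64 * (1 / a + 1) ^ 2 * ((5000 / 6561) ^ m / (1 - 5000 / 6561)))) atTop (𝓝 0) := by
      have := ((tendsto_pow_atTop_nhds_zero_of_lt_one (by norm_num : (0 : ℝ) ≤ 5000 / 6561)
        (by norm_num)).div_const (1 - 5000 / 6561)).const_mul (64 * (1 / a + 1) ^ 2)
      simpa using ENNReal.tendsto_ofReal this
    -- `m₀` is fixed first, making the chaining sum and the exceptional probability small; then `t`
    -- is taken large enough for the terms in `1/√T` and for `2^{m₀} ≤ T`.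
    obtain ⟨m₀, hm1, hm2⟩ := ((h1.eventually_lt_const (half_pos hη)).and
      (h2.eventually_le_const hκ)).exists
    refine ⟨1 / 2 ^ m₀, by positivity, ?_⟩
    have h3 : Tendsto (fun t : ℝ≥0 => (4 / a + 2) / √((t : ℝ) ^ (1 / α))) atTop (𝓝 0) :=
      tendsto_const_nhds.div_atTop hsq
    filter_upwards [eventually_gt_atTop 0, h3.eventually_le_const (half_pos hη),
      hsq.eventually_ge_atTop (2 ^ m₀)] with t ht ht3 ht4
    have hT : 2 ^ m₀ ≤ (t : ℝ) ^ (1 / α) := by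
      have h5 : (1 : ℝ) ≤ 2 ^ m₀ := one_le_pow₀ one_le_two
      have h6 := Real.sq_sqrt (Real.rpow_nonneg t.2 (1 / α))
      change √((t : ℝ) ^ (1 / α)) ^ 2 = (t : ℝ) ^ (1 / α) at h6
      nlinarith
    show P.map (fluctPath α a X ε t) (oscSet (1 / 2 ^ m₀) η) ≤ κ
    rw [Measure.map_apply_of_aemeasurable (hmeas t) (isOpen_oscSet _ _).measurableSet]
    exact (measure_oscSet_fluctPath_le hα hc ha (hX t) (hμ t) ht hT (by linarith)).trans hm2

lemma isLimitLaw_iff_hasGaussianCharFun {Q : Measure C(I, ℝ)} [IsProbabilityMeasure Q] :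
    IsLimitLaw α c a Q ↔ HasGaussianCharFun (limitCov α c a) Q := by
  rw [hasGaussianCharFun_iff fun r s => by
    simp only [limitCov, abs_sub_comm (r : ℝ) s, add_comm (limitVar α c a r)]]
  exact ⟨fun h => ⟨h.gaussian, h.centered, h.covariance_eq⟩, fun h => ⟨h.1, h.2.1, h.2.2⟩⟩

lemma isLimitLaw_iff_eq {Q : ProbabilityMeasure C(I, ℝ)}
    (hQ : HasGaussianCharFun (limitCov α c a) (Q : Measure C(I, ℝ)))
    (Q' : ProbabilityMeasure C(I, ℝ)) :
    IsLimitLaw α c a (Q' : Measure C(I, ℝ)) ↔ Q' = Q := by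
  rw [isLimitLaw_iff_hasGaussianCharFun]
  refine ⟨fun h => ?_, fun h => h ▸ hQ⟩
  have h' : (Q' : Measure C(I, ℝ)) = Q :=
    eq_of_integral_cexp_sum_eq fun s θ => (h s θ).trans (hQ s θ).symm
  exact Subtype.ext h'

end StableSystem

end StableFluct

theorem mainTheorem8 {Ω : Type*} [MeasurableSpace Ω] (P : Measure Ω) [IsProbabilityMeasure P]
    (α c a : ℝ) (hα : 0 < α) (hα2 : α ≤ 2) (hc : 0 < c) (ha : 0 < a)
    (X : ℤ → ℝ≥0 → Ω → ℝ) (ε : Ω → ℝ)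
    (hX : ∀ j, StableFluct.IsSymmetricStableProcess α c (X j) P)
    (hXindep : iIndepFun (fun (j : ℤ) (ω : Ω) (t : ℝ≥0) => X j t ω) P)
    (hε : Measurable ε) (hεunif : pdf.IsUniform ε (Set.Icc (0 : ℝ) 1) P volume)
    (hεX : IndepFun ε (fun (ω : Ω) (p : ℤ × ℝ≥0) => X p.1 p.2 ω) P) :
    (∀ t : ℝ≥0, 0 < t → ∀ᵐ ω ∂P,
      (∀ x : ℝ, {j : ℤ | StableFluct.position a X ε t ω j ∈ Set.Icc 0 x}.Finite) ∧
      Continuous (fun s : unitInterval => StableFluct.fluct α a X ε t ω (s : ℝ))) ∧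
    ∃ Q : ProbabilityMeasure C(unitInterval, ℝ),
      (∀ Q' : ProbabilityMeasure C(unitInterval, ℝ),
        StableFluct.IsLimitLaw α c a (Q' : Measure C(unitInterval, ℝ)) ↔ Q' = Q) ∧
      TendstoInDistribution (fun t : ℝ≥0 => StableFluct.fluctPath α a X ε t) atTop
        (id : C(unitInterval, ℝ) → C(unitInterval, ℝ)) (fun _ => P)
        (Q : Measure C(unitInterval, ℝ)) := by
  have hμ : ∀ t θ, charFun (P.map (X 0 t)) θ =
      ((Real.exp (-((t : ℝ) * c * |θ| ^ α)) : ℝ) : ℂ) := (hX 0).charFun_eq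
  have hprob : ∀ j t, IsProbabilityMeasure (P.map (X j t)) := fun j t =>
    Measure.isProbabilityMeasure_map ((hX j).levy.measurable t).aemeasurable
  -- At each fixed time the particles are a perturbed lattice; equal characteristic functions give
  -- all displacements the law of `X 0 t`.
  have hlat : ∀ t, StableFluct.IsPerturbedLattice (P.map (X 0 t)) (fun j => X j t) ε P := fun t =>
    { measurable := fun j => (hX j).levy.measurable t
      indep := hXindep.comp (fun _ f => f t) fun _ => measurable_pi_apply t
      law := fun j => Measure.ext_of_charFun (funext fun θ => by
        rw [hμ, (hX j).charFun_eq])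
      measurable_shift := hε
      indep_shift := hεX.comp (φ := id)
        (ψ := fun (f : ℤ × ℝ≥0 → ℝ) (j : ℤ) => f (j, t)) measurable_id
        (measurable_pi_lambda _ fun j => measurable_pi_apply (j, t)) }
  refine ⟨fun t ht => ?_, ?_⟩
  · filter_upwards [StableFluct.ae_isRegularConfig_of_stable (μ := fun t => P.map (X 0 t)) hα hc ha
      (hlat t) (hμ t) ht] with ω hω
    exact ⟨hω.1.finite, StableFluct.continuous_fluct hω.1⟩
  · obtain ⟨Q, hQ, hlim⟩ := StableFluct.exists_tendstoInDistribution_fluctPath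
      (μ := fun t => P.map (X 0 t)) hα hc ha hlat hμ
    exact ⟨Q, StableFluct.isLimitLaw_iff_eq hQ, hlim⟩
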